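/- Let $D_1,\dots,D_n$ be pairwise disjoint closed disks in the Euclidean plane, each with a positive radius and a weight $\omega_i\in\{0,\infty\}$; outside the disks the weight is $1$. The weighted length of a rectifiable curve is the integral along it of the weight, where the boundary of $D_i$ has weight $\min\{1,\omega_i\}$. For $u\in\partial D_i$ and $v\in\partial D_j$ (possibly $i=j$), let $\delta(u,v)$ be a weighted shortest path from $u$ to $v$ when $D_i$ and $D_j$ are the only disks in the plane, and let $\lVert\delta(u,v)\rVert$ be its weighted length. A \emph{tangent edge} $e(u,v)$ from $D=D_i$ to $D'=D_j$ ($i\ne j$) is given by a common tangent of $D$ and $D'$ with tangency points $u\in\partial D$ and $v\in\partial D'$ such that $\delta(u,v)$ can be chosen so that it does not meet the interior of any of the $n$ disks. Let $C(D)=\{x: d(x,D)\le d(x,D_k)\text{ for all }k\}$ be the cell of $D$ in the Voronoi diagram of the disks. Two disks are neighbors if their cells share a Voronoi edge, and a Voronoi vertex of $C(D)$ is a point of $C(D)$ that lies in at least two other cells. On the boundary of each disk $D$ let a finite set of \emph{distinguished points} be given that contains, for all neighbors $D'$ of $D$ and all Voronoi vertices $p$ of $C(D)$: (1) the tangency points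 on $D$ of the common tangents of $D$ and $D'$; (2) the closest point on $D$ to $D'$; (3) the tangency points on $D$ of the tangent lines of $D$ through $p$; (4) the closest point on $D$ to $p$; and, in addition, enough points that the tangent directions at any two consecutive distinguished points of a disk differ by at most $\pi/2$ (every closed arc of central angle $\pi/2$ contains a distinguished point). (a) Let $e(u,v)$ be a tangent edge with $u\in\partial D$, let $u$ lie strictly between two consecutive distinguished points of $D$, and let $u''$ be one of these two points. If the subarc $\widehat{u''u}$ followed by the segment $\overline{uv}$ is not a convex chain (that is, it is not contained in the boundary of its convex hull), then $\lVert\delta(u,v)\rVert\ge\lVert\delta(u,u'')\rVert$. (b) Consequently all edges of the coalesced graph have non-negative weight. The vertices of this graph are the directed intervals, that is, the distinguished points $(u',u')$ and the open arcs $(u',u'')$ between consecutive distinguished points, each with one of its two directions of traversal. A tangent edge $e(u,v)$ yields an edge of weight $\lVert\delta(u,v)\rVert-\lVert\delta(u,u'')\rVert+\lVert\delta(v,v'')\rVert$ from the host interval $(u',u'')$ of $u$ to the host interval $(v',v'')$ of $v$: these are the directed intervals that contain $u$ and $v$ and whose traversals pass $u$ and $v$ in the direction of $v-u$. For consecutive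 distinguished points $u',u''$ of a disk, in either direction, there are an edge of weight $\lVert\delta(u',u'')\rVert$ from $(u',u')$ to $(u',u'')$ and an edge of weight $0$ from $(u',u'')$ to $(u'',u'')$, with the same direction. -/

import Mathlib

open scoped ENNReal NNReal
open Set

/-- A scene of `n` pairwise disjoint closed disks in the Euclidean plane `ℂ`, each of them of
weight `0` or `∞` (the weight outside of all disks is `1`). -/
structure DiskScene (n : ℕ) where
  center : Fin n → ℂ
  radius : Fin n → ℝ
  radius_pos : ∀ i, 0 < radius i
  disjoint : ∀ i j, i ≠ j →
    Disjoint (Metric.closedBall (center i) (radius i)) (Metric.closedBall (center j) (radius j))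
  weight : Fin n → ℝ≥0∞
  weight_eq : ∀ i, weight i = 0 ∨ weight i = ⊤

/-- `γ`, restricted to `[0,1]`, is a path from `p` to `q`: a rectifiable curve, given by a
Lipschitz parametrization. -/
def IsPathBetween (γ : ℝ → ℂ) (p q : ℂ) : Prop :=
  (∃ K : ℝ≥0, LipschitzOnWith K γ (Icc 0 1)) ∧ γ 0 = p ∧ γ 1 = q

/-- A chain (a curve, given as a set of points) is convex if it lies on the boundary of its
convex hull. -/
def IsConvexChain (A : Set ℂ) : Prop := A ⊆ frontier (convexHull ℝ A)

namespace DiskScene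

variable {n : ℕ} (S : DiskScene n)

/-- The (closed) disk `D_i`. -/
def disk (i : Fin n) : Set ℂ := Metric.closedBall (S.center i) (S.radius i)

/-- The point of the boundary circle of `D_i` at the (counterclockwise) angle `θ`. -/
noncomputable def bdry (i : Fin n) (θ : ℝ) : ℂ :=
  S.center i + S.radius i * Complex.exp (θ * Complex.I)

/-- The arc of the boundary of `D_i` swept by the angles between `θ` and `φ`. -/
def arc (i : Fin n) (θ φ : ℝ) : Set ℂ := S.bdry i '' uIcc θ φ

/-! ### The weighted region metric -/

open Classical in
/-- The factor by which `D_i` changes the cost `1` of a unit of length at `x`: it is `ω_i` in the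
interior of `D_i`, `min {1, ω_i}` on its boundary, and `1` elsewhere. -/
noncomputable def costFactor (i : Fin n) (x : ℂ) : ℝ≥0∞ :=
  if x ∈ Metric.ball (S.center i) (S.radius i) then S.weight i
  else if x ∈ Metric.sphere (S.center i) (S.radius i) then min 1 (S.weight i)
  else 1

/-- The cost of a unit of length at `x` if the disks with index in `A` are the only ones. The
disks are disjoint, so at most one factor differs from `1`. -/
noncomputable def cost (A : Finset (Fin n)) (x : ℂ) : ℝ≥0∞ := ∏ i ∈ A, S.costFactor i x

/-- The weighted length of `γ` on `[0,1]` if the disks with index in `A` are the only ones. -/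
noncomputable def weightedLength (A : Finset (Fin n)) (γ : ℝ → ℂ) : ℝ≥0∞ :=
  ∫⁻ t in Icc (0 : ℝ) 1, S.cost A (γ t) * ‖deriv γ t‖ₑ

/-- `‖δ(u,v)‖`, for `u` on `D_i` and `v` on `D_j`: the weighted length of a weighted shortest path
from `u` to `v` if `D_i` and `D_j` (possibly `i = j`) are the only disks. -/
noncomputable def deltaLength (i j : Fin n) (u v : ℂ) : ℝ≥0∞ :=
  ⨅ (γ : ℝ → ℂ) (_ : IsPathBetween γ u v), S.weightedLength {i, j} γ

/-- `γ` is a path `δ(u,v)`: a weighted shortest path from `u` to `v` if `D_i` and `D_j` are the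
only disks. -/
def IsDelta (i j : Fin n) (u v : ℂ) (γ : ℝ → ℂ) : Prop :=
  IsPathBetween γ u v ∧ S.weightedLength {i, j} γ = S.deltaLength i j u v

/-! ### Tangents and the visibility graph -/

/-- The line through `z` and `p` is tangent to `D_i` at `z` (for `p ≠ z`). -/
def TangentAt (i : Fin n) (z p : ℂ) : Prop :=
  z ∈ Metric.sphere (S.center i) (S.radius i) ∧ inner ℝ (p - z) (z - S.center i) = 0

/-- `u` on `D_i` and `v` on `D_j` are the tangency points of a common tangent of the two disks. -/
def CommonTangent (i j : Fin n) (u v : ℂ) : Prop :=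
  i ≠ j ∧ S.TangentAt i u v ∧ S.TangentAt j v u

/-- The (directed) tangent edge `e(u,v)` of the extended visibility graph, from `u` on `D_i` to
`v` on `D_j`: `u` and `v` are the tangency points of a common tangent, and `δ(u,v)` does not
meet the interior of any disk of the scene. (`δ(u,v)` is determined up to its part in the disks of
weight `0`, through which one moves at no cost, for instance along the boundary.) -/
def TangentEdge (i j : Fin n) (u v : ℂ) : Prop :=
  S.CommonTangent i j u v ∧
    ∃ γ : ℝ → ℂ, S.IsDelta i j u v γ ∧
      ∀ t ∈ Icc (0 : ℝ) 1, ∀ k, γ t ∉ Metric.ball (S.center k) (S.radius k)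

/-! ### The Voronoi diagram of the disks -/

/-- The Voronoi cell `C(D_i)`. -/
def cell (i : Fin n) : Set ℂ :=
  {x | ∀ j, Metric.infDist x (S.disk i) ≤ Metric.infDist x (S.disk j)}

/-- `D_i` and `D_j` are neighbors: their cells share a Voronoi edge, that is, a point that is in
no third cell (such a point lies in the relative interior of an edge, since the cells are closed). -/
def Neighbor (i j : Fin n) : Prop :=
  i ≠ j ∧ ∃ x, x ∈ S.cell i ∧ x ∈ S.cell j ∧ ∀ k, k ≠ i → k ≠ j → x ∉ S.cell k

/-- `p` is a Voronoi vertex of `C(D_i)`: a point of this cell and of at least two other cells. -/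
def VoronoiVertex (i : Fin n) (p : ℂ) : Prop :=
  p ∈ S.cell i ∧ ∃ j k, j ≠ i ∧ k ≠ i ∧ j ≠ k ∧ p ∈ S.cell j ∧ p ∈ S.cell k

/-! ### Distinguished points -/

/-- Type (1): tangency points on `D_i` of the common tangents with its neighbors. -/
def type1 (i : Fin n) : Set ℂ := {x | ∃ j, S.Neighbor i j ∧ ∃ v, S.CommonTangent i j x v}

/-- Type (2): the closest points on `D_i` to its neighbors. -/
def type2 (i : Fin n) : Set ℂ :=
  {y | y ∈ S.disk i ∧ ∃ j, S.Neighbor i j ∧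
    ∀ z ∈ S.disk i, Metric.infDist y (S.disk j) ≤ Metric.infDist z (S.disk j)}

/-- Type (3): tangency points on `D_i` of its tangent lines through the Voronoi vertices of
`C(D_i)`. -/
def type3 (i : Fin n) : Set ℂ := {z | ∃ p, S.VoronoiVertex i p ∧ S.TangentAt i z p}

/-- Type (4): the closest points on `D_i` to the Voronoi vertices of `C(D_i)`. -/
def type4 (i : Fin n) : Set ℂ :=
  {w | w ∈ S.disk i ∧ ∃ p, S.VoronoiVertex i p ∧ ∀ z ∈ S.disk i, dist p w ≤ dist p z}

/-- `P i` is the set of distinguished points of `D_i`: a finite set of boundary points with all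
points of the types (1) to (4), and with so many more that the tangent directions at any two
consecutive ones differ by at most `π / 2`, that is, each closed arc of angle `π / 2` contains
one of them. -/
structure IsDistinguished (P : Fin n → Set ℂ) : Prop where
  finite : ∀ i, (P i).Finite
  subset_sphere : ∀ i, P i ⊆ Metric.sphere (S.center i) (S.radius i)
  type1_subset : ∀ i, S.type1 i ⊆ P i
  type2_subset : ∀ i, S.type2 i ⊆ P i
  type3_subset : ∀ i, S.type3 i ⊆ P i
  type4_subset : ∀ i, S.type4 i ⊆ P i
  gap : ∀ i θ, ∃ φ ∈ Icc θ (θ + Real.pi / 2), S.bdry i φ ∈ P i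

/-- The points of `D_i` at the angles `α < β` are distinguished and consecutive: there is no
distinguished point at an angle strictly between. -/
def Consecutive (P : Fin n → Set ℂ) (i : Fin n) (α β : ℝ) : Prop :=
  α < β ∧ S.bdry i α ∈ P i ∧ S.bdry i β ∈ P i ∧ ∀ θ ∈ Ioo α β, S.bdry i θ ∉ P i

end DiskScene

/-- A directed interval on the boundary of the disk of index `idx`, from `src` to `tgt`, traversed
counterclockwise if `ccw = true` and clockwise otherwise. If `src ≠ tgt` it is the open arc between
the two points, and if `src = tgt` it is the closed interval that consists of this point. -/
structure DirectedInterval (n : ℕ) where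
  idx : Fin n
  ccw : Bool
  src : ℂ
  tgt : ℂ

namespace DiskScene

variable {n : ℕ} (S : DiskScene n)

/-! ### The coalesced graph -/

/-- The angles `θ₁` and `θ₂` are those of the two ends, in the direction of traversal, of an open
directed interval between consecutive distinguished points. -/
def ConsecutiveDir (P : Fin n → Set ℂ) (i : Fin n) (ccw : Bool) (θ₁ θ₂ : ℝ) : Prop :=
  if ccw then S.Consecutive P i θ₁ θ₂ else S.Consecutive P i θ₂ θ₁

/-- `d` is the direction (a positive multiple of the velocity) in which a point that runs around
`D_i` counterclockwise (`ccw = true`) or clockwise (`ccw = false`) passes `x`. -/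
def PassesAlong (i : Fin n) (ccw : Bool) (x d : ℂ) : Prop :=
  ∃ r : ℝ, 0 < r ∧ d = (if ccw then r else -r : ℝ) * (Complex.I * (x - S.center i))

/-- `h` is the host interval of the boundary point `x` of `D_i` for a tangent edge of direction `d`
with end `x`: it contains `x`, and its traversal passes `x` in the direction `d` (so that the
transition between the arc and the edge is forward going). -/
inductive Host (P : Fin n → Set ℂ) (i : Fin n) (x d : ℂ) : DirectedInterval n → Prop
  | point (s : Bool) (hx : x ∈ P i) (hd : S.PassesAlong i s x d) : Host P i x d ⟨i, s, x, x⟩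
  | interval (s : Bool) (θ₁ θ θ₂ : ℝ) (hcons : S.ConsecutiveDir P i s θ₁ θ₂)
      (hθ : θ ∈ Ioo (min θ₁ θ₂) (max θ₁ θ₂)) (hx : x = S.bdry i θ) (hd : S.PassesAlong i s x d) :
      Host P i x d ⟨i, s, S.bdry i θ₁, S.bdry i θ₂⟩

/-- `S.CoalescedEdge P a b w`: the coalesced graph has an edge of weight `w` from `a` to `b`. -/
inductive CoalescedEdge (P : Fin n → Set ℂ) :
    DirectedInterval n → DirectedInterval n → EReal → Prop
  | tangent (i j : Fin n) (u v : ℂ) (a b : DirectedInterval n) (he : S.TangentEdge i j u v)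
      (ha : S.Host P i u (v - u) a) (hb : S.Host P j v (v - u) b) :
      CoalescedEdge P a b
        ((S.deltaLength i j u v : EReal) - (S.deltaLength i i u a.tgt : EReal)
          + (S.deltaLength j j v b.tgt : EReal))
  | arcEnter (i : Fin n) (s : Bool) (θ₁ θ₂ : ℝ) (hcons : S.ConsecutiveDir P i s θ₁ θ₂) :
      CoalescedEdge P ⟨i, s, S.bdry i θ₁, S.bdry i θ₁⟩ ⟨i, s, S.bdry i θ₁, S.bdry i θ₂⟩
        (S.deltaLength i i (S.bdry i θ₁) (S.bdry i θ₂) : EReal)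
  | arcLeave (i : Fin n) (s : Bool) (θ₁ θ₂ : ℝ) (hcons : S.ConsecutiveDir P i s θ₁ θ₂) :
      CoalescedEdge P ⟨i, s, S.bdry i θ₁, S.bdry i θ₂⟩ ⟨i, s, S.bdry i θ₂, S.bdry i θ₂⟩ 0

end DiskScene

/-! Everything rests on one comparison, `deltaLength_arc_le_of_tangentEdge`: an arc of `D_i` of
angle at most `π / 2` that starts at `u` in the direction of a tangent edge and has no distinguished
point before its end costs no more than the edge. Claim (a) follows, because an arc that the edge
continues forward forms a convex chain with it (`isConvexChain_arc_union_segment`); a non-convex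
chain therefore means that `u''` lies in the direction of the edge. Claim (b) follows, because the
same direction selects the host interval of `u`.

If `D_i` has weight `0`, the arc is free. Otherwise suppose that the edge is cheaper than the arc.
Up to its first contact with `D_j`, a shortest path is the segment `uv` if `D_j` has weight `∞`; if
`D_j` has weight `0`, it is a segment from `u` aimed at the center of `D_j` (inner tangent), or an
arc of `D_i` followed by a tangent segment aimed at this center (outer tangent). In each case some
segment from `D_i` to `D_j` avoids all open disks, and the arc, measured from the start of the
segment, is longer than the segment.

Over an arc without distinguished points, a single neighbor `D_k` bounds the Voronoi cell of `D_i`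
(`exists_bounds_on_arc`): a change of the bounding disk would produce a point of type (4), and an
escape of the cell to infinity one of type (1). Moreover `D_k` is not `D_j`, since `u` would then be
of type (1). The empty ball that touches `D_i` and `D_k` rolls along the arc. It has to pass over
the segment, whose far end it never swallows because this end lies in `D_j`. By `rolling_ball` and
`disk_on_right_side` this forces `D_k` to the right of the segment.

If the segment is tangent to `D_i`, then `D_k` lies below the tangent and cannot bound the cell in
the starting direction (`tangent_segment_blocked`). For an inner tangent, `D_k` reaches into the
wedge between the segment and the tangent; then `exists_angle_le` finds an inner tangency point
(type (1)) or the point of `D_i` closest to `D_k` (type (2)) on the arc (`inner_segment_blocked`).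
-/

/-! ### A ball rolling between two disks -/

set_option maxHeartbeats 600000 in
/-- Let balls with centers `(m t, ν t)` and radii `ρ t` move so that they always touch the disk of
radius `s` around `(P, Q)` and never contain `(ℓ, 0)` in their interiors. If the disk does not
meet the segment from the origin to `(ℓ, 0)`, and the balls have to pass over that segment, then
the disk touches the first ball, or it touches the segment, on the side of positive second
coordinates. -/
lemma rolling_ball {ℓ s P Q : ℝ} {m ν ρ : ℝ → ℝ} (hℓ : 0 < ℓ) (hs : 0 < s)
    (hm : ContinuousOn m (Icc 0 ℓ)) (hν : ContinuousOn ν (Icc 0 ℓ))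
    (hρ : ContinuousOn ρ (Icc 0 ℓ))
    (hρ0 : ∀ t ∈ Icc 0 ℓ, 0 < ρ t)
    (htan : ∀ t ∈ Icc 0 ℓ, (P - m t) ^ 2 + (Q - ν t) ^ 2 = (ρ t + s) ^ 2)
    (hout : ∀ t ∈ Icc 0 ℓ, ρ t ^ 2 ≤ (m t - ℓ) ^ 2 + ν t ^ 2)
    (hlow : ∀ t ∈ Icc 0 ℓ, m t = ℓ → -ρ t < ν t)
    (hm0 : m 0 ≤ ℓ) (hmℓ : ν ℓ ≤ ρ ℓ → ℓ ≤ m ℓ)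
    (hpos : ∀ t ∈ Icc 0 ℓ, ∀ σ, (σ - m t) ^ 2 + ν t ^ 2 ≤ ρ t ^ 2 → 0 ≤ σ)
    (hblock : ∀ σ ∈ Icc 0 ℓ, s ^ 2 ≤ (P - σ) ^ 2 + Q ^ 2)
    (hend : s ^ 2 < (P - ℓ) ^ 2 + Q ^ 2) (hstart : s ^ 2 < P ^ 2 + Q ^ 2) :
    0 < ν 0 * s + ρ 0 * Q ∨ (0 < P ∧ P < ℓ ∧ Q = s) := by
  have hup : ∀ t ∈ Icc 0 ℓ, ν t - ρ t - s ≤ Q := fun t ht ↦ by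
    have h1 := htan t ht
    have h2 := hρ0 t ht
    nlinarith [sq_nonneg (P - m t)]
  -- `ν t * s + ρ t * Q` is `ρ t + s` times the second coordinate of the point where the ball and
  -- the disk touch.
  have hle : ∀ t ∈ Icc 0 ℓ, ν t * s + ρ t * Q ≤ 0 → ν t ≤ ρ t := fun t ht h ↦ by
    have h1 := hup t ht
    have h2 := hρ0 t ht
    by_contra! h3
    nlinarith
  -- A ball centered above `(ℓ, 0)` whose contact with the disk is not above the axis would have to
  -- rest on the axis at `(ℓ, 0)`, and the disk would touch this point too, against `hend`.
  have hmid : ∀ t ∈ Icc 0 ℓ, m t = ℓ → ν t * s + ρ t * Q ≤ 0 → False := fun t ht hmt h ↦ by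
    have h1 := hup t ht
    have h2 := hρ0 t ht
    have h3 := hle t ht h
    have h4 := hlow t ht hmt
    have h5 := hout t ht
    have h6 := htan t ht
    rw [hmt] at h5 h6
    have h7 : ν t = ρ t := by nlinarith
    rw [h7] at h h6 h1
    have h8 : Q = -s := by nlinarith
    rw [h8] at h6 hend
    nlinarith
  have hmlt : ∀ a ∈ Icc 0 ℓ, (∀ t ∈ Icc 0 a, ν t * s + ρ t * Q ≤ 0) → m a < ℓ := fun a ha h ↦ by
    by_contra! hc
    obtain ⟨t, ht, hmt⟩ := intermediate_value_Icc ha.1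
      (hm.mono (Icc_subset_Icc_right ha.2)) ⟨hm0, hc⟩
    exact hmid t ⟨ht.1, ht.2.trans ha.2⟩ hmt (h t ht)
  have hφ : ContinuousOn (fun t ↦ ν t * s + ρ t * Q) (Icc 0 ℓ) := by fun_prop
  by_cases hall : ∀ t ∈ Icc 0 ℓ, ν t * s + ρ t * Q ≤ 0
  · have hr : ℓ ∈ Icc 0 ℓ := right_mem_Icc.2 hℓ.le
    exact absurd (hmℓ (hle ℓ hr (hall ℓ hr))) (hmlt ℓ hr hall).not_ge
  push Not at hall
  obtain ⟨b, hb, hφb⟩ := hall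
  by_cases h0 : 0 < ν 0 * s + ρ 0 * Q
  · exact Or.inl h0
  right
  push Not at h0
  -- `a` is the first time at which the point of contact is on the axis.
  obtain ⟨a, ⟨⟨ha, hφa⟩, hleast⟩⟩ : ∃ a, IsLeast {t | t ∈ Icc 0 ℓ ∧ 0 ≤ ν t * s + ρ t * Q} a := by
    refine IsCompact.exists_isLeast ?_ ⟨b, hb, hφb.le⟩
    exact isCompact_Icc.of_isClosed_subset
      (hφ.preimage_isClosed_of_isClosed isClosed_Icc isClosed_Ici) fun t ht ↦ ht.1
  have hneg : ∀ t ∈ Icc 0 a, t ≠ a → ν t * s + ρ t * Q < 0 := fun t ht hta ↦ by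
    by_contra! hc
    exact hta (le_antisymm ht.2 (hleast ⟨⟨ht.1, ht.2.trans ha.2⟩, hc⟩))
  have hφa0 : ν a * s + ρ a * Q = 0 := by
    obtain ⟨t, ht, hφt⟩ := intermediate_value_Icc ha.1
      (hφ.mono (Icc_subset_Icc_right ha.2)) ⟨h0, hφa⟩
    by_cases hta : t = a
    · simpa [hta] using hφt
    · exact absurd hφt (hneg t ht hta).ne
  have hma : m a < ℓ := hmlt a ha fun t ht ↦ by
    by_cases hta : t = a
    · rw [hta, hφa0]
    · exact (hneg t ht hta).le
  have hρa := hρ0 a ha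
  have hta := htan a ha
  -- The first coordinate of the point of contact at time `a`.
  obtain ⟨w, hw⟩ : ∃ w, w = m a + ρ a / (ρ a + s) * (P - m a) := ⟨_, rfl⟩
  have hne : ρ a + s ≠ 0 := by positivity
  have hνa : ν a = -(ρ a / (ρ a + s)) * (Q - ν a) := by
    field_simp
    linarith
  have hQa : Q = s / (ρ a + s) * (Q - ν a) := by
    field_simp
    linarith
  have hw1 : (w - m a) ^ 2 + ν a ^ 2 = ρ a ^ 2 := by
    calc (w - m a) ^ 2 + ν a ^ 2
        = (ρ a / (ρ a + s)) ^ 2 * ((P - m a) ^ 2 + (Q - ν a) ^ 2) := by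
          conv_lhs => rw [hνa, hw]
          ring
      _ = ρ a ^ 2 := by rw [hta]; field_simp
  have hw2 : (P - w) ^ 2 + Q ^ 2 = s ^ 2 := by
    have hPw : P - w = s / (ρ a + s) * (P - m a) := by
      rw [hw]; field_simp; ring
    calc (P - w) ^ 2 + Q ^ 2
        = (s / (ρ a + s)) ^ 2 * ((P - m a) ^ 2 + (Q - ν a) ^ 2) := by
          conv_lhs => rw [hQa, hPw]
          ring
      _ = s ^ 2 := by rw [hta]; field_simp
  have hw0 : 0 < w := by
    rcases (hpos a ha w hw1.le).lt_or_eq with h | h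
    · exact h
    · rw [← h] at hw2
      nlinarith
  have hwℓ : w < ℓ := by
    by_contra! hc
    rcases hc.lt_or_eq with h | h
    · have := hout a ha
      nlinarith
    · rw [← h] at hw2
      linarith
  -- Otherwise a small move along the segment from `w` towards `P` would enter the disk.
  have hPw : P = w := by
    by_contra hne
    have key : ∀ δ, w + δ ∈ Icc 0 ℓ → 0 ≤ -2 * δ * (P - w) + δ ^ 2 := fun δ hδ ↦ by
      nlinarith [hblock _ hδ]
    rcases lt_or_gt_of_ne hne with h | h
    · have h1 : 0 < min (w - P) w := lt_min (by linarith) hw0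
      have h2 := key (-min (w - P) w) ⟨by linarith [min_le_right (w - P) w], by linarith⟩
      have h3 := mul_le_mul_of_nonneg_left (min_le_left (w - P) w) h1.le
      linarith [mul_pos h1 h1]
    · have h1 : 0 < min (P - w) (ℓ - w) := lt_min (by linarith) (by linarith)
      have h2 := key (min (P - w) (ℓ - w)) ⟨by linarith, by linarith [min_le_right (P - w) (ℓ - w)]⟩
      have h3 := mul_le_mul_of_nonneg_left (min_le_left (P - w) (ℓ - w)) h1.le
      linarith [mul_pos h1 h1]
  refine ⟨hPw ▸ hw0, hPw ▸ hwℓ, ?_⟩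
  have hQ2 : Q ^ 2 = s ^ 2 := by rw [hPw] at hw2; linarith
  rcases sq_eq_sq_iff_eq_or_eq_neg.1 hQ2 with h | h
  · exact h
  -- A disk below the axis cannot touch a ball above the axis, as it does at time `b`.
  · have h1 := hup b hb
    have h2 := hρ0 b hb
    rw [h] at hφb h1
    linarith [mul_le_mul_of_nonneg_right (show ν b ≤ ρ b by linarith) hs.le]

/-! ### Rolling along the unit circle -/

lemma mul_cos_le_sin {t : ℝ} (h0 : 0 ≤ t) (h1 : t ≤ Real.pi / 2) : t * Real.cos t ≤ Real.sin t := by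
  rcases h1.lt_or_eq with h | h
  · have hc : 0 < Real.cos t := Real.cos_pos_of_mem_Ioo ⟨by linarith [Real.pi_pos], h⟩
    have := Real.le_tan h0 h
    rwa [Real.tan_eq_sin_div_cos, le_div_iff₀ hc] at this
  · rw [h]; simp

/-- Both `sin t - t cos t` and `t sin t - 1 + cos t` are at least `t - sin t`; the claim is their
combination with coefficients `S` and `C`, where `S + C ≥ 1`. It serves to show that the last ball
has passed the end of the segment, which is `hmℓ` in `rolling_ball`. -/
lemma rolling_trig {t S C : ℝ} (h0 : 0 ≤ t) (h1 : t < Real.pi / 2) (hS : 0 ≤ S) (hC : 0 ≤ C)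
    (hSC : S ^ 2 + C ^ 2 = 1) :
    t * (1 - C * Real.sin t + S * Real.cos t) ≤ (1 + S) * Real.sin t - C * (1 - Real.cos t) := by
  have hpi := Real.pi_pos
  have hc : 0 < Real.cos t := Real.cos_pos_of_mem_Ioo ⟨by linarith, h1⟩
  have hs1 := Real.sin_le_one t
  have hs0 : 0 ≤ Real.sin t := Real.sin_nonneg_of_nonneg_of_le_pi h0 (by linarith)
  have hst : Real.sin t ≤ t := Real.sin_le h0
  have hsq := Real.sin_sq_add_cos_sq t
  have htc := mul_cos_le_sin h0 h1.le
  have hhalf : t * (1 + Real.cos t) ≤ 2 * Real.sin t := by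
    have h2 := mul_cos_le_sin (t := t / 2) (by linarith) (by linarith)
    have hc2 : 0 < Real.cos (t / 2) := Real.cos_pos_of_mem_Ioo ⟨by linarith, by linarith⟩
    have e1 : Real.sin t = 2 * Real.sin (t / 2) * Real.cos (t / 2) := by
      rw [← Real.sin_two_mul]; ring_nf
    have e2 : Real.cos t = 2 * Real.cos (t / 2) ^ 2 - 1 := by
      rw [← Real.cos_two_mul]; ring_nf
    rw [e1, e2]
    nlinarith
  have h2 : (1 + t) * (1 - Real.sin t) ≤ Real.cos t := by
    have hc1 := Real.cos_le_one t
    have h3 : (1 + t) * Real.cos t ≤ 1 + Real.sin t := by linarith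
    have h4 : (1 + t) * (1 - Real.sin t) * Real.cos t ≤ Real.cos t * Real.cos t := by
      nlinarith [mul_le_mul_of_nonneg_left h3 (sub_nonneg.2 hs1)]
    exact le_of_mul_le_mul_right h4 hc
  have hS1 : S ≤ 1 := by nlinarith
  have hC1 : C ≤ 1 := by nlinarith
  have hsum : 1 ≤ S + C := by nlinarith
  have ha : t - Real.sin t ≤ Real.sin t - t * Real.cos t := by linarith
  have hb : t - Real.sin t ≤ t * Real.sin t - 1 + Real.cos t := by nlinarith
  nlinarith [mul_le_mul_of_nonneg_left ha hS, mul_le_mul_of_nonneg_left hb hC,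
    mul_nonneg (sub_nonneg.2 hsum) (sub_nonneg.2 hst)]

set_option maxHeartbeats 1000000 in
/-- The unit disk around the origin is separated from the point at distance `ℓ` of `(0, 1)` in
direction `(S, C)` by the balls that touch both the unit disk, at the points `(sin t, cos t)`, and
the disk of radius `s` around `(d₁, d₂)`. -/
lemma disk_on_right_side {ℓ s d₁ d₂ S C : ℝ} (hℓ : 0 < ℓ) (hℓ' : ℓ < Real.pi / 2) (hs : 0 < s)
    (hS : 0 ≤ S) (hC : 0 ≤ C) (hSC : S ^ 2 + C ^ 2 = 1) (hD : (1 + s) ^ 2 < d₁ ^ 2 + d₂ ^ 2)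
    {R : ℝ → ℝ}
    (hq : ∀ t ∈ Icc 0 ℓ, 0 < s - 1 + d₁ * Real.sin t + d₂ * Real.cos t)
    (hR : ∀ t ∈ Icc 0 ℓ, R t = (d₁ ^ 2 + d₂ ^ 2 - (s - 1) ^ 2) /
      (2 * (s - 1 + d₁ * Real.sin t + d₂ * Real.cos t)))
    (hB : ∀ t ∈ Icc 0 ℓ, (R t - 1) ^ 2 ≤
      (ℓ * S - R t * Real.sin t) ^ 2 + (1 + ℓ * C - R t * Real.cos t) ^ 2)
    (hblock : ∀ σ ∈ Icc 0 ℓ, s ^ 2 ≤ (d₁ - σ * S) ^ 2 + (d₂ - (1 + σ * C)) ^ 2)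
    (hend : s ^ 2 < (d₁ - ℓ * S) ^ 2 + (d₂ - (1 + ℓ * C)) ^ 2) :
    S * s < C * d₁ - S * (d₂ - 1) ∨
      (0 < S * d₁ + C * (d₂ - 1) ∧ S * d₁ + C * (d₂ - 1) < ℓ ∧ C * d₁ - S * (d₂ - 1) = s) := by
  have hpi := Real.pi_pos
  have hsin : ∀ t ∈ Icc 0 ℓ, 0 ≤ Real.sin t := fun t ht ↦
    Real.sin_nonneg_of_nonneg_of_le_pi ht.1 (by linarith [ht.2])
  have hcos : ∀ t ∈ Icc 0 ℓ, 0 < Real.cos t := fun t ht ↦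
    Real.cos_pos_of_mem_Ioo ⟨by linarith [ht.1], by linarith [ht.2]⟩
  -- This is the condition that the ball of center `R t (sin t, cos t)` and radius `R t - 1` touches
  -- the disk of radius `s`; the squares of `R t` cancel.
  have hRq : ∀ t ∈ Icc 0 ℓ, 2 * R t * (s - 1 + d₁ * Real.sin t + d₂ * Real.cos t) =
      d₁ ^ 2 + d₂ ^ 2 - (s - 1) ^ 2 := fun t ht ↦ by
    rw [hR t ht]
    have := (hq t ht).ne'
    field_simp
  have hfar : ∀ x y : ℝ, x ^ 2 + y ^ 2 = 1 → s ^ 2 < (d₁ - x) ^ 2 + (d₂ - y) ^ 2 := fun x y h ↦ by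
    have h1 : (d₁ * x + d₂ * y) ^ 2 ≤ d₁ ^ 2 + d₂ ^ 2 := by
      nlinarith [sq_nonneg (d₁ * y - d₂ * x)]
    obtain ⟨D, hD0, hD2⟩ : ∃ D : ℝ, 0 ≤ D ∧ D ^ 2 = d₁ ^ 2 + d₂ ^ 2 :=
      ⟨√(d₁ ^ 2 + d₂ ^ 2), Real.sqrt_nonneg _, Real.sq_sqrt (by positivity)⟩
    rw [← hD2] at h1 hD
    have h2 : 1 + s < D := lt_of_pow_lt_pow_left₀ 2 hD0 hD
    have h3 : d₁ * x + d₂ * y ≤ D := le_of_sq_le_sq h1 hD0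
    nlinarith
  have hR1 : ∀ t ∈ Icc 0 ℓ, 1 < R t := fun t ht ↦ by
    rw [hR t ht, lt_div_iff₀ (by linarith [hq t ht])]
    nlinarith [hfar _ _ (Real.sin_sq_add_cos_sq t), Real.sin_sq_add_cos_sq t]
  have hRc : ContinuousOn R (Icc 0 ℓ) := by
    refine ContinuousOn.congr ?_ hR
    refine ContinuousOn.div (by fun_prop) (by fun_prop) fun t ht ↦ ?_
    linarith [hq t ht]
  have hdot : ∀ t ∈ Icc 0 ℓ, 0 ≤ S * Real.sin t + C * Real.cos t := fun t ht ↦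
    add_nonneg (mul_nonneg hS (hsin t ht)) (mul_nonneg hC (hcos t ht).le)
  have h0 : (0 : ℝ) ∈ Icc 0 ℓ := ⟨le_rfl, hℓ.le⟩
  have hr : ℓ ∈ Icc 0 ℓ := ⟨hℓ.le, le_rfl⟩
  have hS1 : S ≤ 1 := by nlinarith
  -- In these coordinates the segment lies on the first axis, and its right side becomes the side of
  -- positive second coordinates.
  have main := rolling_ball (P := S * d₁ + C * (d₂ - 1)) (Q := C * d₁ - S * (d₂ - 1))
    (m := fun t ↦ R t * (S * Real.sin t + C * Real.cos t) - C)
    (ν := fun t ↦ R t * (C * Real.sin t - S * Real.cos t) + S)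
    (ρ := fun t ↦ R t - 1) hℓ hs (by fun_prop) (by fun_prop) (by fun_prop)
    (fun t ht ↦ by linarith [hR1 t ht]) ?_ ?_ ?_ ?_ ?_ ?_ ?_ ?_ ?_
  · refine main.imp_left fun h ↦ ?_
    have h1 := hR1 0 h0
    simp only [Real.sin_zero, Real.cos_zero] at h
    have : 0 < (R 0 - 1) * (C * d₁ - S * (d₂ - 1) - S * s) := by linarith
    have := pos_of_mul_pos_right this (by linarith)
    linarith
  · intro t ht
    have h1 := hRq t ht
    have h2 := Real.sin_sq_add_cos_sq t
    have h3 : ∀ x y : ℝ, (S * d₁ + C * (d₂ - 1) - (R t * (S * x + C * y) - C)) ^ 2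
        + (C * d₁ - S * (d₂ - 1) - (R t * (C * x - S * y) + S)) ^ 2
        = (S ^ 2 + C ^ 2) * ((d₁ - R t * x) ^ 2 + (d₂ - R t * y) ^ 2) := fun x y ↦ by
      have hh : (S * d₁ + C * (d₂ - 1) - (R t * (S * x + C * y) - C)) =
        S * (d₁ - R t * x) + C * (d₂ - R t * y) := by ring
      have hh' : (C * d₁ - S * (d₂ - 1) - (R t * (C * x - S * y) + S)) =
        C * (d₁ - R t * x) - S * (d₂ - R t * y) := by ring
      rw [hh, hh']; ring
    rw [h3, hSC]
    linear_combination (-1) * h1 + R t ^ 2 * h2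
  · intro t ht
    refine (hB t ht).trans (le_of_eq ?_)
    have h3 : ∀ x y : ℝ, (R t * (S * x + C * y) - C - ℓ) ^ 2 + (R t * (C * x - S * y) + S) ^ 2
        - ((ℓ * S - R t * x) ^ 2 + (1 + ℓ * C - R t * y) ^ 2) =
        (S ^ 2 + C ^ 2 - 1) * (R t ^ 2 * (x ^ 2 + y ^ 2) - 2 * R t * y + 1 - ℓ ^ 2) := fun x y ↦ by
      ring
    have h4 := h3 (Real.sin t) (Real.cos t)
    rw [hSC, sub_self, zero_mul] at h4
    linarith
  · intro t ht hmt
    have h1 := hR1 t ht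
    have h2 := hsin t ht
    have h3 := Real.cos_le_one t
    have h4 := mul_nonneg hC h2
    rcases hS1.lt_or_eq with h | h
    · have h5 : 0 ≤ S * (1 - Real.cos t) := mul_nonneg hS (by linarith)
      have h6 : 0 ≤ R t := by linarith
      linarith [mul_nonneg h6 h4, mul_nonneg h6 h5, mul_pos (sub_pos.2 h1) (sub_pos.2 h)]
    · have hC0 : C = 0 := by nlinarith
      simp only [h, hC0, zero_mul, one_mul, add_zero, sub_zero, zero_sub] at hmt ⊢
      have h5 : 0 < Real.sin t := by
        rcases h2.lt_or_eq with h6 | h6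
        · exact h6
        · rw [← h6] at hmt; linarith
      have h6 := Real.sin_sq_add_cos_sq t
      have h7 : Real.cos t < 1 := by nlinarith
      nlinarith
  · have h1 := hB 0 h0
    simp only [Real.sin_zero, Real.cos_zero, mul_zero, sub_zero, mul_one, zero_add] at h1 ⊢
    have h2 : 2 * C * (R 0 - 1) * ℓ ≤ ℓ * ℓ := by nlinarith
    have h3 := le_of_mul_le_mul_right h2 hℓ
    nlinarith [hR1 0 h0]
  · intro hν
    have h1 := rolling_trig hℓ.le hℓ' hS hC hSC
    have h2 := hR1 ℓ hr
    have h3 := hdot ℓ hr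
    set x := Real.sin ℓ
    set y := Real.cos ℓ
    have h4 : 1 + S ≤ R ℓ * (1 - C * x + S * y) := by linarith
    have h5 : 0 < 1 - C * x + S * y := by
      by_contra! hc
      nlinarith
    have h6 : (1 + S) * (S * x + C * y) ≤ R ℓ * (S * x + C * y) * (1 - C * x + S * y) := by
      nlinarith
    have h7 : (1 + S) * (S * x + C * y) - C * (1 - C * x + S * y) =
        (1 + S) * x - C * (1 - y) + (S ^ 2 + C ^ 2 - 1) * x := by ring
    rw [hSC] at h7
    have h8 : ℓ * (1 - C * x + S * y) ≤ (R ℓ * (S * x + C * y) - C) * (1 - C * x + S * y) := by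
      linarith
    exact le_of_mul_le_mul_right h8 h5
  · intro t ht σ h
    have h1 := hR1 t ht
    have h2 := hdot t ht
    have h3 := Real.sin_sq_add_cos_sq t
    have h4 := hcos t ht
    have h5 := Real.cos_le_one t
    have h6 : σ ^ 2 - 2 * σ * (R t * (S * Real.sin t + C * Real.cos t) - C)
        + 2 * R t * (1 - Real.cos t) ≤ 0 := by
      have e : ∀ x y : ℝ, (σ - (R t * (S * x + C * y) - C)) ^ 2 + (R t * (C * x - S * y) + S) ^ 2
        = σ ^ 2 - 2 * σ * (R t * (S * x + C * y) - C) + (S ^ 2 + C ^ 2) * (R t ^ 2 * (x ^ 2 + y ^ 2)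
          - 2 * R t * y + 1) := fun x y ↦ by ring
      have e' := e (Real.sin t) (Real.cos t)
      rw [hSC, h3] at e'
      linarith
    by_contra! hσ
    have hC1 : C ≤ 1 := by nlinarith
    have h7 : C * Real.cos t ≤ R t * (S * Real.sin t + C * Real.cos t) := by
      linarith [mul_nonneg hS (hsin t ht), mul_nonneg (sub_nonneg.2 h1.le) h2]
    have h8 := mul_le_mul_of_nonpos_left h7 hσ.le
    have h9 : 0 ≤ (1 - C) * (1 - Real.cos t) * (-σ) :=
      mul_nonneg (mul_nonneg (by linarith) (by linarith)) (by linarith)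
    have h10 : 0 ≤ (R t - 1) * (1 - Real.cos t) := mul_nonneg (by linarith) (by linarith)
    have h11 : σ ^ 2 + 2 * σ * (1 - Real.cos t) + 2 * (1 - Real.cos t) ≤ 0 := by linarith
    have h12 : 0 ≤ (1 - Real.cos t) * Real.cos t := mul_nonneg (by linarith) h4.le
    have h13 : Real.cos t = 1 := by
      nlinarith [sq_nonneg (σ + (1 - Real.cos t))]
    rw [h13] at h11
    nlinarith
  · intro σ hσ
    refine (hblock σ hσ).trans (le_of_eq ?_)
    linear_combination (-((d₁) ^ 2 + (d₂ - 1) ^ 2 - σ ^ 2)) * hSC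
  · refine hend.trans_eq ?_
    linear_combination (-((d₁) ^ 2 + (d₂ - 1) ^ 2 - ℓ ^ 2)) * hSC
  · have := hfar 0 1 (by norm_num)
    refine this.trans_eq ?_
    linear_combination (-((d₁) ^ 2 + (d₂ - 1) ^ 2)) * hSC

/-! ### A disk wedged between a segment and a tangent -/

lemma add_sq_le_of_sq_le {a₁ a₂ b₁ b₂ r s : ℝ} (hr : 0 ≤ r) (hs : 0 ≤ s)
    (ha : a₁ ^ 2 + a₂ ^ 2 ≤ r ^ 2) (hb : b₁ ^ 2 + b₂ ^ 2 ≤ s ^ 2) :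
    (a₁ + b₁) ^ 2 + (a₂ + b₂) ^ 2 ≤ (r + s) ^ 2 := by
  have h : (a₁ * b₁ + a₂ * b₂) ^ 2 ≤ (r * s) ^ 2 := by
    have h1 := mul_le_mul ha hb (by positivity) (by positivity)
    nlinarith [sq_nonneg (a₁ * b₂ - a₂ * b₁)]
  have h2 := le_of_sq_le_sq h (by positivity)
  nlinarith

/-- The ball of radius `ρ` rests on the line `y = 0` at the origin, below the disk of radius `r`
that rests on this line at `(L, 0)`. A disk of radius `s` touches the ball, or the segment from
the origin to `(L, r)`, from the right. Then it has a point in the triangle below this segment. -/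
lemma exists_mem_triangle_of_touching {L r s ρ X Y ℓ : ℝ} (hL : 0 < L) (hr : 0 < r) (hs : 0 < s)
    (hρ : 0 < ρ) (hℓ : 0 < ℓ) (hℓr : (ℓ + r) ^ 2 = L ^ 2 + r ^ 2)
    (htan : X ^ 2 = (Y + s) * (2 * ρ + s - Y)) (hρL : 4 * r * ρ ≤ L ^ 2) (hX : 0 < X)
    (halt : L * s < r * X - L * Y ∨
      (0 < L * X + r * Y ∧ L * X + r * Y < ℓ * (ℓ + r) ∧ r * X - L * Y = (ℓ + r) * s)) :
    ∃ x y, x < L ∧ 0 < y ∧ L * y ≤ r * x ∧ (x - X) ^ 2 + (y - Y) ^ 2 ≤ s ^ 2 := by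
  have hm : 0 < ℓ + r := by linarith
  rcases halt with h | ⟨h1, h2, h3⟩
  · have hne : ρ + s ≠ 0 := by positivity
    obtain ⟨w, hw⟩ : ∃ w, w = ρ / (ρ + s) := ⟨_, rfl⟩
    have hw0 : 0 < w := by rw [hw]; positivity
    have hws : (1 - w) * (ρ + s) = s := by rw [hw]; field_simp; ring
    have hws' : w * (ρ + s) = ρ := by rw [hw]; field_simp
    have hxy : L * (ρ + w * (Y - ρ)) < r * (w * X) := by
      have h4 := mul_lt_mul_of_pos_left h hw0
      have : L * ρ = L * w * (ρ + s) := by rw [mul_assoc, hws']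
      linarith
    have hdist : X ^ 2 + (Y - ρ) ^ 2 = (ρ + s) ^ 2 := by rw [htan]; ring
    have hball : (w * X) ^ 2 + (w * (Y - ρ)) ^ 2 = ρ ^ 2 := by
      rw [mul_pow, mul_pow, ← mul_add, hdist, ← mul_pow, hws']
    have hXw : 0 < w * X := mul_pos hw0 hX
    have hy : 0 < ρ + w * (Y - ρ) := by nlinarith
    refine ⟨w * X, ρ + w * (Y - ρ), ?_, hy, hxy.le, ?_⟩
    -- The point of contact is on the circle of radius `ρ`, so `x² ≤ 2ρy ≤ 2ρrx / L`, and `4rρ ≤ L²`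
    -- gives `x ≤ L / 2`.
    · by_contra! hc
      have h5 : (w * X) ^ 2 ≤ 2 * ρ * (ρ + w * (Y - ρ)) := by nlinarith
      have h6 : L * (w * X) * (w * X) ≤ 2 * ρ * r * (w * X) := by nlinarith
      have h7 := le_of_mul_le_mul_right h6 hXw
      nlinarith
    · have e : (w * X - X) ^ 2 + (ρ + w * (Y - ρ) - Y) ^ 2 =
        (1 - w) ^ 2 * (X ^ 2 + (Y - ρ) ^ 2) := by ring
      rw [e, hdist, ← mul_pow, hws]
  · have hm2 : 0 < (ℓ + r) ^ 2 := by positivity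
    -- The foot of the perpendicular from `(X, Y)` to the segment, where the disk touches it.
    refine ⟨(L * X + r * Y) * L / (ℓ + r) ^ 2, (L * X + r * Y) * r / (ℓ + r) ^ 2, ?_,
      by positivity, le_of_eq (by ring), ?_⟩
    · rw [div_lt_iff₀ hm2, mul_comm L (_ ^ 2)]
      have : L * X + r * Y < (ℓ + r) ^ 2 := by linarith [mul_pos hm hr]
      exact mul_lt_mul_of_pos_right this hL
    · have e2 : (ℓ + r) ^ 2 * (((L * X + r * Y) * L / (ℓ + r) ^ 2 - X) ^ 2 +
          ((L * X + r * Y) * r / (ℓ + r) ^ 2 - Y) ^ 2) = (r * X - L * Y) ^ 2 := by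
        have a1 : (L * X + r * Y) * L / (ℓ + r) ^ 2 - X = -(r * (r * X - L * Y)) / (ℓ + r) ^ 2 := by
          field_simp; rw [hℓr]; ring
        have a2 : (L * X + r * Y) * r / (ℓ + r) ^ 2 - Y = L * (r * X - L * Y) / (ℓ + r) ^ 2 := by
          field_simp; rw [hℓr]; ring
        rw [a1, a2]
        have a3 : (ℓ + r) ^ 2 * ((-(r * (r * X - L * Y)) / (ℓ + r) ^ 2) ^ 2 +
          (L * (r * X - L * Y) / (ℓ + r) ^ 2) ^ 2) =
          (L ^ 2 + r ^ 2) * (r * X - L * Y) ^ 2 / (ℓ + r) ^ 2 := by field_simp; ring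
        rw [a3, ← hℓr]; field_simp
      rw [h3, mul_pow] at e2
      exact (mul_left_cancel₀ hm2.ne' e2).le

/-- If `L < X`, the chord from `(x, y)` to the topmost point `(X, Y + s)` stays above the axis and
not above the line through the origin and `(L, r)`. It then crosses the vertical radius below `(L,
r)`, so that the two disks meet. -/
lemma le_of_segment_not_crossing {L r s X Y x y : ℝ} (hr : 0 < r) (hs : 0 < s) (hL : 0 < L)
    (hθ : 0 < Y + s) (hdisj : (r + s) ^ 2 < (X - L) ^ 2 + (Y - r) ^ 2)
    (hf : L * (Y + s) ≤ r * X) (hx : x < L) (hy : 0 < y) (hxy : L * y ≤ r * x)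
    (hp : (x - X) ^ 2 + (y - Y) ^ 2 ≤ s ^ 2) : X ≤ L := by
  by_contra! hX
  obtain ⟨w, hw⟩ : ∃ w, w = (L - x) / (X - x) := ⟨_, rfl⟩
  have hXx : 0 < X - x := by linarith
  have hw0 : 0 < w := by rw [hw]; exact div_pos (by linarith) hXx
  have hw1 : w < 1 := by rw [hw, div_lt_one hXx]; linarith
  have hwL : x + w * (X - x) = L := by rw [hw]; field_simp; ring
  obtain ⟨z, hz⟩ : ∃ z, z = y + w * (Y + s - y) := ⟨_, rfl⟩
  have hz0 : 0 < z := by nlinarith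
  have hzr : z ≤ r := by
    have h1 : L * z ≤ r * L := by
      calc L * z = (1 - w) * (L * y) + w * (L * (Y + s)) := by rw [hz]; ring
        _ ≤ (1 - w) * (r * x) + w * (r * X) := by gcongr
        _ = r * L := by rw [← hwL]; ring
    nlinarith
  have hz2 : (L - X) ^ 2 + (z - Y) ^ 2 ≤ s ^ 2 := by
    have e : (L - X) ^ 2 + (z - Y) ^ 2 = (1 - w) * ((x - X) ^ 2 + (y - Y) ^ 2) + w * s ^ 2
        - w * (1 - w) * ((x - X) ^ 2 + (y - (Y + s)) ^ 2) := by
      rw [hz, ← hwL]; ring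
    have : 0 ≤ w * (1 - w) * ((x - X) ^ 2 + (y - (Y + s)) ^ 2) :=
      mul_nonneg (mul_nonneg hw0.le (by linarith)) (by positivity)
    linarith [mul_le_mul_of_nonneg_left hp (sub_nonneg.2 hw1.le)]
  have h1 := add_sq_le_of_sq_le (a₁ := 0) (a₂ := r - z) (b₁ := L - X) (b₂ := z - Y) hr.le hs.le
    (by nlinarith) hz2
  have e : (0 + (L - X)) ^ 2 + (r - z + (z - Y)) ^ 2 = (X - L) ^ 2 + (Y - r) ^ 2 := by ring
  linarith

/-- The ball of radius `ρ` rests on the line `y = 0` at the origin, below the disk of radius `r`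
that rests on this line at `(L, 0)`. A disk of radius `s` touches the ball to the right of the
segment between the origin and `(L, r)`. Then its topmost point is to the left of `(L, r)`. -/
lemma center_le_of_touching {L r s ρ X Y ℓ : ℝ} (hL : 0 < L) (hr : 0 < r) (hs : 0 < s) (hρ : 0 < ρ)
    (hℓ : 0 < ℓ) (hℓr : (ℓ + r) ^ 2 = L ^ 2 + r ^ 2) (hθ : 0 < Y + s)
    (htan : X ^ 2 = (Y + s) * (2 * ρ + s - Y)) (hρL : 4 * r * ρ ≤ L ^ 2)
    (hdisj : (r + s) ^ 2 < (X - L) ^ 2 + (Y - r) ^ 2)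
    (halt : L * s < r * X - L * Y ∨
      (0 < L * X + r * Y ∧ L * X + r * Y < ℓ * (ℓ + r) ∧ r * X - L * Y = (ℓ + r) * s)) :
    X ≤ L ∧ L * (Y + s) ≤ r * X := by
  have hLm : L ≤ ℓ + r := le_of_sq_le_sq (by nlinarith) (by linarith)
  have hf : L * (Y + s) ≤ r * X := by
    rcases halt with h | ⟨-, -, h⟩
    · linarith
    · linarith [mul_le_mul_of_nonneg_right hLm hs.le]
  have hX : 0 < X := by
    have : 0 < r * X := lt_of_lt_of_le (mul_pos hL hθ) hf
    exact pos_of_mul_pos_right this hr.le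
  obtain ⟨x, y, hx, hy, hxy, hp⟩ :=
    exists_mem_triangle_of_touching hL hr hs hρ hℓ hℓr htan hρL hX halt
  exact ⟨le_of_segment_not_crossing hr hs hL hθ hdisj hf hx hy hxy hp, hf⟩

/-- Here `(X, θ)` is the topmost point of the wedged disk, which lies outside the disk of radius
`r`. If both alternatives fail, then `ℓ < X ≤ L` and `θ > 2rℓ / (ℓ + 2r)`, which is too close to
`(L, r)`: the estimates would give `(2r + ℓ)² < (2r - ℓ)² + 8rℓ`, but the two sides are equal. -/
lemma le_or_mul_le_sq {L r θ ρ X ℓ : ℝ} (hL : 0 < L) (hr : 0 < r) (hℓ : 0 < ℓ)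
    (hℓr : (ℓ + r) ^ 2 = L ^ 2 + r ^ 2) (hρL : 4 * r * ρ ≤ L ^ 2) (hθ : 0 < θ) (hθr : θ ≤ r)
    (hXL : X ≤ L) (htopr : r ^ 2 < (X - L) ^ 2 + (θ - r) ^ 2) : X ≤ ℓ ∨ 2 * ρ * θ ≤ ℓ ^ 2 := by
  have hLm : L < ℓ + r := lt_of_pow_lt_pow_left₀ 2 (by linarith) (by nlinarith)
  by_contra! hc
  obtain ⟨h1, h2⟩ := hc
  have hL2 : L ^ 2 = ℓ * (ℓ + 2 * r) := by nlinarith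
  have h3 : 2 * r * ℓ < θ * (ℓ + 2 * r) := by
    have h4 : 2 * r * ℓ ^ 2 < θ * (ℓ * (ℓ + 2 * r)) := by
      rw [← hL2]; nlinarith
    have h5 : ℓ * (2 * r * ℓ) < ℓ * (θ * (ℓ + 2 * r)) := by linarith
    exact lt_of_mul_lt_mul_left h5 hℓ.le
  have h4 : ℓ < 2 * r := by nlinarith
  have h5 : (r - θ) * (ℓ + 2 * r) < r * (2 * r - ℓ) := by linarith
  have h6 : r ^ 2 < (L - ℓ) ^ 2 + (r - θ) ^ 2 := by nlinarith
  have h7 : (r - θ) ^ 2 * (ℓ + 2 * r) ^ 2 ≤ (r * (2 * r - ℓ)) ^ 2 := by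
    rw [← mul_pow]
    exact pow_le_pow_left₀ (mul_nonneg (by linarith) (by linarith)) h5.le 2
  have h8 : (ℓ + r - L) * (ℓ + r + L) = r ^ 2 := by linarith
  have h9 : (ℓ + 2 * r) ^ 2 ≤ 4 * r * (ℓ + r + L) := by nlinarith
  have h10 : (ℓ + r - L) * (ℓ + 2 * r) ^ 2 ≤ 4 * r * r ^ 2 := by
    calc (ℓ + r - L) * (ℓ + 2 * r) ^ 2 ≤ (ℓ + r - L) * (4 * r * (ℓ + r + L)) :=
          mul_le_mul_of_nonneg_left h9 (by linarith)
      _ = 4 * r * ((ℓ + r - L) * (ℓ + r + L)) := by ring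
      _ = 4 * r * r ^ 2 := by rw [h8]
  have h11 : (L - ℓ) ^ 2 = 2 * ℓ * (ℓ + r - L) := by nlinarith
  have h12 : r ^ 2 * (ℓ + 2 * r) ^ 2 <
      ((L - ℓ) ^ 2 + (r - θ) ^ 2) * (ℓ + 2 * r) ^ 2 :=
    mul_lt_mul_of_pos_right h6 (by positivity)
  rw [h11] at h12
  have h13 : 2 * ℓ * ((ℓ + r - L) * (ℓ + 2 * r) ^ 2) ≤ 2 * ℓ * (4 * r * r ^ 2) :=
    mul_le_mul_of_nonneg_left h10 (by linarith)
  linarith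

/-- The unit disk has its center at `(0, -1)` and sees `(X, Y)` at the angle `arctan (X / (Y + 1)) ≤
X`. Both alternatives of `key` give `X ≤ ℓ`, the second because `s ≤ Y` implies `X² ≤ 2ρ(Y + s)`. -/
lemma exists_angle_of_center {s ρ X Y ℓ : ℝ} (hs : 0 < s) (hℓ : 0 < ℓ) (hX : 0 < X)
    (hθ : 0 < Y + s) (htan : X ^ 2 = (Y + s) * (2 * ρ + s - Y))
    (key : X ≤ ℓ ∨ 2 * ρ * (Y + s) ≤ ℓ ^ 2) (hY : s ≤ Y) :
    ∃ t ∈ Ioc 0 ℓ,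
      X * Real.cos t = (Y + 1) * Real.sin t ∧ 0 < X * Real.sin t + (Y + 1) * Real.cos t := by
  have hXℓ : X ≤ ℓ := by
    rcases key with h | h
    · exact h
    · refine le_of_sq_le_sq ?_ hℓ.le
      linarith [mul_nonneg hθ.le (sub_nonneg.2 hY)]
  have hY1 : 0 < Y + 1 := by linarith
  have hz : 0 < X / (Y + 1) := by positivity
  have hzX : X / (Y + 1) ≤ X := div_le_self hX.le (by linarith)
  have hcos := Real.cos_arctan_pos (X / (Y + 1))
  have htan := Real.tan_arctan (X / (Y + 1))
  rw [Real.tan_eq_sin_div_cos, div_eq_div_iff hcos.ne' hY1.ne'] at htan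
  have hpos := Real.arctan_pos.2 hz
  have hsin : 0 < Real.sin (Real.arctan (X / (Y + 1))) :=
    Real.sin_pos_of_pos_of_lt_pi hpos
      (by linarith [Real.arctan_lt_pi_div_two (X / (Y + 1)), Real.pi_pos])
  refine ⟨Real.arctan (X / (Y + 1)), ⟨hpos, ?_⟩, by linarith, by positivity⟩
  have := Real.le_tan hpos.le (Real.arctan_lt_pi_div_two _)
  rw [Real.tan_arctan] at this
  linarith

/-- For `T = tan (t / 2)`, the inequality `X sin t + (Y + 1) cos t ≥ 1 + s` reads `(2 + Y + s)T² -
2XT + (s - Y) ≤ 0`. It fails at `T = 0`, so any solution `T ≤ ℓ / 2` yields an angle of tangency up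
to `2 arctan T ≤ ℓ`. -/
lemma exists_angle_of_inner_tangent {s ρ X Y ℓ : ℝ} (hℓ : 0 < ℓ) (hX : 0 < X)
    (hθ : 0 < Y + s) (htan : X ^ 2 = (Y + s) * (2 * ρ + s - Y))
    (hD : (1 + s) ^ 2 < X ^ 2 + (Y + 1) ^ 2)
    (key : X ≤ ℓ ∨ 2 * ρ * (Y + s) ≤ ℓ ^ 2) (hY : Y < s) :
    ∃ t ∈ Ioc 0 ℓ, X * Real.sin t + (Y + 1) * Real.cos t = 1 + s := by
  -- The quadratic in `T` has a positive discriminant since the disks are disjoint.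
  have hβ : (s - Y) * (2 + (Y + s)) < X ^ 2 := by nlinarith
  obtain ⟨T, hT0, hTℓ, hT⟩ : ∃ T, 0 ≤ T ∧ T ≤ ℓ / 2 ∧
      (2 + (Y + s)) * T ^ 2 - 2 * X * T + (s - Y) ≤ 0 := by
    have h2 : 0 < 2 + (Y + s) := by linarith
    rcases key with h | h
    -- The vertex of the parabola.
    · refine ⟨X / (2 + (Y + s)), by positivity, ?_, ?_⟩
      · rw [div_le_iff₀ h2]; nlinarith
      · have e : (2 + (Y + s)) * (X / (2 + (Y + s))) ^ 2 - 2 * X * (X / (2 + (Y + s))) + (s - Y) =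
          ((s - Y) * (2 + (Y + s)) - X ^ 2) / (2 + (Y + s)) := by field_simp; ring
        rw [e]
        exact div_nonpos_of_nonpos_of_nonneg (by linarith) h2.le
    -- Now `T` is the geometric mean of the two roots, whose product is `(s - Y) / (2 + Y + s)`.
    · have h3 : 0 ≤ (s - Y) / (2 + (Y + s)) := div_nonneg (by linarith) h2.le
      have hsq := Real.sq_sqrt h3
      have hle : √((s - Y) / (2 + (Y + s))) * (2 + (Y + s)) ≤ X := by
        refine le_of_sq_le_sq ?_ hX.le
        rw [mul_pow, hsq]
        have : (s - Y) / (2 + (Y + s)) * (2 + (Y + s)) ^ 2 = (s - Y) * (2 + (Y + s)) := by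
          field_simp
        linarith
      refine ⟨√((s - Y) / (2 + (Y + s))), Real.sqrt_nonneg _, ?_, ?_⟩
      · refine Real.sqrt_le_iff.2 ⟨by linarith, ?_⟩
        rw [div_le_iff₀ h2]
        have h4 : s - Y ≤ (Y + s) * ρ := by nlinarith
        nlinarith [sq_nonneg ℓ]
      · have h5 : (2 + (Y + s)) * ((s - Y) / (2 + (Y + s))) = s - Y := by field_simp
        rw [hsq, h5]
        have h6 := mul_le_mul_of_nonneg_right hle (Real.sqrt_nonneg ((s - Y) / (2 + (Y + s))))
        nlinarith
  have hTpos : 0 < T := by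
    rcases hT0.lt_or_eq with h | h
    · exact h
    · rw [← h] at hT; nlinarith
  have hval : 0 ≤ X * Real.sin (2 * Real.arctan T) + (Y + 1) * Real.cos (2 * Real.arctan T)
      - (1 + s) := by
    rw [Real.sin_two_mul, Real.cos_two_mul, Real.sin_arctan]
    have hc2 := Real.cos_sq_arctan T
    have hc := Real.cos_arctan T
    have h1 : (0 : ℝ) < 1 + T ^ 2 := by positivity
    have hs1 : √(1 + T ^ 2) ^ 2 = 1 + T ^ 2 := Real.sq_sqrt h1.le
    rw [hc2, hc]
    have : X * (2 * (T / √(1 + T ^ 2)) * (1 / √(1 + T ^ 2))) + (Y + 1) * (2 * (1 / (1 + T ^ 2)) - 1)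
      - (1 + s) = -((2 + (Y + s)) * T ^ 2 - 2 * X * T + (s - Y)) / (1 + T ^ 2) := by
      have : (T / √(1 + T ^ 2)) * (1 / √(1 + T ^ 2)) = T / (1 + T ^ 2) := by
        rw [div_mul_div_comm, mul_one, ← pow_two, hs1]
      rw [mul_assoc 2, this]
      field_simp
      ring
    rw [this]
    exact div_nonneg (by linarith) h1.le
  have h2T : 2 * Real.arctan T ≤ ℓ := by
    have := Real.le_tan (Real.arctan_nonneg.2 hT0) (Real.arctan_lt_pi_div_two T)
    rw [Real.tan_arctan] at this
    linarith
  obtain ⟨t, ht, hft⟩ := intermediate_value_Icc (a := 0) (b := 2 * Real.arctan T)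
    (f := fun t ↦ X * Real.sin t + (Y + 1) * Real.cos t - (1 + s))
    (by linarith [Real.arctan_pos.2 hTpos]) (by fun_prop)
    (show (0 : ℝ) ∈ _ from ⟨by simp only [Real.sin_zero, Real.cos_zero]; linarith, hval⟩)
  simp only at hft
  refine ⟨t, ⟨lt_of_le_of_ne ht.1 fun h ↦ ?_, ht.2.trans h2T⟩, by linarith⟩
  rw [← h] at hft
  simp only [Real.sin_zero, Real.cos_zero] at hft
  linarith

/-- A disk that lies between the unit disk and a disk of radius `r` at distance `ℓ` of `(0, 1)`
faces the unit disk within an angle `ℓ`, or else one of the inner common tangents touches the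
unit disk within an angle `ℓ`. -/
lemma exists_angle_le {L r s ρ X Y ℓ : ℝ} (hL : 0 < L) (hr : 0 < r) (hs : 0 < s)
    (hℓ : 0 < ℓ) (hℓr : (ℓ + r) ^ 2 = L ^ 2 + r ^ 2) (hθ : 0 < Y + s)
    (htan : X ^ 2 = (Y + s) * (2 * ρ + s - Y)) (hρL : 4 * r * ρ ≤ L ^ 2)
    (hD : (1 + s) ^ 2 < X ^ 2 + (Y + 1) ^ 2)
    (hdisj : (r + s) ^ 2 < (X - L) ^ 2 + (Y - r) ^ 2) (hXL : X ≤ L)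
    (htop : L * (Y + s) ≤ r * X) :
    ∃ t ∈ Ioc 0 ℓ, X * Real.sin t + (Y + 1) * Real.cos t = 1 + s ∨
      (X * Real.cos t = (Y + 1) * Real.sin t ∧ 0 < X * Real.sin t + (Y + 1) * Real.cos t) := by
  have hX : 0 < X := by
    have : 0 < r * X := lt_of_lt_of_le (mul_pos hL hθ) htop
    exact pos_of_mul_pos_right this hr.le
  have hθr : Y + s ≤ r := by
    have h1 : L * (Y + s) ≤ L * r := by nlinarith
    exact le_of_mul_le_mul_left h1 hL
  have hLℓ : ℓ < L := lt_of_pow_lt_pow_left₀ 2 hL.le (by nlinarith)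
  have hLm : L < ℓ + r := lt_of_pow_lt_pow_left₀ 2 (by linarith) (by nlinarith)
  have htopr : r ^ 2 < (X - L) ^ 2 + (Y + s - r) ^ 2 := by
    by_contra! hc
    have := add_sq_le_of_sq_le (a₁ := X - L) (a₂ := Y + s - r) (b₁ := 0) (b₂ := -s) hr.le hs.le
      hc (by nlinarith)
    nlinarith
  have key := le_or_mul_le_sq hL hr hℓ hℓr hρL hθ hθr hXL htopr
  rcases le_or_gt s Y with hY | hY
  · obtain ⟨t, ht, h⟩ := exists_angle_of_center hs hℓ hX hθ htan key hY
    exact ⟨t, ht, Or.inr h⟩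
  · obtain ⟨t, ht, h⟩ := exists_angle_of_inner_tangent hℓ hX hθ htan hD key hY
    exact ⟨t, ht, Or.inl h⟩

namespace DiskScene

variable {n : ℕ} (S : DiskScene n)

/-! ### Distances from the disks -/

/-- The component of `d` in the direction of angle `θ`. -/
noncomputable def proj (d : ℂ) (θ : ℝ) : ℝ := d.re * Real.cos θ + d.im * Real.sin θ

lemma bdry_re (i : Fin n) (θ : ℝ) :
    (S.bdry i θ).re = (S.center i).re + S.radius i * Real.cos θ := by
  simp [bdry, Complex.exp_ofReal_mul_I_re]

lemma bdry_im (i : Fin n) (θ : ℝ) :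
    (S.bdry i θ).im = (S.center i).im + S.radius i * Real.sin θ := by
  simp [bdry, Complex.exp_ofReal_mul_I_im]

lemma bdry_mem_sphere (i : Fin n) (θ : ℝ) :
    S.bdry i θ ∈ Metric.sphere (S.center i) (S.radius i) := by
  simp [bdry, (S.radius_pos i).le]

lemma inner_eq_re_im (z w : ℂ) : inner ℝ z w = z.re * w.re + z.im * w.im := by
  simp [Complex.inner]; ring

lemma dist_sq_eq (z w : ℂ) : dist z w ^ 2 = (z.re - w.re) ^ 2 + (z.im - w.im) ^ 2 := by
  rw [Complex.dist_eq, Complex.sq_norm, Complex.normSq_apply]; simp; ring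

lemma norm_sq_eq (z : ℂ) : ‖z‖ ^ 2 = z.re ^ 2 + z.im ^ 2 := by
  rw [Complex.sq_norm, Complex.normSq_apply]; ring

lemma radius_add_lt {i j : Fin n} (h : i ≠ j) :
    S.radius i + S.radius j < ‖S.center j - S.center i‖ := by
  have := S.disjoint i j h
  rwa [disjoint_closedBall_closedBall_iff (S.radius_pos i).le (S.radius_pos j).le, dist_comm,
    dist_eq_norm] at this

lemma infDist_disk_eq (i : Fin n) (x : ℂ) :
    Metric.infDist x (S.disk i) = max 0 (dist x (S.center i) - S.radius i) := by
  have hr := S.radius_pos i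
  have hne : (S.disk i).Nonempty := ⟨S.center i, Metric.mem_closedBall_self hr.le⟩
  refine le_antisymm ?_ (max_le Metric.infDist_nonneg ?_)
  · rcases le_or_gt (dist x (S.center i)) (S.radius i) with h | h
    · rw [Metric.infDist_zero_of_mem (show x ∈ S.disk i from h)]
      exact le_max_left _ _
    · refine le_max_of_le_right ?_
      have hd : 0 < dist x (S.center i) := hr.trans h
      set w : ℝ := S.radius i / dist x (S.center i) with hw
      have hw1 : w < 1 := (div_lt_one hd).2 h
      have hw0 : 0 < w := by positivity
      have hy : S.center i + w * (x - S.center i) ∈ S.disk i := by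
        rw [disk, Metric.mem_closedBall, dist_eq_norm, add_sub_cancel_left, norm_mul,
          Complex.norm_of_nonneg hw0.le, ← dist_eq_norm, hw, div_mul_cancel₀ _ hd.ne']
      refine (Metric.infDist_le_dist_of_mem hy).trans (le_of_eq ?_)
      rw [dist_eq_norm, show x - (S.center i + w * (x - S.center i)) =
        ((1 - w : ℝ) : ℂ) * (x - S.center i) by push_cast; ring, norm_mul,
        Complex.norm_of_nonneg (by linarith), ← dist_eq_norm, sub_mul, one_mul, hw,
        div_mul_cancel₀ _ hd.ne']
  · rw [Metric.le_infDist hne]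
    intro y hy
    have := dist_triangle x y (S.center i)
    rw [disk, Metric.mem_closedBall] at hy
    linarith

/-- The reciprocal of the distance from the center of `D_i`, in the direction `θ`, of the point
that has the same distance from `D_i` and `D_j`. -/
noncomputable def gain (i j : Fin n) (θ : ℝ) : ℝ :=
  2 * (S.radius j - S.radius i + proj (S.center j - S.center i) θ) /
    (‖S.center j - S.center i‖ ^ 2 - (S.radius j - S.radius i) ^ 2)

lemma gain_denom_pos {i j : Fin n} (h : j ≠ i) :
    0 < ‖S.center j - S.center i‖ ^ 2 - (S.radius j - S.radius i) ^ 2 := by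
  have h1 := S.radius_add_lt h.symm
  have h2 := S.radius_pos i
  have h3 := S.radius_pos j
  nlinarith

lemma gain_pos_iff {i j : Fin n} (h : j ≠ i) {θ : ℝ} :
    0 < S.gain i j θ ↔ 0 < S.radius j - S.radius i + proj (S.center j - S.center i) θ := by
  rw [gain, div_pos_iff_of_pos_right (S.gain_denom_pos h)]
  constructor <;> intro <;> linarith

lemma continuous_gain (i j : Fin n) : Continuous (S.gain i j) := by
  unfold gain proj
  fun_prop

/-- The point at distance `R` of the center of `D_i` in the direction `θ`. -/
noncomputable def rayPoint (i : Fin n) (R θ : ℝ) : ℂ :=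
  S.center i + R * Complex.exp (θ * Complex.I)

lemma rayPoint_re (i : Fin n) (R θ : ℝ) :
    (S.rayPoint i R θ).re = (S.center i).re + R * Real.cos θ := by
  simp [rayPoint, Complex.exp_ofReal_mul_I_re]

lemma rayPoint_im (i : Fin n) (R θ : ℝ) :
    (S.rayPoint i R θ).im = (S.center i).im + R * Real.sin θ := by
  simp [rayPoint, Complex.exp_ofReal_mul_I_im]

/-- The squares of `R` cancel, so on a ray from the center of `D_i` the comparison of the distances
from `D_i` and `D_j` is affine in `R` and decided by the sign of `1 - R * gain`. Hence the largest
positive gain determines where the ray leaves the Voronoi cell. -/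
lemma dist_rayPoint_sq {i j : Fin n} (h : j ≠ i) (R θ : ℝ) :
    dist (S.rayPoint i R θ) (S.center j) ^ 2 - (R + (S.radius j - S.radius i)) ^ 2 =
      (‖S.center j - S.center i‖ ^ 2 - (S.radius j - S.radius i) ^ 2) *
        (1 - R * S.gain i j θ) := by
  have hK := (S.gain_denom_pos h).ne'
  have e : (‖S.center j - S.center i‖ ^ 2 - (S.radius j - S.radius i) ^ 2) *
      (1 - R * S.gain i j θ) = ‖S.center j - S.center i‖ ^ 2 - (S.radius j - S.radius i) ^ 2 -
      2 * R * (S.radius j - S.radius i + proj (S.center j - S.center i) θ) := by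
    rw [gain]; field_simp
  rw [e, dist_sq_eq, norm_sq_eq, rayPoint_re, rayPoint_im, proj]
  simp only [Complex.sub_re, Complex.sub_im]
  linear_combination R ^ 2 * Real.sin_sq_add_cos_sq θ

lemma infDist_rayPoint_self (i : Fin n) {R : ℝ} (hR : S.radius i ≤ R) (θ : ℝ) :
    Metric.infDist (S.rayPoint i R θ) (S.disk i) = R - S.radius i := by
  have h0 : 0 ≤ R := (S.radius_pos i).le.trans hR
  rw [infDist_disk_eq, rayPoint, dist_eq_norm, add_sub_cancel_left, norm_mul,
    Complex.norm_exp_ofReal_mul_I, mul_one, Complex.norm_of_nonneg h0, max_eq_right (by linarith)]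

lemma lt_infDist_rayPoint {i j : Fin n} (h : j ≠ i) {R θ : ℝ}
    (hg : R * S.gain i j θ < 1) : R - S.radius i < Metric.infDist (S.rayPoint i R θ) (S.disk j) := by
  have h1 := S.dist_rayPoint_sq h R θ
  have h2 := mul_pos (S.gain_denom_pos h) (sub_pos.2 hg)
  rw [infDist_disk_eq]
  refine lt_max_of_lt_right ?_
  have := lt_of_pow_lt_pow_left₀ 2 (dist_nonneg (x := S.rayPoint i R θ) (y := S.center j))
    (show (R + (S.radius j - S.radius i)) ^ 2 < _ by linarith)
  linarith

lemma infDist_rayPoint_eq {i j : Fin n} (h : j ≠ i) {R θ : ℝ} (hR : S.radius i ≤ R)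
    (hg : R * S.gain i j θ = 1) : Metric.infDist (S.rayPoint i R θ) (S.disk j) = R - S.radius i := by
  have h1 := S.dist_rayPoint_sq h R θ
  rw [hg, sub_self, mul_zero, sub_eq_zero] at h1
  have := (sq_eq_sq₀ dist_nonneg (by linarith [S.radius_pos j])).1 h1
  rw [infDist_disk_eq, this, max_eq_right (by linarith)]
  ring

lemma le_infDist_rayPoint {i j : Fin n} (h : j ≠ i) {R θ : ℝ} (hR : S.radius i ≤ R)
    (hg : R * S.gain i j θ ≤ 1) : R - S.radius i ≤ Metric.infDist (S.rayPoint i R θ) (S.disk j) := by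
  rcases hg.lt_or_eq with hg | hg
  · exact (S.lt_infDist_rayPoint h hg).le
  · exact (S.infDist_rayPoint_eq h hR hg).ge

lemma radius_mul_gain_lt {i j : Fin n} (h : j ≠ i) (θ : ℝ) : S.radius i * S.gain i j θ < 1 := by
  have h1 := S.dist_rayPoint_sq h (S.radius i) θ
  have h2 : S.radius i + S.radius j < dist (S.center i) (S.center j) := by
    rw [dist_comm, dist_eq_norm]; exact S.radius_add_lt h.symm
  have h3 : dist (S.center i) (S.rayPoint i (S.radius i) θ) = S.radius i := by
    rw [dist_comm]; exact S.bdry_mem_sphere i θ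
  have h4 := dist_triangle (S.center i) (S.rayPoint i (S.radius i) θ) (S.center j)
  have h5 : S.radius j < dist (S.rayPoint i (S.radius i) θ) (S.center j) := by linarith
  have h6 := S.radius_pos j
  have h7 : 0 < (‖S.center j - S.center i‖ ^ 2 - (S.radius j - S.radius i) ^ 2) *
      (1 - S.radius i * S.gain i j θ) := by rw [← h1]; nlinarith
  linarith [pos_of_mul_pos_right h7 (S.gain_denom_pos h).le]

/-! ### Recognizing distinguished points -/

/-- The two tangency points of an outer tangent have the same outward normal, hence the same angle
`θ`; the hypothesis says that their tangent lines coincide. -/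
lemma bdry_mem_type1_of_outer {i k : Fin n} (hN : S.Neighbor i k) {θ : ℝ}
    (h : proj (S.center k - S.center i) θ = S.radius i - S.radius k) : S.bdry i θ ∈ S.type1 i := by
  refine ⟨k, hN, S.bdry k θ, hN.1, ⟨S.bdry_mem_sphere i θ, ?_⟩, ⟨S.bdry_mem_sphere k θ, ?_⟩⟩ <;>
  · rw [inner_eq_re_im]
    simp only [Complex.sub_re, Complex.sub_im, bdry_re, bdry_im, proj] at h ⊢
    have := Real.sin_sq_add_cos_sq θ
    first
    | linear_combination S.radius i * h + S.radius i * (S.radius k - S.radius i) * this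
    | linear_combination -S.radius k * h + S.radius k * (S.radius i - S.radius k) * this

/-- For an inner tangent the outward normals are opposite, hence the angle `θ + π` on the second
disk. -/
lemma bdry_mem_type1_of_inner {i k : Fin n} (hN : S.Neighbor i k) {θ : ℝ}
    (h : proj (S.center k - S.center i) θ = S.radius i + S.radius k) : S.bdry i θ ∈ S.type1 i := by
  refine ⟨k, hN, S.bdry k (θ + Real.pi), hN.1, ⟨S.bdry_mem_sphere i θ, ?_⟩,
    ⟨S.bdry_mem_sphere k _, ?_⟩⟩ <;>
  · rw [inner_eq_re_im]
    simp only [Complex.sub_re, Complex.sub_im, bdry_re, bdry_im, proj, Real.cos_add_pi,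
      Real.sin_add_pi] at h ⊢
    have := Real.sin_sq_add_cos_sq θ
    first
    | linear_combination S.radius i * h - S.radius i * (S.radius k + S.radius i) * this
    | linear_combination S.radius k * h - S.radius k * (S.radius i + S.radius k) * this

lemma bdry_mem_type2 {i k : Fin n} (hN : S.Neighbor i k) {θ D : ℝ} (hD : 0 < D)
    (h : S.center k - S.center i = D * Complex.exp (θ * Complex.I)) : S.bdry i θ ∈ S.type2 i := by
  refine ⟨Metric.sphere_subset_closedBall (S.bdry_mem_sphere i θ), k, hN, fun z hz ↦ ?_⟩
  have hnorm : ‖S.center k - S.center i‖ = D := by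
    rw [h, norm_mul, Complex.norm_exp_ofReal_mul_I, mul_one, Complex.norm_of_nonneg hD.le]
  have h1 := S.radius_add_lt hN.1
  have h2 : dist (S.bdry i θ) (S.center k) = D - S.radius i := by
    rw [dist_comm, dist_eq_norm, show S.center k - S.bdry i θ =
      ((D - S.radius i : ℝ) : ℂ) * Complex.exp (θ * Complex.I) by
        rw [bdry, ← sub_sub, h]; push_cast; ring, norm_mul, Complex.norm_exp_ofReal_mul_I, mul_one,
      Complex.norm_of_nonneg (by linarith [S.radius_pos k])]
  rw [infDist_disk_eq, infDist_disk_eq, h2]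
  refine max_le_max le_rfl ?_
  have h3 := dist_triangle (S.center k) z (S.center i)
  rw [disk, Metric.mem_closedBall] at hz
  rw [dist_eq_norm, hnorm, dist_comm (S.center k)] at h3
  linarith

lemma bdry_mem_type4 {i : Fin n} {R θ : ℝ} (hR : S.radius i ≤ R)
    (hV : S.VoronoiVertex i (S.rayPoint i R θ)) : S.bdry i θ ∈ S.type4 i := by
  refine ⟨Metric.sphere_subset_closedBall (S.bdry_mem_sphere i θ), _, hV, fun z hz ↦ ?_⟩
  have h2 : dist (S.rayPoint i R θ) (S.bdry i θ) = R - S.radius i := by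
    rw [dist_eq_norm, show S.rayPoint i R θ - S.bdry i θ =
      ((R - S.radius i : ℝ) : ℂ) * Complex.exp (θ * Complex.I) by
        rw [bdry, rayPoint]; push_cast; ring, norm_mul, Complex.norm_exp_ofReal_mul_I, mul_one,
      Complex.norm_of_nonneg (by linarith)]
  rw [h2, ← S.infDist_rayPoint_self i hR θ]
  exact Metric.infDist_le_dist_of_mem hz

/-! ### The Voronoi cell of a disk over an arc without distinguished points -/

/-- `D_k` is the disk that bounds the Voronoi cell of `D_i` in the direction `θ`. -/
def Bounds (i k : Fin n) (θ : ℝ) : Prop := 0 < S.gain i k θ ∧ ∀ l ≠ i, S.gain i l θ ≤ S.gain i k θ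

variable {S}

lemma Bounds.radius_le {i k : Fin n} (hk : k ≠ i) {θ : ℝ} (h : S.Bounds i k θ) :
    S.radius i ≤ (S.gain i k θ)⁻¹ := by
  rw [← one_div, le_div_iff₀ h.1]
  exact (S.radius_mul_gain_lt hk θ).le

lemma Bounds.mem_cell {i k l : Fin n} (hk : k ≠ i) (hl : l ≠ i) {θ : ℝ} (h : S.Bounds i k θ)
    (hlk : S.gain i l θ = S.gain i k θ) : S.rayPoint i (S.gain i k θ)⁻¹ θ ∈ S.cell l := by
  intro j
  have hR := h.radius_le hk
  rw [S.infDist_rayPoint_eq hl hR (by rw [hlk, inv_mul_cancel₀ h.1.ne'])]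
  by_cases hj : j = i
  · rw [hj, S.infDist_rayPoint_self i hR]
  · refine S.le_infDist_rayPoint hj hR ?_
    rw [inv_mul_le_iff₀ h.1, mul_one]
    exact h.2 j hj

lemma Bounds.mem_cell_self {i k : Fin n} (hk : k ≠ i) {θ : ℝ} (h : S.Bounds i k θ) :
    S.rayPoint i (S.gain i k θ)⁻¹ θ ∈ S.cell i := by
  intro j
  have hR := h.radius_le hk
  rw [S.infDist_rayPoint_self i hR]
  by_cases hj : j = i
  · rw [hj, S.infDist_rayPoint_self i hR]
  · refine S.le_infDist_rayPoint hj hR ?_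
    rw [inv_mul_le_iff₀ h.1, mul_one]
    exact h.2 j hj

/-- A tie would put the point where the ray leaves the cell into a third cell, and make the boundary
point below this Voronoi vertex one of type (4). -/
lemma Bounds.gain_lt {P : Fin n → Set ℂ} (hP : S.IsDistinguished P) {i k l : Fin n} (hk : k ≠ i)
    (hl : l ≠ i) (hlk : l ≠ k) {θ : ℝ} (h : S.Bounds i k θ) (hθ : S.bdry i θ ∉ P i) :
    S.gain i l θ < S.gain i k θ := by
  refine lt_of_le_of_ne (h.2 l hl) fun heq ↦ hθ (hP.type4_subset i (S.bdry_mem_type4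
    (h.radius_le hk) ⟨h.mem_cell_self hk, k, l, hk, hl, hlk.symm, h.mem_cell hk hk rfl,
      h.mem_cell hk hl heq⟩))

lemma Bounds.neighbor {P : Fin n → Set ℂ} (hP : S.IsDistinguished P) {i k : Fin n} (hk : k ≠ i)
    {θ : ℝ} (h : S.Bounds i k θ) (hθ : S.bdry i θ ∉ P i) : S.Neighbor i k := by
  refine ⟨hk.symm, _, h.mem_cell_self hk, h.mem_cell hk hk rfl, fun l hl hlk hc ↦ ?_⟩
  have hR := h.radius_le hk
  have h1 := S.lt_infDist_rayPoint hl (θ := θ) (R := (S.gain i k θ)⁻¹) (by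
    rw [inv_mul_lt_iff₀ h.1, mul_one]; exact h.gain_lt hP hk hl hlk hθ)
  have h2 := hc i
  rw [S.infDist_rayPoint_self i hR] at h2
  linarith

variable (S) in
lemma exists_bounds {i j : Fin n} (hj : j ≠ i) {θ : ℝ} (h : 0 < S.gain i j θ) :
    ∃ k ≠ i, S.Bounds i k θ := by
  obtain ⟨k, hk, hmax⟩ := Finset.exists_max_image (Finset.univ.filter (· ≠ i))
    (fun k ↦ S.gain i k θ) ⟨j, by simp [hj]⟩
  simp only [Finset.mem_filter, Finset.mem_univ, true_and] at hk hmax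
  exact ⟨k, hk, h.trans_le (hmax j hj), hmax⟩

/-- Over a connected arc without distinguished points, one disk bounds the Voronoi cell. -/
lemma exists_bounds_on_arc {P : Fin n → Set ℂ} (hP : S.IsDistinguished P) {i j : Fin n} {A : Set ℝ}
    (hA : IsPreconnected A) (hAP : ∀ θ ∈ A, S.bdry i θ ∉ P i) (hj : j ≠ i) {θ₁ : ℝ} (hθ₁ : θ₁ ∈ A)
    (hg : 0 < S.gain i j θ₁) : ∃ k, S.Neighbor i k ∧ ∀ θ ∈ A, S.Bounds i k θ := by
  obtain ⟨k, hk, hb⟩ := S.exists_bounds hj hg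
  have hN := hb.neighbor hP hk (hAP _ hθ₁)
  refine ⟨k, hN, ?_⟩
  -- `U`, where `D_k` strictly dominates, is open. Within `A` it is also closed: ties are excluded
  -- by `Bounds.gain_lt`, and only a vanishing gain of `D_k` remains to be ruled out.
  set U : Set ℝ := {θ | 0 < S.gain i k θ} ∩
    ⋂ l : Fin n, {θ | l ≠ i → l ≠ k → S.gain i l θ < S.gain i k θ} with hU
  have hUo : IsOpen U := by
    refine (isOpen_lt continuous_const (S.continuous_gain i k)).inter
      (isOpen_iInter_of_finite fun l ↦ ?_)
    by_cases h1 : l ≠ i ∧ l ≠ k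
    · simpa [h1.1, h1.2] using isOpen_lt (S.continuous_gain i l) (S.continuous_gain i k)
    · convert isOpen_univ using 1
      ext θ
      simp only [mem_ofPred_eq, mem_univ, iff_true]
      exact fun h2 h3 ↦ absurd ⟨h2, h3⟩ h1
  have hBU : ∀ θ ∈ A, S.Bounds i k θ → θ ∈ U := fun θ hθ h ↦
    ⟨h.1, mem_iInter.2 fun l hl hlk ↦ h.gain_lt hP hk hl hlk (hAP θ hθ)⟩
  have hcl : closure U ⊆ {θ | 0 ≤ S.gain i k θ ∧ ∀ l ≠ i, S.gain i l θ ≤ S.gain i k θ} := by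
    refine closure_minimal (fun θ hθ ↦ ⟨hθ.1.le, fun l hl ↦ ?_⟩) ?_
    · by_cases hlk : l = k
      · rw [hlk]
      · exact (mem_iInter.1 hθ.2 l hl hlk).le
    · simp only [ofPred_and, ofPred_forall]
      exact (isClosed_le continuous_const (S.continuous_gain i k)).inter (isClosed_iInter fun l ↦
        isClosed_iInter fun _ ↦ isClosed_le (S.continuous_gain i l) (S.continuous_gain i k))
  have hsub := hA.subset_of_closure_inter_subset hUo ⟨θ₁, hθ₁, hBU _ hθ₁ hb⟩ (by
    rintro θ ⟨hθ, hθA⟩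
    obtain ⟨h1, h2⟩ := hcl hθ
    -- Where the gain vanishes, the bisector escapes to infinity, and the angle is that of an outer
    -- common tangent.
    refine hBU θ hθA ⟨lt_of_le_of_ne h1 fun h0 ↦ hAP θ hθA (hP.type1_subset i
      (S.bdry_mem_type1_of_outer hN ?_)), h2⟩
    rw [gain, eq_comm, div_eq_zero_iff] at h0
    have := (S.gain_denom_pos hk).ne'
    rcases h0 with h0 | h0
    · linarith
    · exact absurd h0 this)
  exact fun θ hθ ↦ ⟨(hsub hθ).1, (hcl (subset_closure (hsub hθ))).2⟩

/-- The open ball that touches `D_i` at the angle `θ` and also the disk that bounds the cell is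
empty. -/
lemma Bounds.le_dist {i k j : Fin n} (hk : k ≠ i) (hj : j ≠ i) {θ : ℝ} (h : S.Bounds i k θ) :
    (S.gain i k θ)⁻¹ - S.radius i ≤
      dist (S.rayPoint i (S.gain i k θ)⁻¹ θ) (S.center j) - S.radius j := by
  have hR := h.radius_le hk
  have h1 := S.le_infDist_rayPoint (θ := θ) hj hR (by
    rw [inv_mul_le_iff₀ h.1, mul_one]; exact h.2 j hj)
  have h2 : S.radius i < (S.gain i k θ)⁻¹ := by
    rw [← one_div, lt_div_iff₀ h.1]; exact S.radius_mul_gain_lt hk θ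
  rw [infDist_disk_eq] at h1
  rcases le_max_iff.1 h1 with h3 | h3
  · linarith
  · exact h3

end DiskScene

namespace DiskScene

variable {n : ℕ} (S : DiskScene n)

/-! ### Coordinates adapted to a boundary point -/

/-- The coordinate along the tangent of `D_i` at the angle `φ`, with `D_i` scaled to the unit disk
around the origin. The sign `σ` chooses the direction of the tangent. -/
noncomputable def coordX (i : Fin n) (φ σ : ℝ) (p : ℂ) : ℝ :=
  σ * ((p - S.center i).im * Real.cos φ - (p - S.center i).re * Real.sin φ) / S.radius i

/-- The coordinate along the normal of `D_i` at the angle `φ`, with `D_i` scaled to the unit disk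
around the origin. -/
noncomputable def coordY (i : Fin n) (φ : ℝ) (p : ℂ) : ℝ :=
  ((p - S.center i).re * Real.cos φ + (p - S.center i).im * Real.sin φ) / S.radius i

lemma sign_sq {σ : ℝ} (hσ : σ = 1 ∨ σ = -1) : σ ^ 2 = 1 := by
  rcases hσ with rfl | rfl <;> norm_num

lemma cos_add_sign {σ : ℝ} (hσ : σ = 1 ∨ σ = -1) (φ t : ℝ) :
    Real.cos (φ + σ * t) = Real.cos φ * Real.cos t - σ * (Real.sin φ * Real.sin t) := by
  rcases hσ with rfl | rfl <;> simp [Real.cos_add]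

lemma sin_add_sign {σ : ℝ} (hσ : σ = 1 ∨ σ = -1) (φ t : ℝ) :
    Real.sin (φ + σ * t) = Real.sin φ * Real.cos t + σ * (Real.cos φ * Real.sin t) := by
  rcases hσ with rfl | rfl <;> simp [Real.sin_add]

variable {S} in
lemma re_eq_coord {i : Fin n} {φ σ : ℝ} (hσ : σ = 1 ∨ σ = -1) (p : ℂ) :
    p.re = (S.center i).re + S.radius i *
      (S.coordY i φ p * Real.cos φ - σ * S.coordX i φ σ p * Real.sin φ) := by
  have hr := (S.radius_pos i).ne'
  have h1 := Real.sin_sq_add_cos_sq φ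
  have h2 := sign_sq hσ
  rw [coordX, coordY]
  simp only [Complex.sub_re, Complex.sub_im]
  field_simp
  rw [h2]
  linear_combination ((S.center i).re - p.re) * h1

variable {S} in
lemma im_eq_coord {i : Fin n} {φ σ : ℝ} (hσ : σ = 1 ∨ σ = -1) (p : ℂ) :
    p.im = (S.center i).im + S.radius i *
      (S.coordY i φ p * Real.sin φ + σ * S.coordX i φ σ p * Real.cos φ) := by
  have hr := (S.radius_pos i).ne'
  have h1 := Real.sin_sq_add_cos_sq φ
  have h2 := sign_sq hσ
  rw [coordX, coordY]
  simp only [Complex.sub_re, Complex.sub_im]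
  field_simp
  rw [h2]
  linear_combination ((S.center i).im - p.im) * h1

variable {S} in
lemma exists_coord_eq (i : Fin n) (φ : ℝ) {σ : ℝ} (hσ : σ = 1 ∨ σ = -1) (a b : ℝ) :
    ∃ p, S.coordX i φ σ p = a ∧ S.coordY i φ p = b := by
  have hr := (S.radius_pos i).ne'
  have h1 := Real.sin_sq_add_cos_sq φ
  refine ⟨⟨(S.center i).re + S.radius i * (b * Real.cos φ - σ * a * Real.sin φ),
    (S.center i).im + S.radius i * (b * Real.sin φ + σ * a * Real.cos φ)⟩, ?_, ?_⟩
  · rw [coordX, div_eq_iff hr]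
    simp only [Complex.sub_re, Complex.sub_im]
    linear_combination S.radius i * a * (σ ^ 2 * h1 + sign_sq hσ)
  · rw [coordY, div_eq_iff hr]
    simp only [Complex.sub_re, Complex.sub_im]
    linear_combination S.radius i * b * h1

variable {S} in
lemma dist_sq_coord {i : Fin n} {φ σ : ℝ} (hσ : σ = 1 ∨ σ = -1) (p q : ℂ) :
    dist p q ^ 2 = S.radius i ^ 2 * ((S.coordX i φ σ p - S.coordX i φ σ q) ^ 2 +
      (S.coordY i φ p - S.coordY i φ q) ^ 2) := by
  rw [dist_sq_eq, re_eq_coord (φ := φ) hσ p (S := S) (i := i), re_eq_coord hσ q (S := S) (i := i),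
    im_eq_coord hσ p (S := S) (i := i), im_eq_coord hσ q (S := S) (i := i)]
  have h1 := Real.sin_sq_add_cos_sq φ
  have h2 := sign_sq hσ
  linear_combination (S.radius i ^ 2 * ((S.coordX i φ σ p - S.coordX i φ σ q) ^ 2 * σ ^ 2 +
      (S.coordY i φ p - S.coordY i φ q) ^ 2)) * h1 +
      S.radius i ^ 2 * (S.coordX i φ σ p - S.coordX i φ σ q) ^ 2 * h2

@[simp] lemma coordX_center (i : Fin n) (φ σ : ℝ) : S.coordX i φ σ (S.center i) = 0 := by
  simp [coordX]

@[simp] lemma coordY_center (i : Fin n) (φ : ℝ) : S.coordY i φ (S.center i) = 0 := by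
  simp [coordY]

variable {S} in
lemma coordX_rayPoint {i : Fin n} {φ σ : ℝ} (hσ : σ = 1 ∨ σ = -1) (R t : ℝ) :
    S.coordX i φ σ (S.rayPoint i R (φ + σ * t)) = R / S.radius i * Real.sin t := by
  have h1 := Real.sin_sq_add_cos_sq φ
  have h2 := sign_sq hσ
  rw [coordX, Complex.sub_re, Complex.sub_im, rayPoint_re, rayPoint_im, cos_add_sign hσ,
    sin_add_sign hσ]
  linear_combination (S.radius i)⁻¹ * R * Real.sin t * (h1 * σ ^ 2 + h2)

variable {S} in
lemma coordY_rayPoint {i : Fin n} {φ σ : ℝ} (hσ : σ = 1 ∨ σ = -1) (R t : ℝ) :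
    S.coordY i φ (S.rayPoint i R (φ + σ * t)) = R / S.radius i * Real.cos t := by
  have h1 := Real.sin_sq_add_cos_sq φ
  rw [coordY, Complex.sub_re, Complex.sub_im, rayPoint_re, rayPoint_im, cos_add_sign hσ,
    sin_add_sign hσ]
  linear_combination (S.radius i)⁻¹ * R * Real.cos t * h1

variable {S} in
lemma proj_coord {i : Fin n} {φ σ : ℝ} (hσ : σ = 1 ∨ σ = -1) (p : ℂ) (t : ℝ) :
    proj (p - S.center i) (φ + σ * t) = S.radius i *
      (S.coordX i φ σ p * Real.sin t + S.coordY i φ p * Real.cos t) := by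
  have h1 := Real.sin_sq_add_cos_sq φ
  have h2 := sign_sq hσ
  rw [proj, Complex.sub_re, Complex.sub_im, re_eq_coord (φ := φ) hσ p (S := S) (i := i),
    im_eq_coord (φ := φ) hσ p (S := S) (i := i), cos_add_sign hσ, sin_add_sign hσ]
  linear_combination S.radius i * (S.coordY i φ p * Real.cos t +
    σ ^ 2 * S.coordX i φ σ p * Real.sin t) * h1 + S.radius i * S.coordX i φ σ p * Real.sin t * h2

variable {S} in
lemma norm_sq_coord {i : Fin n} {φ σ : ℝ} (hσ : σ = 1 ∨ σ = -1) (p : ℂ) :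
    ‖p - S.center i‖ ^ 2 = S.radius i ^ 2 * (S.coordX i φ σ p ^ 2 + S.coordY i φ p ^ 2) := by
  rw [← dist_eq_norm, dist_sq_coord (φ := φ) hσ p (S.center i) (S := S) (i := i)]
  simp

variable {S} in
lemma inv_gain_coord {i k : Fin n} {φ σ : ℝ} (hσ : σ = 1 ∨ σ = -1) (t : ℝ) :
    (S.gain i k (φ + σ * t))⁻¹ / S.radius i =
      (S.coordX i φ σ (S.center k) ^ 2 + S.coordY i φ (S.center k) ^ 2 -
        (S.radius k / S.radius i - 1) ^ 2) / (2 * (S.radius k / S.radius i - 1 +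
        S.coordX i φ σ (S.center k) * Real.sin t + S.coordY i φ (S.center k) * Real.cos t)) := by
  have hr := (S.radius_pos i).ne'
  rw [gain, proj_coord hσ, norm_sq_coord (φ := φ) hσ, inv_div]
  set X := S.coordX i φ σ (S.center k)
  set Y := S.coordY i φ (S.center k)
  have e1 : S.radius i ^ 2 * (X ^ 2 + Y ^ 2) - (S.radius k - S.radius i) ^ 2 =
      S.radius i ^ 2 * (X ^ 2 + Y ^ 2 - (S.radius k / S.radius i - 1) ^ 2) := by
    field_simp
  have e2 : 2 * (S.radius k - S.radius i + S.radius i * (X * Real.sin t + Y * Real.cos t)) =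
      S.radius i * (2 * (S.radius k / S.radius i - 1 + X * Real.sin t + Y * Real.cos t)) := by
    field_simp
    ring
  rw [e1, e2, div_div, mul_right_comm (S.radius i), ← pow_two,
    mul_div_mul_left _ _ (pow_ne_zero 2 hr)]

variable {S}

/-! ### Segments blocked by the bounding disk -/

/-- The disk that bounds the Voronoi cell of `D_i` lies to the right of a segment that leads from
the point of `D_i` at the angle `φ` to a third disk. -/
lemma bounding_disk_on_right_side {i j k : Fin n} (hk : k ≠ i) (hj : j ≠ i) (hkj : k ≠ j)
    {φ σ ℓ a b : ℝ} (hσ : σ = 1 ∨ σ = -1) (hℓ : 0 < ℓ) (hℓ' : ℓ < Real.pi / 2) (ha : 0 ≤ a)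
    (hb : 0 ≤ b) (hab : a ^ 2 + b ^ 2 = 1)
    (hbd : ∀ t ∈ Icc 0 ℓ, S.Bounds i k (φ + σ * t)) {y : ℂ} (hy : y ∈ S.disk j)
    (hyX : S.coordX i φ σ y = ℓ * a) (hyY : S.coordY i φ y = 1 + ℓ * b)
    (hblock : ∀ p, ∀ w ∈ Icc 0 ℓ, S.coordX i φ σ p = w * a → S.coordY i φ p = 1 + w * b →
      p ∉ Metric.ball (S.center k) (S.radius k)) :
    a * (S.radius k / S.radius i) <
      b * S.coordX i φ σ (S.center k) - a * (S.coordY i φ (S.center k) - 1) ∨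
    (0 < a * S.coordX i φ σ (S.center k) + b * (S.coordY i φ (S.center k) - 1) ∧
      a * S.coordX i φ σ (S.center k) + b * (S.coordY i φ (S.center k) - 1) < ℓ ∧
      b * S.coordX i φ σ (S.center k) - a * (S.coordY i φ (S.center k) - 1) =
        S.radius k / S.radius i) := by
  have hr := S.radius_pos i
  have hrk := S.radius_pos k
  have hscale : ∀ p q : ℂ, ∀ c : ℝ, 0 ≤ c → c ≤ dist p q → (c / S.radius i) ^ 2 ≤
      (S.coordX i φ σ p - S.coordX i φ σ q) ^ 2 + (S.coordY i φ p - S.coordY i φ q) ^ 2 :=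
    fun p q c hc h ↦ by
      have h1 := pow_le_pow_left₀ hc h 2
      rw [dist_sq_coord (φ := φ) hσ p q (S := S) (i := i)] at h1
      rw [div_pow, div_le_iff₀ (by positivity)]
      linarith
  have hscale' : ∀ p q : ℂ, ∀ c : ℝ, 0 ≤ c → c < dist p q → (c / S.radius i) ^ 2 <
      (S.coordX i φ σ p - S.coordX i φ σ q) ^ 2 + (S.coordY i φ p - S.coordY i φ q) ^ 2 :=
    fun p q c hc h ↦ by
      have h1 := pow_lt_pow_left₀ h hc two_ne_zero
      rw [dist_sq_coord (φ := φ) hσ p q (S := S) (i := i)] at h1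
      rw [div_pow, div_lt_iff₀ (by positivity)]
      linarith
  have hyk : S.radius k < dist (S.center k) y := by
    have := Set.disjoint_left.1 (S.disjoint j k hkj.symm) hy
    rw [Metric.mem_closedBall, not_le, dist_comm] at this
    exact this
  refine disk_on_right_side hℓ hℓ' (div_pos hrk hr) ha hb hab ?_
    (R := fun t ↦ (S.gain i k (φ + σ * t))⁻¹ / S.radius i) ?_ (fun t _ ↦ inv_gain_coord hσ t)
    ?_ ?_ ?_
  · have h1 := S.radius_add_lt hk.symm
    rw [← dist_eq_norm] at h1
    have h2 := hscale' _ _ _ (by linarith) h1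
    simp only [coordX_center, coordY_center, sub_zero] at h2
    rwa [add_div, div_self hr.ne'] at h2
  · intro t ht
    have h1 := (S.gain_pos_iff hk).1 (hbd t ht).1
    rw [proj_coord hσ] at h1
    have h2 : S.radius k / S.radius i - 1 + S.coordX i φ σ (S.center k) * Real.sin t +
      S.coordY i φ (S.center k) * Real.cos t = (S.radius k - S.radius i + S.radius i *
        (S.coordX i φ σ (S.center k) * Real.sin t + S.coordY i φ (S.center k) * Real.cos t)) /
        S.radius i := by field_simp; ring
    rw [h2]
    exact div_pos h1 hr
  · intro t ht
    have h1 := (hbd t ht).le_dist hk hj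
    have h2 := (hbd t ht).radius_le hk
    have h3 := dist_triangle_right (S.rayPoint i (S.gain i k (φ + σ * t))⁻¹ (φ + σ * t))
      (S.center j) y
    have hy' : dist (S.center j) y ≤ S.radius j := by rw [dist_comm]; exact hy
    have h4 := hscale y (S.rayPoint i (S.gain i k (φ + σ * t))⁻¹ (φ + σ * t)) _ (by linarith)
      (show (S.gain i k (φ + σ * t))⁻¹ - S.radius i ≤ _ by
        rw [dist_comm]
        have := dist_triangle (S.rayPoint i (S.gain i k (φ + σ * t))⁻¹ (φ + σ * t)) y (S.center j)
        rw [dist_comm y] at this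
        linarith)
    rw [coordX_rayPoint hσ, coordY_rayPoint hσ, hyX, hyY, sub_div, div_self hr.ne'] at h4
    exact h4
  · intro w hw
    obtain ⟨p, hpX, hpY⟩ := exists_coord_eq (S := S) i φ hσ (w * a) (1 + w * b)
    have h2 := hblock p w hw hpX hpY
    rw [Metric.mem_ball, not_lt, dist_comm] at h2
    have h3 := hscale _ _ _ hrk.le h2
    rwa [hpX, hpY] at h3
  · have h1 := hscale' _ _ _ hrk.le hyk
    rwa [hyX, hyY] at h1

/-- A segment along a tangent of `D_i` that leads to a disk that is no neighbor is blocked. -/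
lemma tangent_segment_blocked {i j k : Fin n} (hk : k ≠ i) (hj : j ≠ i) (hkj : k ≠ j)
    {φ σ ℓ : ℝ} (hσ : σ = 1 ∨ σ = -1) (hℓ : 0 < ℓ) (hℓ' : ℓ < Real.pi / 2)
    (hbd : ∀ t ∈ Icc 0 ℓ, S.Bounds i k (φ + σ * t)) {y : ℂ} (hy : y ∈ S.disk j)
    (hyX : S.coordX i φ σ y = ℓ) (hyY : S.coordY i φ y = 1)
    (hblock : ∀ p, ∀ w ∈ Icc 0 ℓ, S.coordX i φ σ p = w → S.coordY i φ p = 1 →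
      p ∉ Metric.ball (S.center k) (S.radius k)) : False := by
  have h := bounding_disk_on_right_side hk hj hkj hσ hℓ hℓ' zero_le_one le_rfl (by norm_num) hbd hy
    (by rw [hyX, mul_one]) (by rw [hyY, mul_zero, add_zero])
    (fun p w hw h1 h2 ↦ hblock p w hw (by simpa using h1) (by simpa using h2))
  have h1 := (S.gain_pos_iff hk).1 (hbd 0 ⟨le_rfl, hℓ.le⟩).1
  rw [proj_coord hσ, Real.sin_zero, Real.cos_zero] at h1
  have hr := S.radius_pos i
  have h2 : 0 < S.radius k / S.radius i - 1 + S.coordY i φ (S.center k) := by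
    have : S.radius k / S.radius i - 1 + S.coordY i φ (S.center k) =
      (S.radius k - S.radius i + S.radius i * (S.coordX i φ σ (S.center k) * 0 +
        S.coordY i φ (S.center k) * 1)) / S.radius i := by field_simp; ring
    rw [this]
    exact div_pos h1 hr
  -- To the right of the segment means below the tangent, but by `h2` the disk `D_k` reaches above
  -- it.
  rcases h with h | ⟨-, -, h⟩ <;> linarith

/-- A segment from a point of `D_i` to the closest point of a disk that is no neighbor and lies
across the tangent of this point is blocked, if there are no distinguished points along an arc
of the length of the segment. -/
lemma inner_segment_blocked {P : Fin n → Set ℂ} (hP : S.IsDistinguished P) {i j k : Fin n}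
    (hN : S.Neighbor i k) (hj : j ≠ i) (hkj : k ≠ j) {φ σ ℓ L : ℝ}
    (hσ : σ = 1 ∨ σ = -1) (hℓ : 0 < ℓ) (hℓ' : ℓ < Real.pi / 2) (hL : 0 < L)
    (hbd : ∀ t ∈ Icc 0 ℓ, S.Bounds i k (φ + σ * t))
    (harc : ∀ t ∈ Icc 0 ℓ, S.bdry i (φ + σ * t) ∉ P i)
    (hjX : S.coordX i φ σ (S.center j) = L)
    (hjY : S.coordY i φ (S.center j) = 1 + S.radius j / S.radius i)
    (hℓL : (ℓ + S.radius j / S.radius i) ^ 2 = L ^ 2 + (S.radius j / S.radius i) ^ 2)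
    (hblock : ∀ p, ∀ w ∈ Icc 0 ℓ,
      S.coordX i φ σ p = w * (L / (ℓ + S.radius j / S.radius i)) →
      S.coordY i φ p = 1 + w * (S.radius j / S.radius i / (ℓ + S.radius j / S.radius i)) →
      p ∉ Metric.ball (S.center k) (S.radius k)) : False := by
  have hk : k ≠ i := hN.1.symm
  have hr := S.radius_pos i
  have hrj := S.radius_pos j
  have hrk := S.radius_pos k
  have h0 : (0 : ℝ) ∈ Icc 0 ℓ := ⟨le_rfl, hℓ.le⟩
  have hbd0 := hbd 0 h0
  have hle := hbd0.le_dist hk hj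
  have hRr := hbd0.radius_le hk
  have hRlt : S.radius i < (S.gain i k (φ + σ * 0))⁻¹ := by
    rw [← one_div, lt_div_iff₀ hbd0.1]; exact S.radius_mul_gain_lt hk _
  have hR := inv_gain_coord (S := S) (i := i) (k := k) (φ := φ) hσ 0
  have hR1 : 1 < (S.gain i k (φ + σ * 0))⁻¹ / S.radius i := by rwa [one_lt_div hr]
  -- The first ball does not overlap `D_j`; this turns into `hρL` below.
  have hle2 : ((S.gain i k (φ + σ * 0))⁻¹ / S.radius i - 1 + S.radius j / S.radius i) ^ 2 ≤
      L ^ 2 + ((S.gain i k (φ + σ * 0))⁻¹ / S.radius i - (1 + S.radius j / S.radius i)) ^ 2 := by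
    have h1 := pow_le_pow_left₀ (n := 2) (by linarith) (show (S.gain i k (φ + σ * 0))⁻¹ -
      S.radius i + S.radius j ≤ dist (S.rayPoint i (S.gain i k (φ + σ * 0))⁻¹ (φ + σ * 0))
      (S.center j) by linarith)
    rw [dist_sq_coord (φ := φ) hσ (S := S) (i := i), coordX_rayPoint hσ, coordY_rayPoint hσ, hjX,
      hjY, Real.sin_zero, Real.cos_zero] at h1
    have e : (S.gain i k (φ + σ * 0))⁻¹ / S.radius i - 1 + S.radius j / S.radius i =
      ((S.gain i k (φ + σ * 0))⁻¹ - S.radius i + S.radius j) / S.radius i := by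
      field_simp
    rw [e, div_pow, div_le_iff₀ (by positivity)]
    linarith
  have hq : 0 < S.radius k / S.radius i - 1 + S.coordY i φ (S.center k) := by
    have h1 := (S.gain_pos_iff hk).1 hbd0.1
    rw [proj_coord hσ, Real.sin_zero, Real.cos_zero] at h1
    have : S.radius k / S.radius i - 1 + S.coordY i φ (S.center k) =
      (S.radius k - S.radius i + S.radius i * (S.coordX i φ σ (S.center k) * 0 +
        S.coordY i φ (S.center k) * 1)) / S.radius i := by field_simp; ring
    rw [this]
    exact div_pos h1 hr
  have hdisj := pow_lt_pow_left₀ (S.radius_add_lt hkj) (by linarith) two_ne_zero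
  rw [← dist_eq_norm, dist_comm, dist_sq_coord (φ := φ) hσ (S := S) (i := i), hjX, hjY] at hdisj
  have hD := pow_lt_pow_left₀ (S.radius_add_lt hN.1) (by linarith) two_ne_zero
  rw [norm_sq_coord (φ := φ) hσ (S := S) (i := i)] at hD
  set X := S.coordX i φ σ (S.center k) with hX
  set Y := S.coordY i φ (S.center k) with hY
  set r := S.radius j / S.radius i with hr_def
  set s := S.radius k / S.radius i with hs_def
  set R := (S.gain i k (φ + σ * 0))⁻¹ / S.radius i with hR_def
  have hr0 : 0 < r := div_pos hrj hr
  have hs0 : 0 < s := div_pos hrk hr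
  have hm : 0 < ℓ + r := by linarith
  rw [Real.sin_zero, Real.cos_zero, mul_zero, add_zero, mul_one, eq_div_iff (by linarith)] at hR
  have hdisj' : (r + s) ^ 2 < (X - L) ^ 2 + (Y - 1 - r) ^ 2 := by
    rw [hr_def, hs_def, ← add_div, div_pow, div_lt_iff₀ (by positivity)]
    rw [← hr_def]
    linarith
  have hD' : (1 + s) ^ 2 < X ^ 2 + (Y - 1 + 1) ^ 2 := by
    have e : 1 + s = (S.radius i + S.radius k) / S.radius i := by rw [hs_def]; field_simp
    rw [e, div_pow, div_lt_iff₀ (by positivity)]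
    linarith
  have hyd : ∃ y ∈ S.disk j, S.coordX i φ σ y = ℓ * (L / (ℓ + r)) ∧
      S.coordY i φ y = 1 + ℓ * (r / (ℓ + r)) := by
    obtain ⟨p, hpX, hpY⟩ := exists_coord_eq (S := S) i φ hσ (ℓ * (L / (ℓ + r)))
      (1 + ℓ * (r / (ℓ + r)))
    refine ⟨p, ?_, hpX, hpY⟩
    rw [disk, Metric.mem_closedBall]
    refine le_of_sq_le_sq (le_of_eq ?_) hrj.le
    rw [dist_sq_coord (φ := φ) hσ (S := S) (i := i), hpX, hpY, hjX, hjY]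
    have e : (ℓ * (L / (ℓ + r)) - L) ^ 2 + (1 + ℓ * (r / (ℓ + r)) - (1 + r)) ^ 2 = r ^ 2 := by
      have e1 : ℓ * (L / (ℓ + r)) - L = -(r * L) / (ℓ + r) := by field_simp; ring
      have e2 : 1 + ℓ * (r / (ℓ + r)) - (1 + r) = -(r * r) / (ℓ + r) := by field_simp; ring
      rw [e1, e2, div_pow, div_pow, ← add_div, div_eq_iff (by positivity), hℓL]
      ring
    rw [e, hr_def]
    field_simp
  obtain ⟨y, hy, hyX, hyY⟩ := hyd
  have halt := bounding_disk_on_right_side hk hj hkj hσ hℓ hℓ' (div_pos hL hm).le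
    (div_pos hr0 hm).le (by rw [div_pow, div_pow, ← add_div, ← hℓL, div_self (by positivity)])
    hbd hy hyX hyY hblock
  rw [← hX, ← hY, ← hs_def] at halt
  have e1 : ∀ x z : ℝ, r / (ℓ + r) * x - L / (ℓ + r) * z = (r * x - L * z) / (ℓ + r) :=
    fun x z ↦ by ring
  have e2 : ∀ x z : ℝ, L / (ℓ + r) * x + r / (ℓ + r) * z = (L * x + r * z) / (ℓ + r) :=
    fun x z ↦ by ring
  rw [e1, e2, div_mul_eq_mul_div, div_lt_div_iff_of_pos_right hm, div_lt_iff₀ hm,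
    div_eq_iff hm.ne', lt_div_iff₀ hm, zero_mul, mul_comm s] at halt
  -- From here on the origin is the starting point on `D_i` instead of its center, which lowers
  -- second coordinates by `1`; the first ball has radius `R - 1`.
  have htan : X ^ 2 = (Y - 1 + s) * (2 * (R - 1) + s - (Y - 1)) := by linarith
  have hρL : 4 * r * (R - 1) ≤ L ^ 2 := by linarith
  obtain ⟨hXL, htop⟩ := center_le_of_touching hL hr0 hs0 (by linarith) hℓ hℓL (by linarith) htan hρL
    hdisj' halt
  obtain ⟨t, ht, h⟩ := exists_angle_le hL hr0 hs0 hℓ hℓL (by linarith) htan hρL hD' hdisj' hXL htop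
  rw [sub_add_cancel] at h
  refine harc t ⟨ht.1.le, ht.2⟩ ?_
  rcases h with h | ⟨h1, h2⟩
  · refine hP.type1_subset i (S.bdry_mem_type1_of_inner hN ?_)
    rw [proj_coord hσ, h, hs_def]
    field_simp
  · refine hP.type2_subset i (S.bdry_mem_type2 hN (mul_pos hr h2) ?_)
    have h3 := Real.sin_sq_add_cos_sq t
    apply Complex.ext
    · rw [Complex.re_ofReal_mul, Complex.exp_ofReal_mul_I_re, cos_add_sign hσ, Complex.sub_re,
        re_eq_coord (φ := φ) hσ (S.center k) (S := S) (i := i), ← hX, ← hY]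
      linear_combination S.radius i * (-(Real.cos φ * Real.sin t + σ * (Real.sin φ * Real.cos t)) * h1
        - (Y * Real.cos φ - σ * X * Real.sin φ) * h3)
    · rw [Complex.im_ofReal_mul, Complex.exp_ofReal_mul_I_im, sin_add_sign hσ, Complex.sub_im,
        im_eq_coord (φ := φ) hσ (S.center k) (S := S) (i := i), ← hX, ← hY]
      linear_combination S.radius i * (-(Real.sin φ * Real.sin t - σ * (Real.cos φ * Real.cos t)) * h1
        - (Y * Real.sin φ + σ * X * Real.cos φ) * h3)

end DiskScene

/-! ### Lengths of curves -/

/-- The length of the part of `γ` between the parameters `a` and `b`. -/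
noncomputable def curveLength (γ : ℝ → ℂ) (a b : ℝ) : ℝ≥0∞ := ∫⁻ t in Ioc a b, ‖deriv γ t‖ₑ

lemma curveLength_add (γ : ℝ → ℂ) {a b c : ℝ} (hab : a ≤ b) (hbc : b ≤ c) :
    curveLength γ a b + curveLength γ b c = curveLength γ a c := by
  rw [curveLength, curveLength, curveLength, ← Ioc_union_Ioc_eq_Ioc hab hbc,
    MeasureTheory.lintegral_union measurableSet_Ioc (Ioc_disjoint_Ioc_of_le le_rfl)]

/-- Projection to the direction of the chord gives a real Lipschitz function, to which the
fundamental theorem of calculus for absolutely continuous functions applies. -/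
lemma ofReal_dist_le_curveLength {γ : ℝ → ℂ} {K : ℝ≥0} {a b : ℝ} (hab : a ≤ b)
    (hγ : LipschitzOnWith K γ (Icc a b)) :
    ENNReal.ofReal (dist (γ a) (γ b)) ≤ curveLength γ a b := by
  rcases eq_or_ne (γ b) (γ a) with h | h
  · simp [h]
  have hn : ‖γ b - γ a‖ ≠ 0 := norm_ne_zero_iff.2 (sub_ne_zero.2 h)
  set c : ℂ := (starRingEnd ℂ) (γ b - γ a) / ‖γ b - γ a‖ with hc
  have hc1 : ‖c‖ = 1 := by
    rw [hc, norm_div, RCLike.norm_conj, Complex.norm_real, norm_norm, div_self hn]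
  set L : ℂ →L[ℝ] ℝ := Complex.reCLM.comp (ContinuousLinearMap.mul ℝ ℂ c) with hL
  have hLx : ∀ x, L x = (c * x).re := fun x ↦ by simp [hL]
  have hLn : ∀ x, ‖L x‖ ≤ ‖x‖ := fun x ↦ by
    rw [hLx, Real.norm_eq_abs]
    refine (Complex.abs_re_le_norm _).trans ?_
    rw [norm_mul, hc1, one_mul]
  have hLip : LipschitzOnWith K (fun t ↦ L (γ t)) (uIcc a b) := by
    rw [uIcc_of_le hab]
    refine LipschitzOnWith.of_dist_le_mul fun x hx y hy ↦ ?_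
    rw [dist_eq_norm, ← map_sub]
    exact (hLn _).trans (by rw [← dist_eq_norm]; exact hγ.dist_le_mul x hx y hy)
  have hint := hLip.absolutelyContinuousOnInterval.integral_deriv_eq_sub
  have hval : L (γ b) - L (γ a) = dist (γ a) (γ b) := by
    rw [← map_sub, hLx, hc, div_mul_eq_mul_div, mul_comm, Complex.mul_conj, dist_comm, dist_eq_norm,
      Complex.normSq_eq_norm_sq, ← Complex.ofReal_div, Complex.ofReal_re, pow_two,
      mul_div_assoc, div_self hn, mul_one]
  rw [hval, intervalIntegral.integral_of_le hab] at hint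
  have hdiff : ∀ᵐ t ∂(MeasureTheory.volume.restrict (Ioc a b)), DifferentiableAt ℝ γ t := by
    rw [MeasureTheory.Measure.restrict_congr_set MeasureTheory.Ioo_ae_eq_Ioc.symm,
      MeasureTheory.ae_restrict_iff' measurableSet_Ioo]
    filter_upwards [hγ.ae_differentiableWithinAt_of_mem_real] with t ht ht'
    exact (ht (Ioo_subset_Icc_self ht')).differentiableAt (Icc_mem_nhds ht'.1 ht'.2)
  calc ENNReal.ofReal (dist (γ a) (γ b)) = ‖∫ t in Ioc a b, deriv (fun t ↦ L (γ t)) t‖ₑ := by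
        rw [hint, Real.enorm_of_nonneg dist_nonneg]
    _ ≤ ∫⁻ t in Ioc a b, ‖deriv (fun t ↦ L (γ t)) t‖ₑ :=
        MeasureTheory.enorm_integral_le_lintegral_enorm _
    _ ≤ curveLength γ a b := by
        refine MeasureTheory.lintegral_mono_ae ?_
        filter_upwards [hdiff] with t ht
        have := (L.hasFDerivAt.comp_hasDerivAt t ht.hasDerivAt).deriv
        rw [show (fun t ↦ L (γ t)) = L ∘ γ from rfl, this, ← ofReal_norm, ← ofReal_norm]
        exact ENNReal.ofReal_le_ofReal (hLn _)

/-- By the law of cosines, `‖x - y‖² = (‖x‖ - ‖y‖)² + 4 ‖x‖ ‖y‖ sin² (α / 2)`. -/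
lemma two_mul_sin_half_angle_le {x y : ℂ} {r : ℝ} (hr : 0 < r) (hx : r ≤ ‖x‖) (hy : r ≤ ‖y‖) :
    r * (2 * Real.sin (InnerProductGeometry.angle x y / 2)) ≤ ‖x - y‖ := by
  have h1 := InnerProductGeometry.norm_sub_sq_eq_norm_sq_add_norm_sq_sub_two_mul_norm_mul_norm_mul_cos_angle x y
  set α := InnerProductGeometry.angle x y
  have h2 : Real.cos α = 1 - 2 * Real.sin (α / 2) ^ 2 := by
    have := Real.cos_two_mul (α / 2)
    have h3 := Real.sin_sq_add_cos_sq (α / 2)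
    rw [show 2 * (α / 2) = α by ring] at this
    linarith
  refine le_of_sq_le_sq ?_ (norm_nonneg _)
  rw [pow_two ‖x - y‖, h1, h2]
  have h3 : r * r ≤ ‖x‖ * ‖y‖ := mul_le_mul hx hy hr.le (norm_nonneg _)
  nlinarith [sq_nonneg (‖x‖ - ‖y‖), mul_le_mul_of_nonneg_right h3 (sq_nonneg (Real.sin (α / 2)))]

/-- Outside of the ball of radius `r`, angles are at most slightly larger than distances. -/
lemma exists_angle_mul_le_norm_sub {r ε : ℝ} (hr : 0 < r) (hε : 0 < ε) :
    ∃ δ > 0, ∀ x y : ℂ, r ≤ ‖x‖ → r ≤ ‖y‖ → ‖x - y‖ ≤ δ →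
      (1 - ε) * (r * InnerProductGeometry.angle x y) ≤ ‖x - y‖ := by
  set η := min ε 1 with hη
  have hη0 : 0 < η := lt_min hε one_pos
  have hη1 : η ≤ 1 := min_le_right _ _
  refine ⟨r * η, by positivity, fun x y hx hy hxy ↦ ?_⟩
  have h1 := two_mul_sin_half_angle_le hr hx hy
  have ha0 := InnerProductGeometry.angle_nonneg x y
  have haπ := InnerProductGeometry.angle_le_pi x y
  set α := InnerProductGeometry.angle x y
  rcases ha0.eq_or_lt with h0 | h0
  · rw [← h0]; simp
  have h2 : 2 * Real.sin (α / 2) ≤ η := by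
    refine le_of_mul_le_mul_left (h1.trans hxy) hr
  have h3 := Real.mul_le_sin (x := α / 2) (by linarith) (by linarith)
  have h4 : α / 2 ≤ η := by
    have hpi := Real.pi_lt_d2
    have hpi0 := Real.pi_pos
    have : α / 2 ≤ Real.pi / 2 * Real.sin (α / 2) := by
      have := mul_le_mul_of_nonneg_left h3 (show 0 ≤ Real.pi / 2 by positivity)
      calc α / 2 = Real.pi / 2 * (2 / Real.pi * (α / 2)) := by field_simp
        _ ≤ _ := this
    nlinarith
  have h5 := Real.sin_gt_sub_cube (x := α / 2) (by linarith)
  have h6 : (1 - ε) * α ≤ 2 * Real.sin (α / 2) := by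
    have h7 : η ≤ ε := min_le_left _ _
    have h8 : (α / 2) ^ 3 ≤ η * (α / 2) := by
      calc (α / 2) ^ 3 = (α / 2) * (α / 2) * (α / 2) := by ring
        _ ≤ η * 1 * (α / 2) := by gcongr; linarith
        _ = η * (α / 2) := by ring
    nlinarith
  calc (1 - ε) * (r * α) = r * ((1 - ε) * α) := by ring
    _ ≤ r * (2 * Real.sin (α / 2)) := by gcongr
    _ ≤ ‖x - y‖ := h1

/-- A curve that avoids a ball around `c` is at least as long as the arc that it spans. -/
lemma ofReal_angle_le_curveLength {γ : ℝ → ℂ} {K : ℝ≥0} {a b r : ℝ} {c : ℂ} (hab : a ≤ b)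
    (hr : 0 < r) (hγ : LipschitzOnWith K γ (Icc a b)) (hout : ∀ t ∈ Icc a b, r ≤ ‖γ t - c‖) :
    ENNReal.ofReal (r * InnerProductGeometry.angle (γ a - c) (γ b - c)) ≤ curveLength γ a b := by
  rcases eq_or_ne (curveLength γ a b) ⊤ with htop | htop
  · rw [htop]; exact le_top
  rw [← ENNReal.ofReal_toReal htop]
  refine ENNReal.ofReal_le_ofReal ?_
  set A := InnerProductGeometry.angle (γ a - c) (γ b - c)
  set W := (curveLength γ a b).toReal
  have key : ∀ ε : ℝ, 0 < ε → ε < 1 → (1 - ε) * (r * A) ≤ W := fun ε hε hε1 ↦ by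
    obtain ⟨δ, hδ, hloc⟩ := exists_angle_mul_le_norm_sub hr hε
    -- So many equal pieces that each chord has length at most `δ`; the angles of the pieces then
    -- add up by the triangle inequality for angles.
    obtain ⟨N, hN⟩ := exists_nat_gt (K * (b - a) / δ)
    have hN0 : 0 < (N : ℝ) := lt_of_le_of_lt
      (div_nonneg (mul_nonneg K.2 (by linarith)) hδ.le) hN
    set h := (b - a) / N with hh
    have hh0 : 0 ≤ h := div_nonneg (by linarith) hN0.le
    have hhN : N * h = b - a := by rw [hh]; field_simp
    have hKh : K * h ≤ δ := by
      rw [div_lt_iff₀ hδ] at hN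
      have : N * (K * h) ≤ N * δ := by
        calc N * (K * h) = K * (N * h) := by ring
          _ = K * (b - a) := by rw [hhN]
          _ ≤ N * δ := hN.le
      exact le_of_mul_le_mul_left this hN0
    have hmem : ∀ m : ℕ, m ≤ N → a + m * h ∈ Icc a b := fun m hm ↦ by
      have h1 : (m : ℝ) * h ≤ N * h := by gcongr
      exact ⟨by linarith [mul_nonneg (Nat.cast_nonneg (α := ℝ) m) hh0], by linarith⟩
    have ind : ∀ m : ℕ, m ≤ N → ENNReal.ofReal ((1 - ε) * (r *
        InnerProductGeometry.angle (γ a - c) (γ (a + m * h) - c))) ≤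
        curveLength γ a (a + m * h) := by
      intro m
      induction m with
      | zero =>
        intro _
        have hne : γ a - c ≠ 0 := norm_pos_iff.1 (hr.trans_le (hout a ⟨le_rfl, hab⟩))
        simp [InnerProductGeometry.angle_self hne]
      | succ m ih =>
        intro hm
        have hm1 := hmem m (by omega)
        have hm2 := hmem (m + 1) hm
        have hle : a + m * h ≤ a + (m + 1 : ℕ) * h := by push_cast; linarith
        have hsub : Icc (a + m * h) (a + (m + 1 : ℕ) * h) ⊆ Icc a b := Icc_subset_Icc hm1.1 hm2.2
        rw [← curveLength_add γ hm1.1 hle]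
        refine le_trans ?_ (add_le_add (ih (by omega))
          (ofReal_dist_le_curveLength hle (hγ.mono hsub)))
        rw [← ENNReal.ofReal_add (mul_nonneg (by linarith) (mul_nonneg hr.le
          (InnerProductGeometry.angle_nonneg _ _))) dist_nonneg]
        refine ENNReal.ofReal_le_ofReal ?_
        have htri := InnerProductGeometry.angle_le_angle_add_angle (γ a - c) (γ (a + m * h) - c)
          (γ (a + (m + 1 : ℕ) * h) - c)
        have hd : dist (γ (a + m * h)) (γ (a + (m + 1 : ℕ) * h)) ≤ δ := by
          refine (hγ.dist_le_mul _ hm1 _ hm2).trans ?_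
          rw [Real.dist_eq, show a + m * h - (a + (m + 1 : ℕ) * h) = -h by push_cast; ring, abs_neg,
            abs_of_nonneg hh0]
          exact hKh
        have e : γ (a + m * h) - c - (γ (a + (m + 1 : ℕ) * h) - c) =
          γ (a + m * h) - γ (a + (m + 1 : ℕ) * h) := by ring
        have hl := hloc (γ (a + m * h) - c) (γ (a + (m + 1 : ℕ) * h) - c) (hout _ hm1) (hout _ hm2)
          (by rw [e, ← dist_eq_norm]; exact hd)
        rw [e, ← dist_eq_norm] at hl
        have := mul_le_mul_of_nonneg_left (mul_le_mul_of_nonneg_left htri hr.le)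
          (show 0 ≤ 1 - ε by linarith)
        linarith
    have hfin := ind N le_rfl
    rw [hhN, add_sub_cancel, ← ENNReal.ofReal_toReal htop] at hfin
    exact (ENNReal.ofReal_le_ofReal_iff ENNReal.toReal_nonneg).1 hfin
  by_contra! hlt
  have hW0 : 0 ≤ W := ENNReal.toReal_nonneg
  have hrA : 0 < r * A := lt_of_le_of_lt hW0 hlt
  -- With this `ε` the left side of `key` is the midpoint of `W` and `r * A`.
  have h1 := key ((r * A - W) / (2 * (r * A))) (by apply div_pos <;> linarith)
    (by rw [div_lt_one (by positivity)]; linarith)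
  have e : (1 - (r * A - W) / (2 * (r * A))) * (r * A) = (r * A + W) / 2 := by
    have := hrA.ne'
    generalize r * A = z at *
    field_simp
    ring
  rw [e] at h1
  linarith

/-- A curve from `z` that is not longer than the distance between `z` and a ball that it reaches
runs through the whole segment from `z` to this ball. -/
lemma segment_subset_of_curveLength_le {γ : ℝ → ℂ} {K : ℝ≥0} {a b ϱ : ℝ} {c : ℂ} (hab : a ≤ b)
    (hγ : LipschitzOnWith K γ (Icc a b)) (hb : dist (γ b) c ≤ ϱ)
    (hlen : curveLength γ a b ≤ ENNReal.ofReal (dist (γ a) c - ϱ)) (hz : ϱ < dist (γ a) c)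
    (hϱ : 0 ≤ ϱ) {w : ℝ} (hw : w ∈ Icc 0 (dist (γ a) c - ϱ)) :
    ∃ t ∈ Icc a b, γ t = γ a + ((w / dist (γ a) c : ℝ) : ℂ) * (c - γ a) := by
  have hd : 0 < dist (γ a) c := by linarith
  have hbd : dist (γ a) c - ϱ ≤ dist (γ a) (γ b) := by
    linarith [dist_triangle (γ a) (γ b) c]
  have hcont : ContinuousOn (fun t ↦ dist (γ a) (γ t)) (Icc a b) :=
    continuous_dist.comp_continuousOn (continuousOn_const.prodMk hγ.continuousOn)
  obtain ⟨t, ht, hwt⟩ := intermediate_value_Icc hab hcont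
    (show w ∈ Icc _ _ from ⟨by simpa using hw.1, hw.2.trans hbd⟩)
  refine ⟨t, ht, ?_⟩
  simp only at hwt
  have h1 := ofReal_dist_le_curveLength ht.1 (hγ.mono (Icc_subset_Icc_right ht.2))
  have h2 := ofReal_dist_le_curveLength ht.2 (hγ.mono (Icc_subset_Icc_left ht.1))
  have h3 : dist (γ a) (γ t) + dist (γ t) (γ b) ≤ dist (γ a) c - ϱ := by
    rw [← ENNReal.ofReal_le_ofReal_iff (by linarith), ENNReal.ofReal_add dist_nonneg dist_nonneg]
    exact (add_le_add h1 h2).trans ((curveLength_add γ ht.1 ht.2).le.trans hlen)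
  have h4 : dist (γ t) c ≤ dist (γ a) c - w := by
    linarith [dist_triangle (γ t) (γ b) c]
  -- There is equality in the triangle inequality for `γ a`, `γ t`, `c`, which puts `γ t` on the
  -- segment.
  have h5 : dist (γ a) (γ t) = w / dist (γ a) c * dist (γ a) c := by
    rw [hwt]; field_simp
  have h6 : dist (γ t) c = (1 - w / dist (γ a) c) * dist (γ a) c := by
    rw [sub_mul, one_mul, ← h5, hwt]
    linarith [dist_triangle (γ a) (γ t) c]
  have := eq_lineMap_of_dist_eq_mul_of_dist_eq_mul (x := γ a) (y := γ t) (z := c)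
    (r := w / dist (γ a) c) h5 h6
  rw [this, AffineMap.lineMap_apply, vsub_eq_sub, vadd_eq_add, Complex.real_smul, add_comm]

/-- The first time at which a curve reaches a closed set. -/
lemma exists_first_hitting_time {γ : ℝ → ℂ} {b : ℝ} {V : Set ℂ} (hb : 0 ≤ b)
    (hγ : ContinuousOn γ (Icc 0 b)) (hV : IsClosed V) (hbV : γ b ∈ V) :
    ∃ T ∈ Icc 0 b, γ T ∈ V ∧ ∀ t ∈ Ico 0 T, γ t ∉ V := by
  obtain ⟨T, ⟨hT, hTV⟩, hleast⟩ : ∃ T, IsLeast (Icc 0 b ∩ γ ⁻¹' V) T :=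
    (isCompact_Icc.of_isClosed_subset (hγ.preimage_isClosed_of_isClosed isClosed_Icc hV)
      inter_subset_left).exists_isLeast ⟨b, ⟨hb, le_rfl⟩, hbV⟩
  exact ⟨T, hT, hTV, fun t ht h ↦
    (hleast ⟨⟨ht.1, ht.2.le.trans hT.2⟩, h⟩).not_gt ht.2⟩

namespace DiskScene

variable {n : ℕ} (S : DiskScene n)

/-! ### Weighted lengths -/

variable {S}

lemma costFactor_le_one {i : Fin n} {x : ℂ}
    (h : x ∉ Metric.ball (S.center i) (S.radius i)) : S.costFactor i x ≤ 1 := by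
  rw [costFactor, if_neg h]
  split_ifs
  · exact min_le_left _ _
  · exact le_rfl

lemma costFactor_eq_one {i : Fin n} (hi : S.weight i = ⊤) {x : ℂ}
    (h : x ∉ Metric.ball (S.center i) (S.radius i)) : S.costFactor i x = 1 := by
  rw [costFactor, if_neg h, hi]
  simp

lemma costFactor_eq_one_of_notMem {i : Fin n} {x : ℂ} (h : x ∉ S.disk i) :
    S.costFactor i x = 1 := by
  rw [costFactor, if_neg fun h' ↦ h (Metric.ball_subset_closedBall h'),
    if_neg fun h' ↦ h (Metric.sphere_subset_closedBall h')]

lemma costFactor_eq_zero {i : Fin n} (hi : S.weight i = 0) {x : ℂ} (h : x ∈ S.disk i) :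
    S.costFactor i x = 0 := by
  rw [costFactor, hi]
  split_ifs with h1 h2
  · rfl
  · simp
  · rw [disk, ← Metric.ball_union_sphere] at h
    exact absurd h (by simp only [mem_union]; tauto)

lemma cost_pair {i j : Fin n} (h : i ≠ j) (x : ℂ) :
    S.cost {i, j} x = S.costFactor i x * S.costFactor j x := by
  rw [cost, Finset.prod_pair h]

lemma cost_self (i : Fin n) (x : ℂ) : S.cost {i, i} x = S.costFactor i x := by
  simp [cost]

/-- An upper bound for weighted shortest paths by a curve of bounded speed. -/
lemma deltaLength_le_of_curve {i j : Fin n} {γ : ℝ → ℂ} {L : ℝ} {c : ℝ≥0∞} (hL : 0 ≤ L)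
    (hγ : Differentiable ℝ γ) (hd : ∀ t, ‖deriv γ t‖ ≤ L)
    (hc : ∀ t ∈ Icc (0 : ℝ) 1, S.cost {i, j} (γ t) ≤ c) :
    S.deltaLength i j (γ 0) (γ 1) ≤ c * ENNReal.ofReal L := by
  have hLip : LipschitzWith ⟨L, hL⟩ γ := lipschitzWith_of_nnnorm_deriv_le hγ hd
  refine (iInf₂_le γ ⟨⟨_, hLip.lipschitzOnWith⟩, rfl, rfl⟩).trans ?_
  calc S.weightedLength {i, j} γ ≤ ∫⁻ _ in Icc (0 : ℝ) 1, c * ENNReal.ofReal L := by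
        refine MeasureTheory.setLIntegral_mono' measurableSet_Icc fun t ht ↦ ?_
        refine mul_le_mul' (hc t ht) ?_
        rw [← ofReal_norm]
        exact ENNReal.ofReal_le_ofReal (hd t)
    _ = c * ENNReal.ofReal L := by simp

lemma deltaLength_segment_le {i j : Fin n} {p q : ℂ} {c : ℝ≥0∞}
    (hc : ∀ t ∈ Icc (0 : ℝ) 1, S.cost {i, j} (p + t * (q - p)) ≤ c) :
    S.deltaLength i j p q ≤ c * ENNReal.ofReal (dist p q) := by
  have hderiv : ∀ t : ℝ, HasDerivAt (fun t : ℝ ↦ p + t * (q - p)) (q - p) t := fun t ↦ by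
    simpa using ((Complex.ofRealCLM.hasDerivAt (x := t)).mul_const (q - p)).const_add p
  have := deltaLength_le_of_curve (S := S) (i := i) (j := j) (L := dist p q) (c := c)
    (γ := fun t : ℝ ↦ p + t * (q - p)) dist_nonneg (fun t ↦ (hderiv t).differentiableAt)
    (fun t ↦ by rw [(hderiv t).deriv, dist_comm, dist_eq_norm]) hc
  simpa using this

lemma deltaLength_arc_le {i j k : Fin n} {θ a : ℝ} {c : ℝ≥0∞}
    (hc : ∀ t, S.cost {i, j} (S.bdry k t) ≤ c) :
    S.deltaLength i j (S.bdry k θ) (S.bdry k (θ + a)) ≤ c * ENNReal.ofReal (S.radius k * |a|) := by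
  have hr := S.radius_pos k
  have hderiv : ∀ t : ℝ, HasDerivAt (fun t : ℝ ↦ S.bdry k (θ + t * a))
      (S.radius k * (Complex.exp (((θ + t * a : ℝ) : ℂ) * Complex.I) * (a * Complex.I))) t :=
    fun t ↦ by
      have h1 : HasDerivAt (fun t : ℝ ↦ ((θ + t * a : ℝ) : ℂ) * Complex.I) (a * Complex.I) t := by
        have h2 : HasDerivAt (fun t : ℝ ↦ θ + t * a) a t := by
          simpa using ((hasDerivAt_id t).mul_const a).const_add θ
        exact h2.ofReal_comp.mul_const Complex.I
      exact ((h1.cexp).const_mul _).const_add _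
  have := deltaLength_le_of_curve (S := S) (i := i) (j := j) (L := S.radius k * |a|) (c := c)
    (γ := fun t : ℝ ↦ S.bdry k (θ + t * a)) (by positivity)
    (fun t ↦ (hderiv t).differentiableAt) (fun t ↦ by
      rw [(hderiv t).deriv, norm_mul, norm_mul, Complex.norm_exp_ofReal_mul_I]
      simp [abs_of_pos hr]) fun t _ ↦ hc _
  simpa using this

/-! ### Concatenation of paths -/

lemma lintegral_comp_half (F : ℝ → ℝ≥0∞) (b : ℝ) :
    ∫⁻ t in Ioo (b / 2) ((b + 1) / 2), 2 * F (2 * t - b) = ∫⁻ t in Ioo (0 : ℝ) 1, F t := by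
  have himg : (fun t : ℝ ↦ 2 * t - b) '' Ioo (b / 2) ((b + 1) / 2) = Ioo 0 1 := by
    ext x
    simp only [mem_image, mem_Ioo]
    constructor
    · rintro ⟨t, ⟨h1, h2⟩, rfl⟩
      constructor <;> linarith
    · rintro ⟨h1, h2⟩
      exact ⟨(x + b) / 2, ⟨by linarith, by linarith⟩, by ring⟩
  rw [← himg, MeasureTheory.lintegral_image_eq_lintegral_abs_deriv_mul measurableSet_Ioo
    (f' := fun _ ↦ 2) (fun t _ ↦ ?_) (fun x _ y _ h ↦ ?_)]
  · simp
  · simpa using (((hasDerivAt_id t).const_mul 2).sub_const b).hasDerivWithinAt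
  · have : 2 * x - b = 2 * y - b := h
    linarith

/-- Open intervals are needed because the derivative of a concatenation is that of its pieces only
away from the junction and the ends. -/
lemma weightedLength_eq_Ioo (A : Finset (Fin n)) (γ : ℝ → ℂ) :
    S.weightedLength A γ = ∫⁻ t in Ioo (0 : ℝ) 1, S.cost A (γ t) * ‖deriv γ t‖ₑ := by
  rw [weightedLength, MeasureTheory.Measure.restrict_congr_set MeasureTheory.Ioo_ae_eq_Icc]

/-- The path that first runs through `γ₁` and then through `γ₂`. -/
noncomputable def joinPath (γ₁ γ₂ : ℝ → ℂ) (t : ℝ) : ℂ :=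
  -- The `- 0` gives both halves the form `2 * t - b` of `lintegral_comp_half` and
  -- `deriv_comp_affine`.
  if t ≤ 1 / 2 then γ₁ (2 * t - 0) else γ₂ (2 * t - 1)

lemma isPathBetween_joinPath {γ₁ γ₂ : ℝ → ℂ} {p q r : ℂ} (h₁ : IsPathBetween γ₁ p q)
    (h₂ : IsPathBetween γ₂ q r) : IsPathBetween (joinPath γ₁ γ₂) p r := by
  obtain ⟨⟨K₁, hK₁⟩, h10, h11⟩ := h₁
  obtain ⟨⟨K₂, hK₂⟩, h20, h21⟩ := h₂
  refine ⟨⟨2 * max K₁ K₂, LipschitzOnWith.of_dist_le_mul ?_⟩, ?_, ?_⟩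
  · have hA : ∀ x y : ℝ, 0 ≤ x → x ≤ y → y ≤ 1 / 2 →
        dist (joinPath γ₁ γ₂ x) (joinPath γ₁ γ₂ y) ≤ 2 * max (K₁ : ℝ) K₂ * (y - x) :=
      fun x y h0 hxy hy ↦ by
        rw [joinPath, joinPath, if_pos (hxy.trans hy), if_pos hy]
        refine (hK₁.dist_le_mul _ ⟨by linarith, by linarith⟩ _ ⟨by linarith, by linarith⟩).trans ?_
        rw [Real.dist_eq, abs_sub_comm, abs_of_nonneg (by linarith)]
        nlinarith [le_max_left (K₁ : ℝ) K₂]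
    have hj : joinPath γ₁ γ₂ (1 / 2) = q := by rw [joinPath, if_pos le_rfl]; norm_num [h11]
    have hB : ∀ x y : ℝ, 1 / 2 ≤ x → x ≤ y → y ≤ 1 →
        dist (joinPath γ₁ γ₂ x) (joinPath γ₁ γ₂ y) ≤ 2 * max (K₁ : ℝ) K₂ * (y - x) :=
      fun x y h0 hxy hy ↦ by
        have e : ∀ z, 1 / 2 ≤ z → joinPath γ₁ γ₂ z = γ₂ (2 * z - 1) := fun z hz ↦ by
          rcases hz.eq_or_lt with h | h
          · rw [← h, hj]; norm_num [h20]
          · rw [joinPath, if_neg (not_le.2 h)]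
        rw [e x h0, e y (h0.trans hxy)]
        refine (hK₂.dist_le_mul _ ⟨by linarith, by linarith⟩ _ ⟨by linarith, by linarith⟩).trans ?_
        rw [Real.dist_eq, abs_sub_comm, abs_of_nonneg (by linarith)]
        nlinarith [le_max_right (K₁ : ℝ) K₂]
    have hall : ∀ x y : ℝ, 0 ≤ x → x ≤ y → y ≤ 1 →
        dist (joinPath γ₁ γ₂ x) (joinPath γ₁ γ₂ y) ≤ 2 * max (K₁ : ℝ) K₂ * (y - x) :=
      fun x y h0 hxy hy ↦ by
        rcases le_total y (1 / 2) with h | h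
        · exact hA x y h0 hxy h
        rcases le_total (1 / 2) x with h' | h'
        · exact hB x y h' hxy hy
        · have := dist_triangle (joinPath γ₁ γ₂ x) (joinPath γ₁ γ₂ (1 / 2)) (joinPath γ₁ γ₂ y)
          have h3 := hA x (1 / 2) h0 h' le_rfl
          have h4 := hB (1 / 2) y le_rfl h hy
          linarith
    intro x hx y hy
    push_cast
    rcases le_total x y with h | h
    · rw [Real.dist_eq, abs_sub_comm, abs_of_nonneg (by linarith)]
      exact hall x y hx.1 h hy.2
    · rw [Real.dist_eq, abs_of_nonneg (by linarith), dist_comm]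
      exact hall y x hy.1 h hx.2
  · rw [joinPath, if_pos (by norm_num)]; norm_num [h10]
  · rw [joinPath, if_neg (by norm_num)]; norm_num [h21]

lemma deriv_comp_affine (γ : ℝ → ℂ) (b t : ℝ) :
    ‖deriv (fun t ↦ γ (2 * t - b)) t‖ₑ = 2 * ‖deriv γ (2 * t - b)‖ₑ := by
  have h1 := deriv_comp_mul_left (2 : ℝ) (fun t ↦ γ (t - b)) t
  rw [h1, deriv_comp_sub_const, enorm_smul]
  norm_num [Real.enorm_eq_ofReal_abs]

lemma weightedLength_joinPath (A : Finset (Fin n)) (γ₁ γ₂ : ℝ → ℂ) :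
    S.weightedLength A (joinPath γ₁ γ₂) = S.weightedLength A γ₁ + S.weightedLength A γ₂ := by
  have hsplit : S.weightedLength A (joinPath γ₁ γ₂) =
      (∫⁻ t in Ioo (0 / 2 : ℝ) ((0 + 1) / 2), S.cost A (joinPath γ₁ γ₂ t) *
        ‖deriv (joinPath γ₁ γ₂) t‖ₑ) + ∫⁻ t in Ioo (1 / 2 : ℝ) ((1 + 1) / 2),
        S.cost A (joinPath γ₁ γ₂ t) * ‖deriv (joinPath γ₁ γ₂) t‖ₑ := by
    rw [weightedLength, ← MeasureTheory.Measure.restrict_congr_set MeasureTheory.Ioc_ae_eq_Icc,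
      ← Ioc_union_Ioc_eq_Ioc (show (0 : ℝ) ≤ 1 / 2 by norm_num) (show (1 / 2 : ℝ) ≤ 1 by norm_num),
      MeasureTheory.lintegral_union measurableSet_Ioc (Ioc_disjoint_Ioc_of_le le_rfl),
      ← MeasureTheory.Measure.restrict_congr_set MeasureTheory.Ioo_ae_eq_Ioc,
      ← MeasureTheory.Measure.restrict_congr_set MeasureTheory.Ioo_ae_eq_Ioc]
    norm_num
  rw [hsplit, weightedLength_eq_Ioo, weightedLength_eq_Ioo, ← lintegral_comp_half _ 0,
    ← lintegral_comp_half _ 1]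
  congr 1
  · refine MeasureTheory.setLIntegral_congr_fun measurableSet_Ioo fun t ht ↦ ?_
    have hev : joinPath γ₁ γ₂ =ᶠ[nhds t] fun t ↦ γ₁ (2 * t - 0) := by
      filter_upwards [Iio_mem_nhds (show t < 1 / 2 by linarith [ht.2])] with x hx
      exact if_pos (le_of_lt hx)
    simp only [hev.deriv_eq, deriv_comp_affine, hev.self_of_nhds]
    ring
  · refine MeasureTheory.setLIntegral_congr_fun measurableSet_Ioo fun t ht ↦ ?_
    have hev : joinPath γ₁ γ₂ =ᶠ[nhds t] fun t ↦ γ₂ (2 * t - 1) := by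
      filter_upwards [Ioi_mem_nhds (show 1 / 2 < t by linarith [ht.1])] with x hx
      exact if_neg (not_le.2 hx)
    simp only [hev.deriv_eq, deriv_comp_affine, hev.self_of_nhds]
    ring

lemma deltaLength_triangle (i j : Fin n) (p q r : ℂ) :
    S.deltaLength i j p r ≤ S.deltaLength i j p q + S.deltaLength i j q r := by
  refine ENNReal.le_iInf₂_add_iInf₂ fun γ₁ h₁ γ₂ h₂ ↦ ?_
  rw [← weightedLength_joinPath]
  exact iInf₂_le (joinPath γ₁ γ₂) (isPathBetween_joinPath h₁ h₂)

/-- The weighted length is at least the length of an initial part on which the cost is `1`. -/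
lemma curveLength_le_weightedLength {A : Finset (Fin n)} {γ : ℝ → ℂ} {T : ℝ} (hT : T ≤ 1)
    (hc : ∀ t ∈ Ioo 0 T, 1 ≤ S.cost A (γ t)) : curveLength γ 0 T ≤ S.weightedLength A γ := by
  rw [curveLength, weightedLength,
    ← MeasureTheory.Measure.restrict_congr_set MeasureTheory.Ioo_ae_eq_Ioc]
  refine le_trans (MeasureTheory.setLIntegral_mono' measurableSet_Ioo fun t ht ↦ ?_)
    (MeasureTheory.lintegral_mono_set (Ioo_subset_Icc_self.trans (Icc_subset_Icc_right hT)))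
  exact le_mul_of_one_le_left' (hc t ht)

end DiskScene

namespace DiskScene

variable {n : ℕ} {S : DiskScene n}

/-! ### More on adapted coordinates -/

lemma inner_coord {i : Fin n} {φ σ : ℝ} (hσ : σ = 1 ∨ σ = -1) (p q p' q' : ℂ) :
    inner ℝ (p - q) (p' - q') = S.radius i ^ 2 *
      ((S.coordX i φ σ p - S.coordX i φ σ q) * (S.coordX i φ σ p' - S.coordX i φ σ q') +
        (S.coordY i φ p - S.coordY i φ q) * (S.coordY i φ p' - S.coordY i φ q')) := by
  have hr := (S.radius_pos i).ne'
  have h1 := Real.sin_sq_add_cos_sq φ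
  have h2 := sign_sq hσ
  rw [inner_eq_re_im, coordX, coordX, coordX, coordX, coordY, coordY, coordY, coordY]
  simp only [Complex.sub_re, Complex.sub_im]
  field_simp
  rw [h2]
  linear_combination -((p.re - q.re) * (p'.re - q'.re) + (p.im - q.im) * (p'.im - q'.im)) * h1

lemma coord_ext {i : Fin n} {φ σ : ℝ} (hσ : σ = 1 ∨ σ = -1) {p q : ℂ}
    (hX : S.coordX i φ σ p = S.coordX i φ σ q) (hY : S.coordY i φ p = S.coordY i φ q) : p = q := by
  rw [← dist_eq_zero, ← sq_eq_zero_iff, dist_sq_coord hσ, hX, hY]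
  ring

lemma coordX_add_mul (i : Fin n) (φ σ s : ℝ) (p q : ℂ) :
    S.coordX i φ σ (p + s * (q - p)) =
      S.coordX i φ σ p + s * (S.coordX i φ σ q - S.coordX i φ σ p) := by
  simp only [coordX, Complex.sub_re, Complex.sub_im, Complex.add_re, Complex.add_im,
    Complex.re_ofReal_mul, Complex.im_ofReal_mul]
  ring

lemma coordY_add_mul (i : Fin n) (φ s : ℝ) (p q : ℂ) :
    S.coordY i φ (p + s * (q - p)) =
      S.coordY i φ p + s * (S.coordY i φ q - S.coordY i φ p) := by
  simp only [coordY, Complex.sub_re, Complex.sub_im, Complex.add_re, Complex.add_im,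
    Complex.re_ofReal_mul, Complex.im_ofReal_mul]
  ring

lemma coordX_rotate {i : Fin n} {φ σ : ℝ} (hσ : σ = 1 ∨ σ = -1) (t : ℝ) (p : ℂ) :
    S.coordX i (φ + σ * t) σ p =
      S.coordX i φ σ p * Real.cos t - S.coordY i φ p * Real.sin t := by
  rw [coordX, coordX, coordY, cos_add_sign hσ, sin_add_sign hσ]
  linear_combination (-((p - S.center i).im * Real.sin φ + (p - S.center i).re * Real.cos φ) *
    Real.sin t / S.radius i) * sign_sq hσ

lemma coordY_rotate {i : Fin n} {φ σ : ℝ} (hσ : σ = 1 ∨ σ = -1) (t : ℝ) (p : ℂ) :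
    S.coordY i (φ + σ * t) p =
      S.coordX i φ σ p * Real.sin t + S.coordY i φ p * Real.cos t := by
  rw [coordX, coordY, coordY, cos_add_sign hσ, sin_add_sign hσ]
  ring

@[simp] lemma coordX_bdry (i : Fin n) (φ σ : ℝ) : S.coordX i φ σ (S.bdry i φ) = 0 := by
  rw [coordX, Complex.sub_re, Complex.sub_im, bdry_re, bdry_im]
  ring

@[simp] lemma coordY_bdry (i : Fin n) (φ : ℝ) : S.coordY i φ (S.bdry i φ) = 1 := by
  rw [coordY, Complex.sub_re, Complex.sub_im, bdry_re, bdry_im, div_eq_one_iff_eq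
    (S.radius_pos i).ne']
  linear_combination S.radius i * Real.sin_sq_add_cos_sq φ

lemma notMem_ball_iff_coord {i : Fin n} {φ σ : ℝ} (hσ : σ = 1 ∨ σ = -1) {p : ℂ} :
    p ∉ Metric.ball (S.center i) (S.radius i) ↔
      1 ≤ S.coordX i φ σ p ^ 2 + S.coordY i φ p ^ 2 := by
  have hr := S.radius_pos i
  rw [Metric.mem_ball, not_lt, ← sq_le_sq₀ hr.le dist_nonneg,
    dist_sq_coord hσ p (S.center i) (S := S) (i := i)]
  simp only [coordX_center, coordY_center, sub_zero]
  exact le_mul_iff_one_le_right (by positivity)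

lemma angle_bdry_rayPoint {i : Fin n} {φ σ R t : ℝ} (hσ : σ = 1 ∨ σ = -1) (hR : 0 < R)
    (ht : t ∈ Icc 0 Real.pi) :
    InnerProductGeometry.angle (S.bdry i φ - S.center i)
      (S.rayPoint i R (φ + σ * t) - S.center i) = t := by
  have hr := S.radius_pos i
  have h1 : ‖S.bdry i φ - S.center i‖ = S.radius i := by
    rw [← dist_eq_norm]; exact S.bdry_mem_sphere i φ
  have h2 : ‖S.rayPoint i R (φ + σ * t) - S.center i‖ = R := by
    rw [rayPoint, add_sub_cancel_left, norm_mul, Complex.norm_exp_ofReal_mul_I,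
      Complex.norm_of_nonneg hR.le, mul_one]
  rw [InnerProductGeometry.angle, inner_coord hσ (S := S) (i := i) (φ := φ), h1, h2]
  simp only [coordX_center, coordY_center, coordX_bdry, coordY_bdry, sub_zero, zero_mul, zero_add,
    one_mul, coordY_rayPoint hσ]
  rw [show S.radius i ^ 2 * (R / S.radius i * Real.cos t) / (S.radius i * R) = Real.cos t by
    field_simp, Real.arccos_cos ht.1 ht.2]

lemma coordY_pos_of_angle_lt {i : Fin n} {φ : ℝ} {p : ℂ}
    (h : InnerProductGeometry.angle (S.bdry i φ - S.center i) (p - S.center i) < Real.pi / 2) :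
    0 < S.coordY i φ p := by
  have h0 := InnerProductGeometry.angle_nonneg (S.bdry i φ - S.center i) (p - S.center i)
  have h1 := Real.cos_pos_of_mem_Ioo ⟨by linarith [Real.pi_pos], h⟩
  rw [InnerProductGeometry.cos_angle] at h1
  have h2 : 0 < inner ℝ (S.bdry i φ - S.center i) (p - S.center i) := by
    by_contra! h3
    exact h1.not_ge (div_nonpos_of_nonpos_of_nonneg h3 (by positivity))
  rw [inner_coord (Or.inl rfl) (S := S) (i := i) (φ := φ) (σ := 1)] at h2
  simp only [coordX_center, coordY_center, coordX_bdry, coordY_bdry, sub_zero, zero_mul, zero_add,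
    one_mul] at h2
  exact pos_of_mul_pos_right h2 (by positivity)

lemma coord_of_commonTangent {i j : Fin n} {θ σ : ℝ} (hσ : σ = 1 ∨ σ = -1) {v : ℂ}
    (h : S.CommonTangent i j (S.bdry i θ) v) (hX : S.coordX i θ σ v ≠ 0) :
    S.coordY i θ v = 1 ∧ S.coordX i θ σ (S.center j) = S.coordX i θ σ v ∧
      (S.coordY i θ (S.center j) = 1 + S.radius j / S.radius i ∨
        S.coordY i θ (S.center j) = 1 - S.radius j / S.radius i) := by
  have hr := S.radius_pos i
  obtain ⟨-, ⟨-, h1⟩, ⟨h2, h3⟩⟩ := h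
  rw [inner_coord hσ (S := S) (i := i) (φ := θ)] at h1 h3
  simp only [coordX_center, coordY_center, coordX_bdry, coordY_bdry, sub_zero, mul_zero, zero_add,
    mul_one, mul_eq_zero, pow_eq_zero_iff two_ne_zero, hr.ne', false_or] at h1 h3
  have hY : S.coordY i θ v = 1 := by linarith
  rw [hY] at h3
  have hXc : S.coordX i θ σ (S.center j) = S.coordX i θ σ v := by
    have h4 : S.coordX i θ σ v * (S.coordX i θ σ (S.center j) - S.coordX i θ σ v) = 0 := by
      linarith
    rcases mul_eq_zero.1 h4 with h | h
    · exact absurd h hX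
    · linarith
  refine ⟨hY, hXc, ?_⟩
  have h5 : dist v (S.center j) ^ 2 = S.radius j ^ 2 := by rw [Metric.mem_sphere.1 h2]
  rw [dist_sq_coord hσ (S := S) (i := i) (φ := θ), hXc, hY] at h5
  have h6 : (1 - S.coordY i θ (S.center j)) ^ 2 = (S.radius j / S.radius i) ^ 2 := by
    rw [div_pow, eq_div_iff (by positivity)]; linarith
  rcases sq_eq_sq_iff_eq_or_eq_neg.1 h6 with h | h
  · right; linarith
  · left; linarith

lemma TangentAt.notMem_ball {i : Fin n} {z p : ℂ} (h : S.TangentAt i z p) (t : ℝ) :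
    z + t * (p - z) ∉ Metric.ball (S.center i) (S.radius i) := by
  obtain ⟨h1, h2⟩ := h
  rw [Metric.mem_ball, not_lt]
  refine le_of_sq_le_sq ?_ dist_nonneg
  rw [← Metric.mem_sphere.1 h1, dist_sq_eq, dist_sq_eq]
  rw [inner_eq_re_im] at h2
  simp only [Complex.sub_re, Complex.sub_im, Complex.add_re, Complex.add_im,
    Complex.re_ofReal_mul, Complex.im_ofReal_mul] at h2 ⊢
  have h3 : t * ((p.re - z.re) * (z.re - (S.center i).re) +
    (p.im - z.im) * (z.im - (S.center i).im)) = 0 := by rw [h2, mul_zero]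
  linarith [sq_nonneg (t * (p.re - z.re)), sq_nonneg (t * (p.im - z.im))]

/-! ### Curves of tangent edges -/

/-- The path is cut at its first contact with the closed ball of radius `ϱ` around `c`; until then
it has cost `1`, so its Euclidean length is at most its weighted one. The ball is the point `v` if
`D_j` has weight `∞`, and `D_j` itself if it has weight `0`. -/
lemma IsDelta.exists_reach {i j : Fin n} {u v c : ℂ} {ϱ : ℝ} {γ : ℝ → ℂ} (hij : i ≠ j)
    (hi : S.weight i = ⊤) (hγ : S.IsDelta i j u v γ)
    (hfree : ∀ t ∈ Icc (0 : ℝ) 1, ∀ k, γ t ∉ Metric.ball (S.center k) (S.radius k))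
    (hv : dist v c ≤ ϱ)
    (hcost : ∀ x, x ∉ Metric.ball (S.center j) (S.radius j) → ϱ < dist x c →
      S.costFactor j x = 1) :
    ∃ K T, 0 ≤ T ∧ LipschitzOnWith K γ (Icc 0 T) ∧ γ 0 = u ∧ dist (γ T) c ≤ ϱ ∧
      (∀ t ∈ Icc (0 : ℝ) T, ∀ k, γ t ∉ Metric.ball (S.center k) (S.radius k)) ∧
      curveLength γ 0 T ≤ S.deltaLength i j u v := by
  obtain ⟨⟨⟨K, hK⟩, h0, h1⟩, hlen⟩ := hγ
  obtain ⟨T, hT, hTV, hbefore⟩ := exists_first_hitting_time zero_le_one hK.continuousOn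
    (Metric.isClosed_closedBall (x := c) (ε := ϱ)) (by rw [h1]; exact hv)
  refine ⟨K, T, hT.1, hK.mono (Icc_subset_Icc_right hT.2), h0, hTV,
    fun t ht ↦ hfree t ⟨ht.1, ht.2.trans hT.2⟩, ?_⟩
  rw [← hlen]
  refine curveLength_le_weightedLength hT.2 fun t ht ↦ ?_
  have htI : t ∈ Icc (0 : ℝ) 1 := ⟨ht.1.le, ht.2.le.trans hT.2⟩
  rw [cost_pair hij, costFactor_eq_one hi (hfree t htI i), hcost _ (hfree t htI j)
    (not_le.1 (hbefore t ⟨ht.1.le, ht.2⟩)), one_mul]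

lemma costFactor_le_one_of_weight_eq_zero {i : Fin n} (hi : S.weight i = 0) (x : ℂ) :
    S.costFactor i x ≤ 1 := by
  rw [costFactor, hi]
  split_ifs <;> simp

/-- From a point `z` that sees the center of a disk of weight `0`, one reaches each point of this
disk at the cost of the distance between `z` and the disk. -/
lemma deltaLength_le_of_weight_eq_zero {i j : Fin n} (hij : i ≠ j) (hj : S.weight j = 0) {z v : ℂ}
    (hz : S.radius j < dist z (S.center j)) (hv : v ∈ S.disk j)
    (hsee : ∀ t ∈ Icc (0 : ℝ) 1, z + t * (S.center j - z) ∉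
      Metric.ball (S.center i) (S.radius i)) :
    S.deltaLength i j z v ≤ ENNReal.ofReal (dist z (S.center j) - S.radius j) := by
  have hrj := S.radius_pos j
  set d := dist z (S.center j) with hd
  have hd0 : 0 < d := hrj.trans hz
  set s := (d - S.radius j) / d with hs
  have hs0 : 0 ≤ s := div_nonneg (by linarith) hd0.le
  have hs1 : s ≤ 1 := (div_le_one hd0).2 (by linarith)
  set y := z + s * (S.center j - z) with hy
  have hy1 : dist z y = d - S.radius j := by
    rw [dist_comm, dist_eq_norm, hy, add_sub_cancel_left, norm_mul, Complex.norm_of_nonneg hs0,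
      ← dist_eq_norm, dist_comm, ← hd, hs, div_mul_cancel₀ _ hd0.ne']
  have hy2 : y ∈ S.disk j := by
    rw [disk, Metric.mem_closedBall, dist_eq_norm, hy, show z + s * (S.center j - z) - S.center j =
      ((1 - s : ℝ) : ℂ) * (z - S.center j) by push_cast; ring, norm_mul,
      Complex.norm_of_nonneg (by linarith), ← dist_eq_norm, ← hd, sub_mul, hs,
      div_mul_cancel₀ _ hd0.ne']
    linarith
  have h1 : S.deltaLength i j z y ≤ 1 * ENNReal.ofReal (dist z y) := by
    refine deltaLength_segment_le fun t ht ↦ ?_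
    rw [cost_pair hij]
    refine mul_le_one' (costFactor_le_one ?_) (costFactor_le_one_of_weight_eq_zero hj _)
    have := hsee (t * s) ⟨mul_nonneg ht.1 hs0, mul_le_one₀ ht.2 hs0 hs1⟩
    rw [hy]
    convert this using 2
    push_cast
    ring
  have h2 : S.deltaLength i j y v ≤ 0 * ENNReal.ofReal (dist y v) := by
    refine deltaLength_segment_le fun t ht ↦ ?_
    rw [cost_pair hij, costFactor_eq_zero hj, mul_zero]
    exact (convex_closedBall (S.center j) (S.radius j)).add_smul_sub_mem hy2 hv ht
  rw [one_mul, hy1] at h1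
  rw [zero_mul] at h2
  exact (deltaLength_triangle i j z y v).trans ((add_le_add h1 h2).trans (by simp))

/-- `D_j` has a positive gain in one direction, so some neighbor bounds the cell over the whole arc.
This is not `D_j`, since otherwise the start of the tangent would be a distinguished point of type
(1). -/
lemma exists_bounds_of_tangentEdge {P : Fin n → Set ℂ} (hP : S.IsDistinguished P) {i j : Fin n}
    {θ σ τ t₀ : ℝ} {v : ℂ} (he : S.CommonTangent i j (S.bdry i θ) v)
    (harc : ∀ t ∈ Ico 0 τ, S.bdry i (θ + σ * t) ∉ P i) (ht₀ : t₀ ∈ Ico 0 τ)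
    (hg : 0 < S.radius j - S.radius i + proj (S.center j - S.center i) (θ + σ * t₀)) :
    ∃ k, S.Neighbor i k ∧ k ≠ j ∧ ∀ t ∈ Ico 0 τ, S.Bounds i k (θ + σ * t) := by
  have hA : IsPreconnected ((fun t ↦ θ + σ * t) '' Ico 0 τ) :=
    isPreconnected_Ico.image _ (by fun_prop)
  obtain ⟨k, hk, hbd⟩ := S.exists_bounds_on_arc hP hA
    (fun φ ⟨t, ht, h⟩ ↦ h ▸ harc t ht) he.1.symm (mem_image_of_mem _ ht₀)
    ((S.gain_pos_iff he.1.symm).2 hg)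
  refine ⟨k, hk, ?_, fun t ht ↦ hbd _ (mem_image_of_mem _ ht)⟩
  rintro rfl
  have := harc 0 ⟨le_rfl, ht₀.1.trans_lt ht₀.2⟩
  rw [mul_zero, add_zero] at this
  exact this (hP.type1_subset i ⟨k, hk, v, he⟩)

/-- The end of a tangent segment of length `ℓ` of the unit disk lies beyond the tangent at the angle
`ℓ`, so a disk that contains it has positive gain in that direction. -/
lemma one_lt_mul_sin_add_cos {ℓ : ℝ} (h0 : 0 < ℓ) (h1 : ℓ < Real.pi / 2) :
    1 < ℓ * Real.sin ℓ + Real.cos ℓ := by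
  have h2 := Real.mul_le_sin h0.le h1.le
  have h3 := Real.one_sub_sq_div_two_le_cos (x := ℓ)
  have h4 : 1 / 2 < 2 / Real.pi := by
    rw [div_lt_div_iff₀ two_pos Real.pi_pos]; linarith [Real.pi_lt_four]
  nlinarith [mul_le_mul_of_nonneg_left h2 h0.le, mul_pos h0 h0]

end DiskScene

namespace DiskScene

variable {n : ℕ} {S : DiskScene n}

/-! ### Tangent edges are at least as long as the arcs to the next distinguished points -/

lemma proj_le_norm (d : ℂ) (θ : ℝ) : proj d θ ≤ ‖d‖ := by
  refine le_of_sq_le_sq ?_ (norm_nonneg _)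
  rw [norm_sq_eq, proj]
  have := Real.sin_sq_add_cos_sq θ
  have h : (d.re * Real.cos θ + d.im * Real.sin θ) ^ 2 + (d.re * Real.sin θ - d.im * Real.cos θ) ^ 2
    = d.re ^ 2 + d.im ^ 2 := by linear_combination (d.re ^ 2 + d.im ^ 2) * this
  linarith [sq_nonneg (d.re * Real.sin θ - d.im * Real.cos θ)]

/-- A tangent segment to a disk that is reached before the next distinguished point is not free. -/
lemma tangent_segment_not_free {P : Fin n → Set ℂ} (hP : S.IsDistinguished P) {i j : Fin n}
    {θ σ τ t₀ ℓ : ℝ} {v y : ℂ} (hσ : σ = 1 ∨ σ = -1) (he : S.CommonTangent i j (S.bdry i θ) v)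
    (hτ : τ ≤ Real.pi / 2) (harc : ∀ t ∈ Ico 0 τ, S.bdry i (θ + σ * t) ∉ P i) (ht₀ : 0 ≤ t₀)
    (hℓ : 0 < ℓ) (hsum : t₀ + ℓ < τ) (hy : y ∈ S.disk j)
    (hyX : S.coordX i (θ + σ * t₀) σ y = ℓ) (hyY : S.coordY i (θ + σ * t₀) y = 1)
    (hfree : ∀ p k, ∀ w ∈ Icc 0 ℓ, S.coordX i (θ + σ * t₀) σ p = w →
      S.coordY i (θ + σ * t₀) p = 1 → p ∉ Metric.ball (S.center k) (S.radius k)) : False := by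
  have hℓ' : ℓ < Real.pi / 2 := by linarith
  have hshift : ∀ t, θ + σ * t₀ + σ * t = θ + σ * (t₀ + t) := fun t ↦ by ring
  have hg : 0 < S.radius j - S.radius i + proj (S.center j - S.center i) (θ + σ * (t₀ + ℓ)) := by
    have h1 := proj_coord (S := S) (i := i) (φ := θ + σ * t₀) hσ y ℓ
    rw [hshift, hyX, hyY, one_mul] at h1
    have h2 := proj_le_norm (y - S.center j) (θ + σ * (t₀ + ℓ))
    have h3 : ‖y - S.center j‖ ≤ S.radius j := by rw [← dist_eq_norm]; exact hy
    have h4 : proj (y - S.center i) (θ + σ * (t₀ + ℓ)) = proj (y - S.center j) (θ + σ * (t₀ + ℓ)) +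
        proj (S.center j - S.center i) (θ + σ * (t₀ + ℓ)) := by
      simp only [proj, Complex.sub_re, Complex.sub_im]; ring
    have h5 := mul_lt_mul_of_pos_left (one_lt_mul_sin_add_cos hℓ hℓ') (S.radius_pos i)
    linarith
  obtain ⟨k, hN, hkj, hbd⟩ := exists_bounds_of_tangentEdge hP he harc
    (t₀ := t₀ + ℓ) ⟨by linarith, hsum⟩ hg
  refine tangent_segment_blocked hN.1.symm he.1.symm hkj hσ hℓ hℓ' (fun t ht ↦ ?_) hy hyX hyY
    fun p ↦ hfree p k
  rw [hshift]
  exact hbd _ ⟨by linarith [ht.1], by linarith [ht.2]⟩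

/-- `t` is the angle at which a tangent from the center `(X, 1 - r)` touches the unit disk. The
second expression is the length of this tangent; its square is `X² + (1 - r)² - 1`, which exceeds
`r²` because the disks are disjoint. -/
lemma exists_tangency_angle {X r : ℝ} (hX : 0 < X) (hr : 0 < r)
    (hsep : (1 + r) ^ 2 < X ^ 2 + (1 - r) ^ 2) :
    ∃ t ∈ Ioo 0 Real.pi, X * Real.sin t + (1 - r) * Real.cos t = 1 ∧
      r < X * Real.cos t - (1 - r) * Real.sin t := by
  set z : ℂ := ⟨1 - r, X⟩ with hz
  have hre : ‖z‖ * Real.cos z.arg = 1 - r := Complex.norm_mul_cos_arg z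
  have him : ‖z‖ * Real.sin z.arg = X := Complex.norm_mul_sin_arg z
  have hn : 1 + r < ‖z‖ := by
    refine lt_of_pow_lt_pow_left₀ 2 (norm_nonneg _) ?_
    rw [norm_sq_eq]
    simp only [hz]
    linarith
  have hn0 : 0 < ‖z‖ := by linarith
  have h0 : 0 < z.arg := by
    refine lt_of_le_of_ne (Complex.arg_nonneg_iff.2 hX.le) fun h ↦ ?_
    rw [← h, Real.sin_zero, mul_zero] at him
    linarith
  have hfun : ∀ t, X * Real.sin t + (1 - r) * Real.cos t = ‖z‖ * Real.cos (z.arg - t) := fun t ↦ by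
    rw [Real.cos_sub, ← hre, ← him]; ring
  have hfun' : ∀ t, X * Real.cos t - (1 - r) * Real.sin t = ‖z‖ * Real.sin (z.arg - t) :=
    fun t ↦ by rw [Real.sin_sub, ← hre, ← him]; ring
  have hcont : ContinuousOn (fun t ↦ X * Real.sin t + (1 - r) * Real.cos t) (Icc 0 z.arg) := by
    fun_prop
  obtain ⟨t, ht, h1⟩ := intermediate_value_Ioo h0.le hcont
    (show (1 : ℝ) ∈ Ioo _ _ from ⟨by simpa using hr, by
      simp only [hfun, sub_self, Real.cos_zero]; linarith⟩)
  simp only at h1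
  have hπ := Complex.arg_le_pi z
  refine ⟨t, ⟨ht.1, ht.2.trans_le hπ⟩, h1, ?_⟩
  refine lt_of_pow_lt_pow_left₀ 2 ?_ ?_
  · rw [hfun']
    exact mul_nonneg hn0.le (Real.sin_nonneg_of_nonneg_of_le_pi (by linarith [ht.2])
      (by linarith [ht.1]))
  · have h2 : (X * Real.cos t - (1 - r) * Real.sin t) ^ 2 + (X * Real.sin t + (1 - r) * Real.cos t) ^ 2
      = X ^ 2 + (1 - r) ^ 2 := by
      linear_combination (X ^ 2 + (1 - r) ^ 2) * Real.sin_sq_add_cos_sq t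
    rw [h1] at h2
    nlinarith

/-- A curve from `z` to the disk `D_j` that is not longer than their distance is free of disks
only if the segment from `z` to `D_j` is. -/
lemma segment_free_of_curve {i : Fin n} {φ σ ϱ a b : ℝ} {γ : ℝ → ℂ} {K : ℝ≥0} {c : ℂ}
    (hσ : σ = 1 ∨ σ = -1) (hab : a ≤ b) (hγ : LipschitzOnWith K γ (Icc a b))
    (hb : dist (γ b) c ≤ ϱ) (hlen : curveLength γ a b ≤ ENNReal.ofReal (dist (γ a) c - ϱ))
    (hz : ϱ < dist (γ a) c) (hϱ : 0 ≤ ϱ)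
    (hfree : ∀ t ∈ Icc a b, ∀ k, γ t ∉ Metric.ball (S.center k) (S.radius k)) {p : ℂ} (k : Fin n)
    {w : ℝ} (hw : w ∈ Icc 0 ((dist (γ a) c - ϱ) / S.radius i))
    (hX : S.coordX i φ σ p = S.coordX i φ σ (γ a) +
      S.radius i * w / dist (γ a) c * (S.coordX i φ σ c - S.coordX i φ σ (γ a)))
    (hY : S.coordY i φ p = S.coordY i φ (γ a) +
      S.radius i * w / dist (γ a) c * (S.coordY i φ c - S.coordY i φ (γ a))) :
    p ∉ Metric.ball (S.center k) (S.radius k) := by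
  have hr := S.radius_pos i
  obtain ⟨t, ht, h⟩ := segment_subset_of_curveLength_le hab hγ hb hlen hz hϱ
    (w := S.radius i * w) ⟨mul_nonneg hr.le hw.1, by
      have := hw.2; rw [le_div_iff₀ hr] at this; linarith⟩
  have : p = γ t := by
    refine coord_ext (S := S) (i := i) (φ := φ) hσ ?_ ?_
    · rw [h, coordX_add_mul, hX]
    · rw [h, coordY_add_mul, hY]
  rw [this]
  exact hfree t ht k

/-- The case of a tangent edge to a disk of weight `∞`. -/
lemma le_deltaLength_of_weight_eq_top {P : Fin n → Set ℂ} (hP : S.IsDistinguished P) {i j : Fin n}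
    {θ σ τ : ℝ} {v : ℂ} (hσ : σ = 1 ∨ σ = -1) (he : S.TangentEdge i j (S.bdry i θ) v)
    (hX : 0 < S.coordX i θ σ v) (hτ : τ ≤ Real.pi / 2)
    (harc : ∀ t ∈ Ico 0 τ, S.bdry i (θ + σ * t) ∉ P i)
    (hi : S.weight i = ⊤) (hj : S.weight j = ⊤) :
    ENNReal.ofReal (S.radius i * τ) ≤ S.deltaLength i j (S.bdry i θ) v := by
  by_contra! hlt
  obtain ⟨hct, γ, hγ, hfree⟩ := he
  have hr := S.radius_pos i
  have hij := hct.1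
  obtain ⟨hY, -, -⟩ := coord_of_commonTangent hσ hct hX.ne'
  obtain ⟨K, T, hT, hK, h0, hT1, hfreeT, hlen⟩ := hγ.exists_reach (c := v) (ϱ := 0) hij hi hfree
    (by simp) fun x hx _ ↦ costFactor_eq_one hj hx
  have hd : dist (S.bdry i θ) v = S.radius i * S.coordX i θ σ v := by
    rw [← sq_eq_sq₀ dist_nonneg (by positivity), dist_sq_coord hσ (S := S) (i := i) (φ := θ)]
    simp only [coordX_bdry, coordY_bdry, hY]
    ring
  have hup : S.deltaLength i j (S.bdry i θ) v ≤ ENNReal.ofReal (dist (S.bdry i θ) v) := by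
    rw [← one_mul (ENNReal.ofReal _)]
    refine deltaLength_segment_le fun t _ ↦ ?_
    rw [cost_pair hij]
    refine mul_le_one' (costFactor_le_one (hct.2.1.notMem_ball t)) (costFactor_le_one ?_)
    convert hct.2.2.notMem_ball (1 - t) using 2
    push_cast
    ring
  have hlow := ofReal_dist_le_curveLength hT hK
  have hγT : γ T = v := dist_le_zero.1 hT1
  rw [h0, hγT] at hlow
  have hℓ : S.coordX i θ σ v < τ := by
    have h1 := (hlow.trans hlen).trans_lt hlt
    rw [ENNReal.ofReal_lt_ofReal_iff_of_nonneg dist_nonneg, hd] at h1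
    exact lt_of_mul_lt_mul_left h1 hr.le
  refine tangent_segment_not_free hP hσ hct hτ harc le_rfl hX (by rwa [zero_add])
    (Metric.sphere_subset_closedBall hct.2.2.1) (by rw [mul_zero, add_zero])
    (by rw [mul_zero, add_zero, hY]) fun p k w hw hpX hpY ↦ ?_
  rw [mul_zero, add_zero] at hpX hpY
  have hpos : 0 < dist (S.bdry i θ) v := by rw [hd]; positivity
  refine segment_free_of_curve (i := i) (φ := θ) (c := v) (ϱ := 0) hσ hT hK hT1 ?_ ?_ le_rfl hfreeT
    k (w := w) ?_ ?_ ?_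
  · rw [h0, sub_zero]; exact hlen.trans hup
  · rw [h0]; exact hpos
  · rw [h0, sub_zero, hd, mul_div_cancel_left₀ _ hr.ne']; exact hw
  · rw [h0, hpX, hd, coordX_bdry]
    have := hX.ne'
    field_simp
    ring
  · rw [h0, hpY, hY, coordY_bdry]; ring

/-- The case of an inner common tangent that leads to a disk of weight `0`. -/
lemma le_deltaLength_of_inner {P : Fin n → Set ℂ} (hP : S.IsDistinguished P) {i j : Fin n}
    {θ σ τ : ℝ} {v : ℂ} (hσ : σ = 1 ∨ σ = -1) (he : S.TangentEdge i j (S.bdry i θ) v)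
    (hX : 0 < S.coordX i θ σ v) (hτ0 : 0 < τ) (hτ : τ ≤ Real.pi / 2)
    (harc : ∀ t ∈ Ico 0 τ, S.bdry i (θ + σ * t) ∉ P i)
    (hi : S.weight i = ⊤) (hj : S.weight j = 0)
    (hYj : S.coordY i θ (S.center j) = 1 + S.radius j / S.radius i) :
    ENNReal.ofReal (S.radius i * τ) ≤ S.deltaLength i j (S.bdry i θ) v := by
  by_contra! hlt
  obtain ⟨hct, γ, hγ, hfree⟩ := he
  have hr := S.radius_pos i
  have hrj := S.radius_pos j
  have hij := hct.1
  obtain ⟨-, hXj, -⟩ := coord_of_commonTangent hσ hct hX.ne'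
  obtain ⟨K, T, hT, hK, h0, hT1, hfreeT, hlen⟩ := hγ.exists_reach (c := S.center j)
    (ϱ := S.radius j) hij hi hfree (Metric.mem_sphere.1 hct.2.2.1).le
    fun x _ hx ↦ costFactor_eq_one_of_notMem (not_le.2 hx)
  set L := S.coordX i θ σ v with hL
  set d := dist (S.bdry i θ) (S.center j) with hd
  have hdsq : d ^ 2 = S.radius i ^ 2 * (L ^ 2 + (S.radius j / S.radius i) ^ 2) := by
    rw [hd, dist_sq_coord hσ (S := S) (i := i) (φ := θ), hXj, hYj, coordX_bdry, coordY_bdry]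
    ring
  have hdj : S.radius j < d := by
    have := Set.disjoint_left.1 (S.disjoint i j hij)
      (Metric.sphere_subset_closedBall (S.bdry_mem_sphere i θ))
    exact not_le.1 this
  have hup : S.deltaLength i j (S.bdry i θ) v ≤ ENNReal.ofReal (d - S.radius j) := by
    refine deltaLength_le_of_weight_eq_zero hij hj hdj
      (Metric.sphere_subset_closedBall hct.2.2.1) fun t ht ↦ ?_
    rw [notMem_ball_iff_coord hσ (φ := θ), coordX_add_mul, coordY_add_mul, hYj, coordY_bdry]
    have : 0 ≤ t * (S.radius j / S.radius i) := mul_nonneg ht.1 (by positivity)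
    nlinarith [sq_nonneg (S.coordX i θ σ (S.bdry i θ) +
      t * (S.coordX i θ σ (S.center j) - S.coordX i θ σ (S.bdry i θ)))]
  have hlow := ofReal_dist_le_curveLength hT hK
  rw [h0] at hlow
  set ℓ := (d - S.radius j) / S.radius i with hℓ
  have hℓ0 : 0 < ℓ := div_pos (by linarith) hr
  have hℓτ : ℓ < τ := by
    have h1 := (hlow.trans hlen).trans_lt hlt
    rw [ENNReal.ofReal_lt_ofReal_iff_of_nonneg dist_nonneg] at h1
    rw [hℓ, div_lt_iff₀ hr]
    linarith [dist_triangle (S.bdry i θ) (γ T) (S.center j)]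
  have hℓr : ℓ + S.radius j / S.radius i = d / S.radius i := by
    rw [hℓ, ← add_div, sub_add_cancel]
  -- `D_j` lies across the tangent, so its gain is positive already at the start.
  obtain ⟨k, hN, hkj, hbd⟩ := exists_bounds_of_tangentEdge hP hct harc (t₀ := 0) ⟨le_rfl, hτ0⟩ (by
    rw [proj_coord hσ, hYj, Real.sin_zero, Real.cos_zero]
    have : S.radius i * (S.coordX i θ σ (S.center j) * 0 + (1 + S.radius j / S.radius i) * 1) =
      S.radius i + S.radius j := by field_simp; ring
    rw [this]
    linarith)
  have hd0 : 0 < d := by linarith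
  refine inner_segment_blocked hP hN hij.symm hkj hσ hℓ0 (by linarith) hX
    (fun t ht ↦ hbd t ⟨ht.1, by linarith [ht.2]⟩) (fun t ht ↦ harc t ⟨ht.1, by linarith [ht.2]⟩)
    hXj hYj (by rw [hℓr, div_pow, div_eq_iff (by positivity), hdsq]; ring)
    fun p w hw hpX hpY ↦ ?_
  rw [hℓr] at hpX hpY
  refine segment_free_of_curve (i := i) (φ := θ) (c := S.center j) (ϱ := S.radius j) hσ hT hK hT1
    ?_ ?_ hrj.le hfreeT k (w := w) ?_ ?_ ?_
  · rw [h0]; exact hlen.trans hup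
  · rw [h0]; exact hdj
  · rw [h0]; exact hw
  · rw [h0, hpX, coordX_bdry, hXj, ← hd]
    field_simp
    ring
  · rw [h0, hpY, coordY_bdry, hYj, ← hd]
    field_simp
    ring

/-- If a disk that is touched by the tangent of `D_i` at the angle `θ` lies beyond the normal of
`D_i` at the angle `θ + σ * s`, and has a point above the center of `D_i`, then `s < π / 2`. -/
lemma tangency_angle_lt_pi_div_two {i j : Fin n} {θ σ s : ℝ} {v q : ℂ} (hσ : σ = 1 ∨ σ = -1)
    (hs : s ∈ Ioo 0 Real.pi) (hpos : ∀ q ∈ S.disk j, 0 < S.coordX i (θ + σ * s) σ q)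
    (hv : v ∈ S.disk j) (hX : 0 < S.coordX i θ σ v) (hY : S.coordY i θ v = 1) (hq : q ∈ S.disk j)
    (hqY : 0 < S.coordY i θ q) : s < Real.pi / 2 := by
  by_contra! hs2
  have hsin : 0 < Real.sin s := Real.sin_pos_of_mem_Ioo hs
  have hcos : Real.cos s ≤ 0 := Real.cos_nonpos_of_pi_div_two_le_of_le hs2 (by linarith [hs.2])
  have hno : ∀ q ∈ S.disk j, 0 ≤ S.coordX i θ σ q → 0 < S.coordY i θ q → False :=
    fun q hq hq1 hq2 ↦ by
      have h1 := hpos q hq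
      rw [coordX_rotate hσ] at h1
      nlinarith [mul_pos hq2 hsin]
  rcases le_or_gt 0 (S.coordX i θ σ q) with hx | hx
  · exact hno _ hq hx hqY
  · set x := S.coordX i θ σ q
    set L := S.coordX i θ σ v with hL
    set m := -x / (L - x) with hm
    have hLx : 0 < L - x := by linarith
    have hm0 : 0 < m := div_pos (by linarith) hLx
    have hm1 : m ≤ 1 := (div_le_one hLx).2 (by linarith)
    refine hno _ ((convex_closedBall (S.center j) (S.radius j)).add_smul_sub_mem hq hv
      ⟨hm0.le, hm1⟩) ?_ ?_
    · rw [Complex.real_smul, coordX_add_mul, ← hL]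
      refine le_of_eq ?_
      rw [hm, div_mul_cancel₀ _ hLx.ne']
      ring
    · rw [Complex.real_smul, coordY_add_mul, hY]
      linarith [mul_nonneg (sub_nonneg.2 hm1) hqY.le]

set_option maxHeartbeats 800000 in
/-- The case of an outer common tangent that leads to a disk of weight `0`. -/
lemma le_deltaLength_of_outer {P : Fin n → Set ℂ} (hP : S.IsDistinguished P) {i j : Fin n}
    {θ σ τ : ℝ} {v : ℂ} (hσ : σ = 1 ∨ σ = -1) (he : S.TangentEdge i j (S.bdry i θ) v)
    (hX : 0 < S.coordX i θ σ v) (hτ0 : 0 < τ) (hτ : τ ≤ Real.pi / 2)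
    (harc : ∀ t ∈ Ico 0 τ, S.bdry i (θ + σ * t) ∉ P i)
    (hi : S.weight i = ⊤) (hj : S.weight j = 0)
    (hYj : S.coordY i θ (S.center j) = 1 - S.radius j / S.radius i) :
    ENNReal.ofReal (S.radius i * τ) ≤ S.deltaLength i j (S.bdry i θ) v := by
  by_contra! hlt
  obtain ⟨hct, γ, hγ, hfree⟩ := he
  have hr := S.radius_pos i
  have hrj := S.radius_pos j
  have hij := hct.1
  obtain ⟨hYv, hXj, -⟩ := coord_of_commonTangent hσ hct hX.ne'
  obtain ⟨K, T, hT, hK, h0, hT1, hfreeT, hlen⟩ := hγ.exists_reach (c := S.center j)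
    (ϱ := S.radius j) hij hi hfree (Metric.mem_sphere.1 hct.2.2.1).le
    fun x _ hx ↦ costFactor_eq_one_of_notMem (not_le.2 hx)
  set L := S.coordX i θ σ v with hL
  set r := S.radius j / S.radius i with hr_def
  have hrr : 0 < r := div_pos hrj hr
  have hrj' : S.radius j = S.radius i * r := by rw [hr_def]; field_simp
  have hsep : (1 + r) ^ 2 < L ^ 2 + (1 - r) ^ 2 := by
    have h1 := pow_lt_pow_left₀ (S.radius_add_lt hij) (by linarith) two_ne_zero
    rw [norm_sq_coord (φ := θ) hσ, hXj, hYj, hrj'] at h1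
    have h2 : (S.radius i + S.radius i * r) ^ 2 = S.radius i ^ 2 * (1 + r) ^ 2 := by ring
    rw [h2] at h1
    exact lt_of_mul_lt_mul_left h1 (by positivity)
  obtain ⟨s, hs, hs1, hsr⟩ := exists_tangency_angle hX hrr hsep
  set φ := θ + σ * s with hφ
  set g := L * Real.cos s - (1 - r) * Real.sin s with hg
  have hgX : S.coordX i φ σ (S.center j) = g := by rw [hφ, coordX_rotate hσ, hXj, hYj]
  have hgY : S.coordY i φ (S.center j) = 1 := by rw [hφ, coordY_rotate hσ, hXj, hYj, hs1]
  have hsin : 0 < Real.sin s := Real.sin_pos_of_mem_Ioo hs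
  -- the disk `D_j` lies beyond the normal of `D_i` at the tangency point
  have hpos : ∀ q ∈ S.disk j, 0 < S.coordX i φ σ q := fun q hq ↦ by
    by_contra! hq0
    have h1 : dist q (S.center j) ^ 2 ≤ S.radius j ^ 2 := pow_le_pow_left₀ dist_nonneg hq 2
    rw [dist_sq_coord hσ (S := S) (i := i) (φ := φ), hgX, hgY, hrj', mul_pow] at h1
    have h2 := le_of_mul_le_mul_left h1 (by positivity)
    nlinarith [sq_nonneg (S.coordY i φ q - 1)]
  -- The curve avoids the interior of `D_i` and is too short to turn by `τ` around its center. With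
  -- `τ ≤ π / 2` it therefore stays in the half-plane where `coordY i θ` is positive.
  have hangle : ∀ t ∈ Icc 0 T, InnerProductGeometry.angle (S.bdry i θ - S.center i)
      (γ t - S.center i) < τ := fun t ht ↦ by
    have h1 := ofReal_angle_le_curveLength (c := S.center i) ht.1 hr
      (hK.mono (Icc_subset_Icc_right ht.2)) fun t' ht' ↦ by
        have := hfreeT t' ⟨ht'.1, ht'.2.trans ht.2⟩ i
        rwa [Metric.mem_ball, not_lt, dist_eq_norm] at this
    have h2 : curveLength γ 0 t ≤ curveLength γ 0 T := by
      rw [← curveLength_add γ ht.1 ht.2]; exact le_self_add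
    have h3 := ((h1.trans h2).trans hlen).trans_lt hlt
    rw [h0, ENNReal.ofReal_lt_ofReal_iff_of_nonneg
      (mul_nonneg hr.le (InnerProductGeometry.angle_nonneg _ _))] at h3
    exact lt_of_mul_lt_mul_left h3 hr.le
  have hYpos : ∀ t ∈ Icc 0 T, 0 < S.coordY i θ (γ t) := fun t ht ↦
    coordY_pos_of_angle_lt ((hangle t ht).trans_le hτ)
  have hTT : T ∈ Icc 0 T := ⟨hT, le_rfl⟩
  have hγT : γ T ∈ S.disk j := hT1
  have hvj : v ∈ S.disk j := Metric.sphere_subset_closedBall hct.2.2.1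
  have hsπ : s < Real.pi / 2 := tangency_angle_lt_pi_div_two hσ hs hpos hvj hX hYv hγT
    (hYpos T hTT)
  have hcos : 0 < Real.cos s := Real.cos_pos_of_mem_Ioo ⟨by linarith [hs.1, Real.pi_pos], hsπ⟩
  have hcont : ContinuousOn (fun t ↦ S.coordX i φ σ (γ t)) (Icc 0 T) := by
    have : Continuous fun p ↦ S.coordX i φ σ p := by unfold coordX; fun_prop
    exact this.comp_continuousOn hK.continuousOn
  have hstart : S.coordX i φ σ (γ 0) ≤ 0 := by
    rw [h0, hφ, coordX_rotate hσ, coordX_bdry, coordY_bdry]; linarith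
  -- At `t₁` the curve crosses the normal through the tangency point `S.bdry i φ`; `hYpos` places
  -- the crossing on the outward half of this line.
  obtain ⟨t₁, ht₁, hx₁⟩ := intermediate_value_Icc hT hcont
    (show (0 : ℝ) ∈ Icc _ _ from ⟨hstart, (hpos _ hγT).le⟩)
  simp only at hx₁
  set ρ := S.coordY i φ (γ t₁) with hρ
  have hback : ∀ q, S.coordY i θ q =
      S.coordY i φ q * Real.cos s - S.coordX i φ σ q * Real.sin s := fun q ↦ by
    rw [hφ, coordX_rotate hσ, coordY_rotate hσ]
    linear_combination -S.coordY i θ q * Real.sin_sq_add_cos_sq s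
  have hρ0 : 0 < ρ := by
    have h1 := hYpos t₁ ht₁
    rw [hback, hx₁, zero_mul, sub_zero] at h1
    exact pos_of_mul_pos_left h1 hcos.le
  have hz : γ t₁ = S.rayPoint i (S.radius i * ρ) φ := by
    have h1 := coordX_rayPoint (S := S) (i := i) (φ := φ) hσ (S.radius i * ρ) 0
    have h2 := coordY_rayPoint (S := S) (i := i) (φ := φ) hσ (S.radius i * ρ) 0
    rw [mul_zero, add_zero, mul_div_cancel_left₀ _ hr.ne'] at h1 h2
    refine coord_ext (S := S) (i := i) (φ := φ) hσ ?_ ?_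
    · rw [hx₁, h1, Real.sin_zero, mul_zero]
    · rw [h2, Real.cos_zero, mul_one]
  have hlen1 : ENNReal.ofReal (S.radius i * s) ≤ curveLength γ 0 t₁ := by
    have h1 := ofReal_angle_le_curveLength (c := S.center i) ht₁.1 hr
      (hK.mono (Icc_subset_Icc_right ht₁.2)) fun t' ht' ↦ by
        have := hfreeT t' ⟨ht'.1, ht'.2.trans ht₁.2⟩ i
        rwa [Metric.mem_ball, not_lt, dist_eq_norm] at this
    rwa [h0, hz, angle_bdry_rayPoint hσ (by positivity) ⟨hs.1.le, hs.2.le⟩] at h1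
  have hg0 : 0 < g := hrr.trans hsr
  have hzd : dist (S.bdry i φ) (S.center j) = S.radius i * g := by
    rw [← sq_eq_sq₀ dist_nonneg (by positivity), dist_sq_coord hσ (S := S) (i := i) (φ := φ),
      coordX_bdry, coordY_bdry, hgX, hgY]
    ring
  have hzj : S.radius j < dist (S.bdry i φ) (S.center j) := by
    rw [hzd, hrj']; exact mul_lt_mul_of_pos_left hsr hr
  have hup : S.deltaLength i j (S.bdry i θ) v ≤
      ENNReal.ofReal (S.radius i * s) + ENNReal.ofReal (S.radius i * g - S.radius j) := by
    refine (deltaLength_triangle i j _ (S.bdry i φ) v).trans (add_le_add ?_ ?_)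
    · have h1 := deltaLength_arc_le (S := S) (i := i) (j := j) (k := i) (θ := θ) (a := σ * s)
        (c := 1) fun t ↦ by
          rw [cost_pair hij]
          refine mul_le_one' (costFactor_le_one ?_) (costFactor_le_one_of_weight_eq_zero hj _)
          rw [Metric.mem_ball, (S.bdry_mem_sphere i t : dist _ _ = _)]
          exact lt_irrefl _
      have h2 : |σ * s| = s := by
        rw [abs_mul, abs_of_pos hs.1]; rcases hσ with rfl | rfl <;> simp
      rwa [one_mul, h2] at h1
    · rw [← hzd]
      refine deltaLength_le_of_weight_eq_zero hij hj hzj hvj fun t _ ↦ ?_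
      rw [notMem_ball_iff_coord hσ (φ := φ), coordX_add_mul, coordY_add_mul, hgY, coordY_bdry]
      nlinarith [sq_nonneg (S.coordX i φ σ (S.bdry i φ) +
        t * (S.coordX i φ σ (S.center j) - S.coordX i φ σ (S.bdry i φ)))]
  have hsplit := curveLength_add γ ht₁.1 ht₁.2
  -- Reaching the normal already costs as much as the arc in the explicit path of `hup`, which
  -- leaves at most its tangent part for the rest.
  have hlen2 : curveLength γ t₁ T ≤ ENNReal.ofReal (S.radius i * g - S.radius j) := by
    have h1 : ENNReal.ofReal (S.radius i * s) + curveLength γ t₁ T ≤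
        ENNReal.ofReal (S.radius i * s) + ENNReal.ofReal (S.radius i * g - S.radius j) :=
      calc _ ≤ curveLength γ 0 t₁ + curveLength γ t₁ T := by gcongr
        _ ≤ _ := hsplit.le.trans (hlen.trans hup)
    exact (ENNReal.add_le_add_iff_left ENNReal.ofReal_ne_top).1 h1
  have hK₁ := hK.mono (Icc_subset_Icc_left ht₁.1)
  have hlow := ofReal_dist_le_curveLength ht₁.2 hK₁
  have hdist : dist (γ t₁) (S.center j) - S.radius j ≤ dist (γ t₁) (γ T) := by
    linarith [dist_triangle (γ t₁) (γ T) (S.center j)]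
  have hdsq : dist (γ t₁) (S.center j) ^ 2 = S.radius i ^ 2 * (g ^ 2 + (ρ - 1) ^ 2) := by
    rw [dist_sq_coord hσ (S := S) (i := i) (φ := φ), hx₁, hgX, hgY, ← hρ]
    ring
  have hgd : S.radius i * g ≤ dist (γ t₁) (S.center j) := by
    refine le_of_sq_le_sq ?_ dist_nonneg
    rw [hdsq, mul_pow]
    nlinarith [mul_nonneg (sq_nonneg (S.radius i)) (sq_nonneg (ρ - 1))]
  -- Of the points on the normal only the tangency point is that close to `D_j`, so the curve passes
  -- through it.
  have hρ1 : ρ = 1 := by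
    have h1 := hlow.trans hlen2
    rw [ENNReal.ofReal_le_ofReal_iff (by linarith)] at h1
    have h2 : dist (γ t₁) (S.center j) ^ 2 ≤ (S.radius i * g) ^ 2 :=
      pow_le_pow_left₀ dist_nonneg (by linarith) 2
    rw [hdsq, mul_pow] at h2
    have h3 := le_of_mul_le_mul_left h2 (by positivity)
    have h4 : (ρ - 1) ^ 2 = 0 := le_antisymm (by linarith) (sq_nonneg _)
    linarith [pow_eq_zero_iff two_ne_zero |>.1 h4]
  have hzφ : γ t₁ = S.bdry i φ := by rw [hz, hρ1, mul_one]; rfl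
  rw [hzφ, hzd] at hdist
  have hsum : s + (g - r) < τ := by
    have h1 : ENNReal.ofReal (S.radius i * s) + ENNReal.ofReal (S.radius i * g - S.radius j) <
        ENNReal.ofReal (S.radius i * τ) := by
      refine lt_of_le_of_lt ?_ (hlen.trans_lt hlt)
      rw [← hsplit]
      refine add_le_add hlen1 ((ENNReal.ofReal_le_ofReal ?_).trans hlow)
      rw [hzφ]
      exact hdist
    rw [← ENNReal.ofReal_add (mul_nonneg hr.le hs.1.le) (by linarith),
      ENNReal.ofReal_lt_ofReal_iff_of_nonneg (by nlinarith [hs.1]), hrj'] at h1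
    refine lt_of_mul_lt_mul_left (a := S.radius i) ?_ hr.le
    linarith
  have hye : ∃ y ∈ S.disk j, S.coordX i φ σ y = g - r ∧ S.coordY i φ y = 1 := by
    refine ⟨S.bdry i φ + ((g - r) / g : ℝ) * (S.center j - S.bdry i φ), ?_, ?_, ?_⟩
    · rw [disk, Metric.mem_closedBall]
      refine le_of_sq_le_sq (le_of_eq ?_) hrj.le
      rw [dist_sq_coord hσ (S := S) (i := i) (φ := φ), coordX_add_mul, coordY_add_mul, coordX_bdry,
        coordY_bdry, hgX, hgY, hrj']
      field_simp
      ring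
    · rw [coordX_add_mul, coordX_bdry, hgX]; field_simp; ring
    · rw [coordY_add_mul, coordY_bdry, hgY]; ring
  obtain ⟨y, hy, hyX, hyY⟩ := hye
  refine tangent_segment_not_free hP hσ hct hτ harc hs.1.le (sub_pos.2 hsr) hsum hy hyX hyY
    fun p k w hw hpX hpY ↦ ?_
  refine segment_free_of_curve (i := i) (φ := φ) (c := S.center j) (ϱ := S.radius j) hσ ht₁.2 hK₁
    hT1 ?_ ?_ hrj.le (fun t ht ↦ hfreeT t ⟨ht₁.1.trans ht.1, ht.2⟩) k (w := w) ?_ ?_ ?_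
  · rw [hzφ, hzd]; exact hlen2
  · rw [hzφ]; exact hzj
  · rw [hzφ, hzd, hrj', ← mul_sub, mul_div_cancel_left₀ _ hr.ne']; exact hw
  · rw [hzφ, hpX, coordX_bdry, hgX, hzd]
    field_simp
    ring
  · rw [hzφ, hpY, coordY_bdry, hgY]; ring

end DiskScene

namespace DiskScene

variable {n : ℕ} {S : DiskScene n}

lemma bdry_notMem_ball (i : Fin n) (t : ℝ) :
    S.bdry i t ∉ Metric.ball (S.center i) (S.radius i) := by
  rw [Metric.mem_ball, (S.bdry_mem_sphere i t : dist _ _ = _)]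
  exact lt_irrefl _

lemma deltaLength_arc_le_ofReal (i : Fin n) (θ a : ℝ) :
    S.deltaLength i i (S.bdry i θ) (S.bdry i (θ + a)) ≤ ENNReal.ofReal (S.radius i * |a|) := by
  have h := deltaLength_arc_le (S := S) (i := i) (j := i) (k := i) (θ := θ) (a := a) (c := 1)
    fun t ↦ by rw [cost_self]; exact costFactor_le_one (bdry_notMem_ball i t)
  rwa [one_mul] at h

lemma deltaLength_bdry_ne_top (i : Fin n) (θ φ : ℝ) :
    S.deltaLength i i (S.bdry i θ) (S.bdry i φ) ≠ ⊤ := by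
  have h := deltaLength_arc_le_ofReal (S := S) i θ (φ - θ)
  rw [add_sub_cancel] at h
  exact ne_top_of_le_ne_top ENNReal.ofReal_ne_top h

lemma deltaLength_self_of_notMem_ball {i : Fin n} {u : ℂ}
    (hu : u ∉ Metric.ball (S.center i) (S.radius i)) : S.deltaLength i i u u = 0 := by
  have h := deltaLength_segment_le (S := S) (i := i) (j := i) (p := u) (q := u) (c := 1)
    fun t _ ↦ by
      rw [sub_self, mul_zero, add_zero, cost_self]
      exact costFactor_le_one hu
  simpa using h

/-- A tangent edge is at least as long as an arc of angle at most `π / 2` that starts in the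
direction of the edge and has no distinguished points. -/
theorem deltaLength_arc_le_of_tangentEdge {P : Fin n → Set ℂ} (hP : S.IsDistinguished P)
    {i j : Fin n} {θ σ τ : ℝ} {v : ℂ} (hσ : σ = 1 ∨ σ = -1) (he : S.TangentEdge i j (S.bdry i θ) v)
    (hX : 0 < S.coordX i θ σ v) (hτ0 : 0 < τ) (hτ : τ ≤ Real.pi / 2)
    (harc : ∀ t ∈ Ico 0 τ, S.bdry i (θ + σ * t) ∉ P i) :
    S.deltaLength i i (S.bdry i θ) (S.bdry i (θ + σ * τ)) ≤ S.deltaLength i j (S.bdry i θ) v := by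
  have hστ : |σ * τ| = τ := by
    rw [abs_mul, abs_of_pos hτ0]; rcases hσ with rfl | rfl <;> simp
  rcases S.weight_eq i with hi | hi
  · have h := deltaLength_arc_le (S := S) (i := i) (j := i) (k := i) (θ := θ) (a := σ * τ) (c := 0)
      fun t ↦ by
        rw [cost_self, costFactor_eq_zero hi (Metric.sphere_subset_closedBall (S.bdry_mem_sphere i t))]
    rw [zero_mul] at h
    exact h.trans zero_le
  · have h := deltaLength_arc_le_ofReal (S := S) i θ (σ * τ)
    rw [hστ] at h
    refine h.trans ?_
    rcases S.weight_eq j with hj | hj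
    · rcases (coord_of_commonTangent hσ he.1 hX.ne').2.2 with hY | hY
      · exact le_deltaLength_of_inner hP hσ he hX hτ0 hτ harc hi hj hY
      · exact le_deltaLength_of_outer hP hσ he hX hτ0 hτ harc hi hj hY
    · exact le_deltaLength_of_weight_eq_top hP hσ he hX hτ harc hi hj

lemma Consecutive.sub_le {P : Fin n → Set ℂ} (hP : S.IsDistinguished P) {i : Fin n} {α β : ℝ}
    (h : S.Consecutive P i α β) : β - α ≤ Real.pi / 2 := by
  by_contra! hlt
  -- A closed arc of angle `π / 2` in the middle of the gap, away from both of its ends.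
  obtain ⟨φ, hφ, hφP⟩ := hP.gap i (α + (β - α - Real.pi / 2) / 2)
  exact h.2.2.2 φ ⟨by linarith [hφ.1], by linarith [hφ.2]⟩ hφP

lemma Consecutive.deltaLength_le {P : Fin n → Set ℂ} (hP : S.IsDistinguished P) {i j : Fin n}
    {α β θ : ℝ} {v : ℂ} (h : S.Consecutive P i α β) (hθ : θ ∈ Ioo α β)
    (he : S.TangentEdge i j (S.bdry i θ) v) :
    (0 < S.coordX i θ 1 v →
      S.deltaLength i i (S.bdry i θ) (S.bdry i β) ≤ S.deltaLength i j (S.bdry i θ) v) ∧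
    (0 < S.coordX i θ (-1) v →
      S.deltaLength i i (S.bdry i θ) (S.bdry i α) ≤ S.deltaLength i j (S.bdry i θ) v) := by
  have hπ := h.sub_le hP
  obtain ⟨hα, hβ⟩ := hθ
  constructor <;> intro hX
  · have := deltaLength_arc_le_of_tangentEdge hP (Or.inl rfl) he hX (τ := β - θ) (by linarith)
      (by linarith) fun t ht ↦ h.2.2.2 _ ⟨by linarith [ht.1], by linarith [ht.2]⟩
    rwa [one_mul, add_sub_cancel] at this
  · have := deltaLength_arc_le_of_tangentEdge hP (Or.inr rfl) he hX (τ := θ - α) (by linarith)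
      (by linarith) fun t ht ↦ h.2.2.2 _ ⟨by linarith [ht.2], by linarith [ht.1]⟩
    rwa [show θ + -1 * (θ - α) = α by ring] at this

/-! ### Convex chains -/

/-- The tangent of `D_i` at the angle `φ` is a supporting line of `A` through `x`: moving `x` away
from the center leaves the half-plane that contains the hull. -/
lemma mem_frontier_convexHull {i : Fin n} {φ : ℝ} {A : Set ℂ} {x : ℂ}
    (hA : ∀ p ∈ A, S.coordY i φ p ≤ 1) (hx : x ∈ A) (hx1 : S.coordY i φ x = 1) :
    x ∈ frontier (convexHull ℝ A) := by
  have hconv : Convex ℝ {p | S.coordY i φ p ≤ 1} := by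
    intro p hp q hq a b ha hb hab
    simp only [mem_ofPred_eq] at hp hq ⊢
    have e : a • p + b • q = p + b * (q - p) := by
      rw [Complex.real_smul, Complex.real_smul, show a = 1 - b by linarith]
      push_cast
      ring
    rw [e, coordY_add_mul]
    nlinarith
  have hsub : convexHull ℝ A ⊆ {p | S.coordY i φ p ≤ 1} := convexHull_min hA hconv
  refine ⟨subset_closure (subset_convexHull ℝ A hx), fun hint ↦ ?_⟩
  have hlim : Filter.Tendsto (fun ε : ℝ ↦ x + (-ε : ℝ) * (S.center i - x))
      (nhdsWithin 0 (Ioi 0)) (nhds x) := by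
    have h : Continuous fun ε : ℝ ↦ x + (-ε : ℝ) * (S.center i - x) := by fun_prop
    have h0 := h.tendsto 0
    simp only [neg_zero, Complex.ofReal_zero, zero_mul, add_zero] at h0
    exact h0.mono_left nhdsWithin_le_nhds
  obtain ⟨ε, hε, hε0⟩ := ((hlim.eventually (mem_interior_iff_mem_nhds.1 hint)).and
    self_mem_nhdsWithin).exists
  have h1 : S.coordY i φ (x + (-ε : ℝ) * (S.center i - x)) ≤ 1 := hsub hε
  rw [coordY_add_mul, hx1, coordY_center] at h1
  have : 0 < ε := hε0
  linarith

/-- An arc followed by a tangent segment that leads on in the same direction is a convex chain. -/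
lemma isConvexChain_arc_union_segment {i : Fin n} {θ σ τ : ℝ} {v : ℂ} (hσ : σ = 1 ∨ σ = -1)
    (hτ0 : 0 ≤ τ) (hτ : τ ≤ Real.pi / 2) (hX : 0 < S.coordX i θ σ v) (hY : S.coordY i θ v = 1) :
    IsConvexChain (S.arc i (θ + σ * -τ) θ ∪ segment ℝ (S.bdry i θ) v) := by
  have harc : S.arc i (θ + σ * -τ) θ = (fun t ↦ S.bdry i (θ + σ * -t)) '' Icc 0 τ := by
    have h : uIcc (θ + σ * -τ) θ = (fun t ↦ θ + σ * -t) '' Icc 0 τ := by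
      rw [← uIcc_of_le hτ0]
      ext x
      rcases hσ with rfl | rfl
      · simp only [mem_image, mem_uIcc]
        constructor
        · rintro (h | h)
          · exact ⟨θ - x, Or.inl ⟨by linarith, by linarith⟩, by ring⟩
          · exact ⟨θ - x, Or.inl ⟨by linarith, by linarith⟩, by ring⟩
        · rintro ⟨t, ht | ht, rfl⟩
          · exact Or.inl ⟨by linarith, by linarith⟩
          · exact Or.inl ⟨by linarith, by linarith⟩
      · simp only [mem_image, mem_uIcc]
        constructor
        · rintro (h | h)
          · exact ⟨x - θ, Or.inl ⟨by linarith, by linarith⟩, by ring⟩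
          · exact ⟨x - θ, Or.inl ⟨by linarith, by linarith⟩, by ring⟩
        · rintro ⟨t, ht | ht, rfl⟩
          · exact Or.inr ⟨by linarith, by linarith⟩
          · exact Or.inr ⟨by linarith, by linarith⟩
    rw [arc, h, image_image]
  have hseg : ∀ p ∈ segment ℝ (S.bdry i θ) v, ∃ w : ℝ, 0 ≤ w ∧
      S.coordX i θ σ p = w * S.coordX i θ σ v ∧ S.coordY i θ p = 1 := by
    intro p hp
    rw [segment_eq_image'] at hp
    obtain ⟨w, hw, rfl⟩ := hp
    refine ⟨w, hw.1, ?_, ?_⟩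
    · simp only [Complex.real_smul, coordX_add_mul, coordX_bdry]; ring
    · simp only [Complex.real_smul, coordY_add_mul, coordY_bdry, hY]; ring
  -- The tangent at each point of the arc supports the whole chain; the one at the angle `θ` also
  -- serves the points of the segment.
  have hle : ∀ t ∈ Icc 0 τ, ∀ p ∈ S.arc i (θ + σ * -τ) θ ∪ segment ℝ (S.bdry i θ) v,
      S.coordY i (θ + σ * -t) p ≤ 1 := by
    rintro t ht p (hp | hp)
    · rw [harc] at hp
      obtain ⟨s, -, rfl⟩ := hp
      have h := coordY_rayPoint (S := S) (i := i) (φ := θ + σ * -t) hσ (S.radius i) (t - s)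
      rw [show θ + σ * -t + σ * (t - s) = θ + σ * -s by ring, div_self (S.radius_pos i).ne',
        one_mul] at h
      exact h.le.trans (Real.cos_le_one _)
    · obtain ⟨w, hw, h1, h2⟩ := hseg p hp
      rw [coordY_rotate hσ, h1, h2, Real.sin_neg, Real.cos_neg]
      have h3 := Real.sin_nonneg_of_nonneg_of_le_pi ht.1 (by linarith [ht.2, Real.pi_pos])
      have h4 := Real.cos_le_one t
      have h5 := mul_nonneg (mul_nonneg hw hX.le) h3
      linarith
  rintro x hx
  have hx' := hx
  rcases hx' with h | h
  · rw [harc] at h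
    obtain ⟨t, ht, rfl⟩ := h
    exact mem_frontier_convexHull (hle t ht) hx (coordY_bdry i _)
  · obtain ⟨w, -, -, h1⟩ := hseg x h
    refine mem_frontier_convexHull (hle 0 ⟨le_rfl, hτ0⟩) hx ?_
    rwa [neg_zero, mul_zero, add_zero]

lemma coordX_neg (i : Fin n) (θ σ : ℝ) (p : ℂ) : S.coordX i θ (-σ) p = -S.coordX i θ σ p := by
  rw [coordX, coordX]; ring

lemma CommonTangent.coordX_ne_zero {i j : Fin n} {θ σ : ℝ} (hσ : σ = 1 ∨ σ = -1) {v : ℂ}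
    (h : S.CommonTangent i j (S.bdry i θ) v) : S.coordX i θ σ v ≠ 0 := by
  intro hX
  have hr := S.radius_pos i
  obtain ⟨hij, ⟨-, h1⟩, ⟨h2, -⟩⟩ := h
  rw [inner_coord hσ (S := S) (i := i) (φ := θ)] at h1
  simp only [coordX_center, coordY_center, coordX_bdry, coordY_bdry, sub_zero, mul_zero, zero_add,
    mul_one, mul_eq_zero, pow_eq_zero_iff two_ne_zero, hr.ne', false_or] at h1
  have hv : v = S.bdry i θ := coord_ext hσ (by rw [hX, coordX_bdry])
    (by rw [coordY_bdry]; linarith)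
  exact Set.disjoint_left.1 (S.disjoint i j hij)
    (Metric.sphere_subset_closedBall (S.bdry_mem_sphere i θ))
    (hv ▸ Metric.sphere_subset_closedBall h2)

/-! ### The coalesced graph -/

lemma PassesAlong.coordX_pos {i : Fin n} {s : Bool} {θ : ℝ} {v : ℂ}
    (h : S.PassesAlong i s (S.bdry i θ) (v - S.bdry i θ)) :
    0 < S.coordX i θ (if s then 1 else -1) v := by
  obtain ⟨r, hr, h⟩ := h
  have hri := S.radius_pos i
  have h1 := Real.sin_sq_add_cos_sq θ
  have hre := congrArg Complex.re h
  have him := congrArg Complex.im h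
  rw [Complex.re_ofReal_mul, Complex.I_mul_re, Complex.sub_re, Complex.sub_im, bdry_re,
    bdry_im] at hre
  rw [Complex.im_ofReal_mul, Complex.I_mul_im, Complex.sub_im, Complex.sub_re, bdry_re,
    bdry_im] at him
  have e : S.coordX i θ (if s then 1 else -1) v = r := by
    rw [coordX, div_eq_iff hri.ne', Complex.sub_re, Complex.sub_im]
    cases s
    · simp only [Bool.false_eq_true, if_false] at hre him ⊢
      linear_combination -(Real.cos θ * him - Real.sin θ * hre) + r * S.radius i * h1
    · simp only [if_true] at hre him ⊢
      linear_combination Real.cos θ * him - Real.sin θ * hre + r * S.radius i * h1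
  rwa [e]

/-- The host interval is traversed in the direction of the edge, so its target is the end of the arc
to which the comparison applies. Finiteness makes the difference in `EReal` non-negative. -/
lemma Host.deltaLength_le {P : Fin n → Set ℂ} (hP : S.IsDistinguished P) {i j : Fin n} {u v : ℂ}
    {a : DirectedInterval n} (he : S.TangentEdge i j u v) (ha : S.Host P i u (v - u) a) :
    S.deltaLength i i u a.tgt ≤ S.deltaLength i j u v ∧ S.deltaLength i i u a.tgt ≠ ⊤ := by
  cases ha with
  | point s hx hd =>
    have h : S.deltaLength i i u u = 0 := deltaLength_self_of_notMem_ball fun hb ↦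
      (Metric.mem_ball.1 hb).ne (Metric.mem_sphere.1 he.1.2.1.1)
    simp only [h]
    exact ⟨zero_le, ENNReal.zero_ne_top⟩
  | interval s θ₁ θ θ₂ hcons hθ hx hd =>
    subst hx
    refine ⟨?_, deltaLength_bdry_ne_top i θ θ₂⟩
    have hX := hd.coordX_pos
    cases s
    · simp only [ConsecutiveDir, Bool.false_eq_true, if_false] at hcons hX
      rw [min_eq_right hcons.1.le, max_eq_left hcons.1.le] at hθ
      exact (hcons.deltaLength_le hP hθ he).2 hX
    · simp only [ConsecutiveDir, if_true] at hcons hX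
      rw [min_eq_left hcons.1.le, max_eq_right hcons.1.le] at hθ
      exact (hcons.deltaLength_le hP hθ he).1 hX

end DiskScene

theorem mainTheorem8 {n : ℕ} (S : DiskScene n) (P : Fin n → Set ℂ) (hP : S.IsDistinguished P) :
    (∀ (i j : Fin n) (u v : ℂ), S.TangentEdge i j u v →
      ∀ α β θ : ℝ, S.Consecutive P i α β → θ ∈ Set.Ioo α β → u = S.bdry i θ →
      ∀ φ : ℝ, (φ = α ∨ φ = β) →
        ¬ IsConvexChain (S.arc i φ θ ∪ segment ℝ u v) →
        S.deltaLength i i u (S.bdry i φ) ≤ S.deltaLength i j u v) ∧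
    (∀ (a b : DirectedInterval n) (w : EReal), S.CoalescedEdge P a b w → 0 ≤ w) := by
  constructor
  · rintro i j _ v he α β θ hcons hθ rfl φ hφ hnot
    have hπ := hcons.sub_le hP
    have hX := he.1.coordX_ne_zero (Or.inl rfl)
    have hY := (DiskScene.coord_of_commonTangent (Or.inl rfl) he.1 hX).1
    have hneg := DiskScene.coordX_neg (S := S) i θ 1 v
    obtain ⟨hα, hβ⟩ := hθ
    rcases hφ with rfl | rfl
    · refine (hcons.deltaLength_le hP ⟨hα, hβ⟩ he).2 ?_
      rw [hneg, Left.neg_pos_iff]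
      -- If the edge led away from this end of the interval, it would form a convex chain with the
      -- arc.
      by_contra! hX0
      have := DiskScene.isConvexChain_arc_union_segment (Or.inl rfl) (τ := θ - φ) (by linarith)
        (by linarith) (lt_of_le_of_ne hX0 hX.symm) hY
      rw [show θ + 1 * -(θ - φ) = φ by ring] at this
      exact hnot this
    · refine (hcons.deltaLength_le hP ⟨hα, hβ⟩ he).1 ?_
      by_contra! hX0
      have := DiskScene.isConvexChain_arc_union_segment (S := S) (i := i) (θ := θ) (v := v)
        (Or.inr rfl) (τ := φ - θ) (by linarith) (by linarith)
        (by rw [hneg, Left.neg_pos_iff]; exact lt_of_le_of_ne hX0 hX) hY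
      rw [show θ + -1 * -(φ - θ) = φ by ring] at this
      exact hnot this
  · rintro _ _ _ (⟨i, j, u, v, a, b, he, ha, hb⟩ | ⟨i, s, θ₁, θ₂, hcons⟩ | _)
    · obtain ⟨h1, h2⟩ := ha.deltaLength_le hP he
      refine add_nonneg ?_ (EReal.coe_ennreal_nonneg _)
      rw [EReal.sub_nonneg (Or.inr (by simpa using h2)) (Or.inr (EReal.coe_ennreal_ne_bot _))]
      exact EReal.coe_ennreal_le_coe_ennreal_iff.2 h1
    · exact EReal.coe_ennreal_nonneg _
    · exact le_rfl
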